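/- **Notation.** Let $F$ be a totally real number field with ring of integers $\mathfrak o$ and different $\mathfrak d$; $\mathbf a,\mathbf h$ its sets of archimedean and finite places; $\mathbb A$ its adele ring; $x_{\mathbf a},x_{\mathbf h}$ the archimedean and finite parts of an adelic object $x$. Let $n,l\ge 1$. Put $e(x)=e^{2\pi i x}$, $\mathbf e_{\mathbf a}(x)=\prod_{v\in\mathbf a}e(x_v)$, ${}^tx$ = transpose, $\tilde q={}^tq^{-1}$, $S[x]={}^txSx$, and for a family $x=(x_v)_{v\in\mathbf a}$ and $k\in\mathbb Z^{\mathbf a}$, $x_{\mathbf a}^k=\prod_{v\in\mathbf a}x_v^{k_v}$. Let $\Psi=\mathbf e_{\mathbb A}=\prod_v\Psi_v:\mathbb A/F\to\mathbb C^\times$ with $\Psi_v=e_v$, $\Psi_v(x)=e(x)$ for $v\in\mathbf a$, and for $v\in\mathbf h$ above $p$, $\Psi_v(x)=e(-y)$ where $y\in\mathbb Z[1/p]$, $\mathrm{Tr}_{F_v/\mathbb Q_p}(x)-y\in\mathbb Z_p$. The Jacobi group $\boldsymbol G=H\rtimes \mathrm{Sp}_n$ consists of $(\lambda,\mu,\kappa)g$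 with $\lambda,\mu\in M_{l,n}$, $\kappa\in \mathrm{Sym}_l$, $g\in\mathrm{Sp}_n$, and $(\lambda,\mu,\kappa)g(\lambda',\mu',\kappa')g'=(\lambda+\hat\lambda,\mu+\hat\mu,\kappa+\kappa'+\lambda{}^t\hat\mu+\hat\mu{}^t\lambda+\hat\lambda{}^t\hat\mu-\lambda'{}^t\mu')gg'$, $(\hat\lambda\ \hat\mu)=(\lambda'\ \mu')g^{-1}$. It acts at each archimedean place on $\mathcal H=\prod_{v\in\mathbf a}(\mathbb H_n\times M_{l,n}(\mathbb C))$ by $(\tau,w)\mapsto(g\tau,\,w(c\tau+d)^{-1}+\lambda\, g\tau+\mu)$, $g=\begin{pmatrix}a&b\\c&d\end{pmatrix}$; $\mathbf i_0=(i1_n,0)_v$. For $k\in\mathbb Z^{\mathbf a}$ and $S\in\mathrm{Sym}_l(F)$ let $J_{k,S}((\lambda,\mu,\kappa)g,(\tau,w))=\prod_{v\in\mathbf a}\det(c\tau+d)^{k}e\big(-\mathrm{tr}(S\kappa)+\mathrm{tr}(S[w](c\tau+d)^{-1}c)-2\mathrm{tr}({}^t\lambda Sw(c\tau+d)^{-1})-\mathrm{tr}(S[\lambda]g\tau)\big)$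 (all data at $v$) and $(f|_{k,S}\boldsymbol y)(z)=J_{k,S}(\boldsymbol y,z)^{-1}f(\boldsymbol yz)$. Let $\mathfrak b\neq0$ be a fractional ideal, $\mathfrak c\ne 0$ an integral ideal. $K_{\mathbf h}[\mathfrak b,\mathfrak c]\subset\boldsymbol G_{\mathbf h}$ is the group of $(\lambda,\mu,\kappa)\begin{pmatrix}a&b\\c&d\end{pmatrix}$ whose entries at every $v\in\mathbf h$ satisfy $\lambda,a,d\in\mathfrak o_v$; $\mu,\kappa,b\in\mathfrak b_v^{-1}$; $c\in\mathfrak b_v\mathfrak c_v$. Put $K=K[\mathfrak b,\mathfrak c]=K_{\mathbf h}[\mathfrak b,\mathfrak c]\boldsymbol G_{\mathbf a}$ and $K_0=K_{\mathbf h}[\mathfrak b,\mathfrak c]\times K_\infty$, $K_\infty$ the stabilizer of $\mathbf i_0$ in $\boldsymbol G_{\mathbf a}$. Let $\mathcal T_m=\{x\in \mathrm{Sym}_m(F):\mathrm{tr}(xy)\in\mathfrak o\ \forall y\in\mathrm{Sym}_m(\mathfrak o)\}$, $S\in\mathfrak b\mathfrak d^{-1}\mathcal T_l$, and let $\chi:\mathbb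 A^\times/F^\times\to\mathbb C^\times$ be a Hecke character of finite order with $\chi_v(x)=1$ for $v\in\mathbf h$, $x\in\mathfrak o_v^\times$, $x-1\in\mathfrak c_v$; put $\chi(w)=\prod_{v|\mathfrak c}\chi_v(\det a_w)^{-1}$ for $w\in K_0$. An adelic Siegel–Jacobi form $\mathbf f\in\mathcal M^n_{k,S}(K[\mathfrak b,\mathfrak c],\chi)$ is a function $\mathbf f:\boldsymbol G(\mathbb A)\to\mathbb C$ such that (i) $\mathbf f((0,0,\kappa)\gamma\boldsymbol gw)=\chi(w)J_{k,S}(w,\mathbf i_0)^{-1}\Psi(\mathrm{tr}(S\kappa))\mathbf f(\boldsymbol g)$ for $\kappa\in \mathrm{Sym}_l(\mathbb A)$, $\gamma\in\boldsymbol G(F)$, $\boldsymbol g\in\boldsymbol G(\mathbb A)$, $w\in K_0$; (ii) for every $\boldsymbol g\in\boldsymbol G_{\mathbf h}$ the function $f_{\boldsymbol g}$ on $\mathcal H$ with $(f_{\boldsymbol g}|_{k,S}\boldsymbol y)(\mathbf i_0)=\mathbf f(\boldsymbol g\boldsymbol y)$ for all $\boldsymbol y\in\boldsymbol G_{\mathbf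 a}$ is a Siegel–Jacobi modular form for $\Gamma^{\boldsymbol g}=\boldsymbol G(F)\cap\boldsymbol gK\boldsymbol g^{-1}$: it is holomorphic, transforms under $|_{k,S}\gamma$, $\gamma\in\Gamma^{\boldsymbol g}$, by a character of $\Gamma^{\boldsymbol g}$, and for each $g\in \mathrm{Sp}_n(F)$, $f_{\boldsymbol g}|_{k,S}g$ has an (absolutely convergent) expansion $\sum_{t\in L,t\ge0}\sum_{r\in M}c(t,r)\mathbf e_{\mathbf a}(\mathrm{tr}(t\tau))\mathbf e_{\mathbf a}(\mathrm{tr}({}^trw))$ with lattices $L\subset\mathrm{Sym}_n(F)$, $M\subset M_{l,n}(F)$; here $t\ge0$ means that $t_v$ is positive semidefinite for all $v\in\mathbf a$. **Proposition.** Let $\mathbf f\in\mathcal M^n_{k,S}(K[\mathfrak b,\mathfrak c],\chi)$. There are complex numbers $c_0(t,r;q,\lambda)$ ($t\in M_n(F)$, $r\in M_{l,n}(F)$) depending on $q\in \mathrm{GL}_n(\mathbb A)$ and $\lambda\in M_{l,n}(\mathbb A)$ only through $q_{\mathbf h},\lambda_{\mathbf h}$, and lattices $L\subset \mathrm{Sym}_n(F)$,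 $M\subset M_{l,n}(F)$ depending only on $q_{\mathbf h},\lambda_{\mathbf h}$, with $c_0(t,r;q,\lambda)=0$ unless $t\in L$, $t\ge0$, $r\in M$, such that, for all $q\in\mathrm{GL}_n(\mathbb A)$, $\lambda,\mu\in M_{l,n}(\mathbb A)$, $\sigma\in\mathrm{Sym}_n(\mathbb A)$, $$\mathbf f\left((\lambda,\mu,0)\begin{pmatrix}q&\sigma\tilde q\\0&\tilde q\end{pmatrix}\right)=\sum_{t\in L,\ t\ge0}\ \sum_{r\in M}c(t,r;q,\lambda)\,\mathbf e_{\mathbb A}(\mathrm{tr}(t\sigma))\,\mathbf e_{\mathbb A}(\mathrm{tr}({}^tr\lambda\sigma+{}^tr\mu))$$ (absolutely convergent), where 1. $c(t,r;q,\lambda)=c_\sigma(t,r;q,\lambda)=\Psi(\mathrm{tr}(S[\lambda]\sigma))\,\mathbf e_{\mathbf a}(\mathrm{tr}(S[\lambda](iq\,{}^tq)))\,(\det q)_{\mathbf a}^k\,\mathbf e_{\mathbf a}(i\,\mathrm{tr}({}^tqtq+{}^tq\,{}^tr\lambda q))\,c_0(t,r;q,\lambda)$; 2. for all $a\in \mathrm{GL}_n(F)$: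 $c_{a\sigma{}^ta}(t,r;aq,\lambda a^{-1})=\chi(\det a)\,c_\sigma({}^tata,ra;q,\lambda)$; 3. if $\lambda_vq_v\in M_{l,n}(\mathfrak o_v)$ for all $v\in\mathbf h$, then $c(t,r;q,\lambda)\ne0$ only if, for every $v\in\mathbf h$, $({}^tqtq)_v\in(\mathfrak b\mathfrak d^{-1}\mathcal T_n)_v$ and $e_v(\mathrm{tr}({}^tq_v\,{}^tr_v\,x))=1$ for all $x\in M_{l,n}(\mathfrak b_v^{-1})$. -/

import Mathlib

open Matrix NumberField IsDedekindDomain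
open scoped nonZeroDivisors

namespace SiegelJacobi
section group
variable {n l : ℕ} {R : Type*} [CommRing R]

/-- `(x₁ x₂), (y₁ y₂) ↦ x₁ ᵗy₂`. -/
def blockPair (x y : Matrix (Fin l) (Fin n ⊕ Fin n) R) : Matrix (Fin l) (Fin l) R :=
  x.toCols₁ * y.toCols₂ᵀ

theorem blockPair_add_left (x x' y : Matrix (Fin l) (Fin n ⊕ Fin n) R) :
    blockPair (x + x') y = blockPair x y + blockPair x' y := by
  have : (x + x').toCols₁ = x.toCols₁ + x'.toCols₁ := rfl
  rw [blockPair, this, Matrix.add_mul]; rfl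

theorem blockPair_add_right (x y y' : Matrix (Fin l) (Fin n ⊕ Fin n) R) :
    blockPair x (y + y') = blockPair x y + blockPair x y' := by
  have : (y + y').toCols₂ = y.toCols₂ + y'.toCols₂ := rfl
  rw [blockPair, this, Matrix.transpose_add, Matrix.mul_add]; rfl

theorem blockPair_neg_left (x y : Matrix (Fin l) (Fin n ⊕ Fin n) R) :
    blockPair (-x) y = -blockPair x y := by
  have : (-x).toCols₁ = -x.toCols₁ := rfl
  rw [blockPair, this, Matrix.neg_mul]; rfl

theorem blockPair_neg_right (x y : Matrix (Fin l) (Fin n ⊕ Fin n) R) :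
    blockPair x (-y) = -blockPair x y := by
  have : (-y).toCols₂ = -y.toCols₂ := rfl
  rw [blockPair, this, Matrix.transpose_neg, Matrix.mul_neg]; rfl

theorem blockPair_transpose_sub (x y : Matrix (Fin l) (Fin n ⊕ Fin n) R) :
    (blockPair x y)ᵀ - blockPair y x = y * Matrix.J (Fin n) R * xᵀ := by
  conv_rhs => rw [← Matrix.fromCols_toCols x, ← Matrix.fromCols_toCols y]
  rw [Matrix.J, Matrix.transpose_fromCols, Matrix.fromCols_mul_fromBlocks,
    Matrix.fromCols_mul_fromRows]
  simp [blockPair, Matrix.transpose_mul, sub_eq_add_neg]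

theorem blockPair_symplectic (x y : Matrix (Fin l) (Fin n ⊕ Fin n) R)
    (g : Matrix.symplecticGroup (Fin n) R) :
    (blockPair (x * g.1) (y * g.1))ᵀ - blockPair (y * g.1) (x * g.1)
      = (blockPair x y)ᵀ - blockPair y x := by
  have h := SymplecticGroup.mem_iff.1 g.2
  rw [blockPair_transpose_sub, blockPair_transpose_sub, Matrix.transpose_mul]
  calc _ = y * (g.1 * Matrix.J (Fin n) R * g.1ᵀ) * xᵀ := by simp only [Matrix.mul_assoc]
    _ = _ := by rw [h]

end group

/-- The Jacobi group `𝐆^{n,l}(R) = H^{n,l}(R) ⋊ Sp_n(R)`, with elements `(λ,μ,κ) g`. -/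
@[ext]
structure JacobiGroup (n l : ℕ) (R : Type*) [CommRing R] where
  lam : Matrix (Fin l) (Fin n) R
  mu : Matrix (Fin l) (Fin n) R
  kap : Matrix (Fin l) (Fin l) R
  kap_symm : kap.IsSymm
  g : Matrix.symplecticGroup (Fin n) R

namespace JacobiGroup
variable {n l : ℕ} {R : Type*} [CommRing R]

/-- `(λ μ)`. -/
def row (x : JacobiGroup n l R) : Matrix (Fin l) (Fin n ⊕ Fin n) R := Matrix.fromCols x.lam x.mu

/-- `(λ' μ') g⁻¹`. -/
def tw (x y : JacobiGroup n l R) : Matrix (Fin l) (Fin n ⊕ Fin n) R :=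
  Matrix.fromCols y.lam y.mu * (x.g⁻¹ : Matrix.symplecticGroup (Fin n) R).1

theorem mul_symm_aux (x y : JacobiGroup n l R) :
    (x.kap + y.kap + x.lam * (tw x y).toCols₂ᵀ + (tw x y).toCols₂ * x.lamᵀ
      + (tw x y).toCols₁ * (tw x y).toCols₂ᵀ - y.lam * y.muᵀ).IsSymm := by
  have h := blockPair_symplectic y.row y.row x.g⁻¹
  have h1 : blockPair (y.row * (x.g⁻¹ : Matrix.symplecticGroup (Fin n) R).1)
    (y.row * (x.g⁻¹ : Matrix.symplecticGroup (Fin n) R).1)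
      = (tw x y).toCols₁ * (tw x y).toCols₂ᵀ := rfl
  have h2 : blockPair y.row y.row = y.lam * y.muᵀ := by simp [blockPair, row]
  rw [h1, h2] at h
  have hx := x.kap_symm.eq
  have hy := y.kap_symm.eq
  unfold Matrix.IsSymm
  simp only [Matrix.transpose_add, Matrix.transpose_sub, hx, hy]
  rw [sub_eq_sub_iff_add_eq_add] at h
  have e1 : (x.lam * (tw x y).toCols₂ᵀ)ᵀ = (tw x y).toCols₂ * x.lamᵀ := by
    simp [Matrix.transpose_mul]
  have e2 : ((tw x y).toCols₂ * x.lamᵀ)ᵀ = x.lam * (tw x y).toCols₂ᵀ := by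
    simp [Matrix.transpose_mul]
  rw [e1, e2]
  rw [sub_eq_sub_iff_add_eq_add]
  linear_combination (norm := abel) h

/-- The group law
`(λ,μ,κ)g (λ',μ',κ')g' =
(λ+l, μ+m, κ + κ' + λ ᵗm + m ᵗλ + l ᵗm - λ' ᵗμ') gg'`, where `(l m) = (λ' μ') g⁻¹`. -/
instance : Mul (JacobiGroup n l R) where
  mul x y :=
    { lam := x.lam + (tw x y).toCols₁
      mu := x.mu + (tw x y).toCols₂
      kap := x.kap + y.kap + x.lam * (tw x y).toCols₂ᵀ + (tw x y).toCols₂ * x.lamᵀ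
        + (tw x y).toCols₁ * (tw x y).toCols₂ᵀ - y.lam * y.muᵀ
      kap_symm := mul_symm_aux x y
      g := x.g * y.g }

instance : One (JacobiGroup n l R) where
  one := { lam := 0, mu := 0, kap := 0, kap_symm := by simp [Matrix.IsSymm], g := 1 }

theorem ext_row {x y : JacobiGroup n l R} (h : x.row = y.row) (hk : x.kap = y.kap)
    (hg : x.g = y.g) : x = y := by
  obtain ⟨h1, h2⟩ := Matrix.fromCols_inj.eq_iff.1 h
  exact JacobiGroup.ext h1 h2 hk hg

theorem row_mul (x y : JacobiGroup n l R) :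
    (x * y).row = x.row + y.row * (x.g⁻¹ : Matrix.symplecticGroup (Fin n) R).1 := by
  have h : (x * y).row = Matrix.fromCols (x.lam + (tw x y).toCols₁) (x.mu + (tw x y).toCols₂) := rfl
  have h2 : y.row * (x.g⁻¹ : Matrix.symplecticGroup (Fin n) R).1 = tw x y := rfl
  rw [h, h2]
  ext i (j | j) <;> rfl

theorem g_mul (x y : JacobiGroup n l R) : (x * y).g = x.g * y.g := rfl

theorem kap_mul (x y : JacobiGroup n l R) :
    (x * y).kap = x.kap + y.kap
      + blockPair x.row (y.row * (x.g⁻¹ : Matrix.symplecticGroup (Fin n) R).1)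
      + (blockPair x.row (y.row * (x.g⁻¹ : Matrix.symplecticGroup (Fin n) R).1))ᵀ
      + blockPair (y.row * (x.g⁻¹ : Matrix.symplecticGroup (Fin n) R).1)
          (y.row * (x.g⁻¹ : Matrix.symplecticGroup (Fin n) R).1)
      - blockPair y.row y.row := by
  have h2 : y.row * (x.g⁻¹ : Matrix.symplecticGroup (Fin n) R).1 = tw x y := rfl
  have h3 : blockPair y.row y.row = y.lam * y.muᵀ := by simp [blockPair, row]
  have h4 : blockPair x.row (tw x y) = x.lam * (tw x y).toCols₂ᵀ := by simp [blockPair, row]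
  rw [h2, h3, h4, Matrix.transpose_mul, Matrix.transpose_transpose]
  rfl

theorem row_one : (1 : JacobiGroup n l R).row = 0 := by
  ext i (j | j) <;> rfl
theorem kap_one : (1 : JacobiGroup n l R).kap = 0 := rfl
theorem g_one : (1 : JacobiGroup n l R).g = 1 := rfl

theorem inv_symm_aux (x : JacobiGroup n l R) :
    (-x.kap + (blockPair x.row x.row)ᵀ + blockPair (x.row * x.g.1) (x.row * x.g.1)).IsSymm := by
  have h := blockPair_symplectic x.row x.row x.g
  have hx := x.kap_symm.eq
  unfold Matrix.IsSymm
  simp only [Matrix.transpose_add, Matrix.transpose_neg, hx, Matrix.transpose_transpose]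
  linear_combination (norm := abel) h

instance : Inv (JacobiGroup n l R) where
  inv x :=
    { lam := (-(x.row * x.g.1)).toCols₁
      mu := (-(x.row * x.g.1)).toCols₂
      kap := -x.kap + (blockPair x.row x.row)ᵀ + blockPair (x.row * x.g.1) (x.row * x.g.1)
      kap_symm := inv_symm_aux x
      g := x.g⁻¹ }

theorem row_inv (x : JacobiGroup n l R) : (x⁻¹).row = -(x.row * x.g.1) :=
  Matrix.fromCols_toCols _
theorem kap_inv (x : JacobiGroup n l R) : (x⁻¹).kap =
    -x.kap + (blockPair x.row x.row)ᵀ + blockPair (x.row * x.g.1) (x.row * x.g.1) := rfl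
theorem g_inv (x : JacobiGroup n l R) : (x⁻¹).g = x.g⁻¹ := rfl

instance : Group (JacobiGroup n l R) := Group.ofRightAxioms
  (by
    intro x y z
    have hc : (((x.g * y.g)⁻¹ : Matrix.symplecticGroup (Fin n) R)).1 =
        (y.g⁻¹ : Matrix.symplecticGroup (Fin n) R).1 *
          (x.g⁻¹ : Matrix.symplecticGroup (Fin n) R).1 := by
      rw [_root_.mul_inv_rev]; rfl
    apply ext_row
    · simp only [row_mul, g_mul, hc, Matrix.add_mul, Matrix.mul_assoc, add_assoc]
    · have h := blockPair_symplectic y.row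
        (z.row * (y.g⁻¹ : Matrix.symplecticGroup (Fin n) R).1) x.g⁻¹
      simp only [kap_mul, row_mul, g_mul, hc, Matrix.add_mul, ← Matrix.mul_assoc,
        blockPair_add_left, blockPair_add_right, Matrix.transpose_add]
      linear_combination (norm := abel) h
    · simp only [g_mul, mul_assoc])
  (by
    intro x
    apply ext_row
    · simp [row_mul, row_one]
    · simp [kap_mul, row_one, kap_one, blockPair]
      ext i j; simp [Matrix.mul_apply, Matrix.toCols₂, Matrix.toCols₁]
    · simp [g_mul, g_one])
  (by
    intro x
    have hc : x.row * x.g.1 * (x.g⁻¹ : Matrix.symplecticGroup (Fin n) R).1 = x.row := by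
      have : x.g.1 * (x.g⁻¹ : Matrix.symplecticGroup (Fin n) R).1 = 1 :=
        congrArg Subtype.val (mul_inv_cancel x.g)
      rw [Matrix.mul_assoc, this, Matrix.mul_one]
    apply ext_row
    · simp [row_mul, row_inv, row_one, hc]
    · simp only [kap_mul, row_inv, kap_inv, kap_one, Matrix.neg_mul, hc, blockPair_neg_left,
        blockPair_neg_right, Matrix.transpose_neg]
      abel
    · simp [g_mul, g_inv, g_one])

section map
variable {S : Type*} [CommRing S]

def mapSp (φ : R →+* S) (g : Matrix.symplecticGroup (Fin n) R) :
    Matrix.symplecticGroup (Fin n) S :=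
  ⟨g.1.map φ, SymplecticGroup.map_mem g.2 φ⟩

/-- Functoriality in the ring. -/
def map (φ : R →+* S) (x : JacobiGroup n l R) : JacobiGroup n l S where
  lam := x.lam.map φ
  mu := x.mu.map φ
  kap := x.kap.map φ
  kap_symm := x.kap_symm.map φ
  g := mapSp φ x.g

theorem mapSp_mul (φ : R →+* S) (g h : Matrix.symplecticGroup (Fin n) R) :
    mapSp φ (g * h) = mapSp φ g * mapSp φ h :=
  Subtype.ext (Matrix.map_mul)

theorem mapSp_one (φ : R →+* S) :
    mapSp φ (1 : Matrix.symplecticGroup (Fin n) R) = 1 :=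
  Subtype.ext (Matrix.map_one φ (map_zero φ) (map_one φ))

def mapHom (φ : R →+* S) : JacobiGroup n l R →* JacobiGroup n l S where
  toFun := map φ
  map_one' := by
    apply JacobiGroup.ext
    · exact Matrix.map_zero φ (map_zero φ)
    · exact Matrix.map_zero φ (map_zero φ)
    · exact Matrix.map_zero φ (map_zero φ)
    · exact mapSp_one φ
  map_mul' x y := by
    have hr : ∀ z : JacobiGroup n l R, (map φ z).row = z.row.map φ := by
      intro z; ext i (j | j) <;> rfl
    have hi : ((mapSp φ x.g)⁻¹ : Matrix.symplecticGroup (Fin n) S).1 =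
        (x.g⁻¹ : Matrix.symplecticGroup (Fin n) R).1.map φ := by
      have : (mapSp φ x.g)⁻¹ = mapSp φ x.g⁻¹ := by
        rw [inv_eq_iff_mul_eq_one, ← mapSp_mul, mul_inv_cancel, mapSp_one]
      rw [this]; rfl
    have hp : ∀ a b : Matrix (Fin l) (Fin n ⊕ Fin n) R,
        blockPair (a.map φ) (b.map φ) = (blockPair a b).map φ := by
      intro a b
      simp only [blockPair, Matrix.map_mul]; rfl
    have hg : (map φ x).g = mapSp φ x.g := rfl
    have hk : ∀ z : JacobiGroup n l R, (map φ z).kap = z.kap.map φ := fun _ => rfl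
    apply ext_row
    · simp only [row_mul, hr, hg, hi, Matrix.map_mul,
        Matrix.map_add φ (map_add φ)]
    · simp only [kap_mul, hk, hr, hg, hi, ← Matrix.map_mul, hp, Matrix.map_add φ (map_add φ),
        Matrix.map_sub φ (map_sub φ), Matrix.transpose_map]
    · exact mapSp_mul φ x.g y.g
end map
/-- `g ∈ Sp_n(R)` as the element `(0,0,0) g`. -/
def ofSp (g : Matrix.symplecticGroup (Fin n) R) : JacobiGroup n l R where
  lam := 0
  mu := 0
  kap := 0
  kap_symm := by simp [Matrix.IsSymm]
  g := g

/-- `(0,0,κ)`. -/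
def central (κ : Matrix (Fin l) (Fin l) R) (hκ : κ.IsSymm) : JacobiGroup n l R where
  lam := 0
  mu := 0
  kap := κ
  kap_symm := hκ
  g := 1

end JacobiGroup

/-! ### Places, adeles, local lattices -/

open NumberField.InfinitePlace.Completion

noncomputable section

/-- `e(x) = e^{2πix}`. -/
def expC (x : ℂ) : ℂ := Complex.exp (2 * Real.pi * Complex.I * x)

section places
variable (F : Type*) [Field F] [NumberField F]

/-- `x ↦ x_𝐚`. -/
def toArch : AdeleRing (𝓞 F) F →+* InfiniteAdeleRing F :=
  RingHom.fst (InfiniteAdeleRing F) (FiniteAdeleRing (𝓞 F) F)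

/-- `x ↦ x_𝐡`. -/
def toFin : AdeleRing (𝓞 F) F →+* FiniteAdeleRing (𝓞 F) F :=
  RingHom.snd (InfiniteAdeleRing F) (FiniteAdeleRing (𝓞 F) F)

variable {F}

/-- `x ↦ x_v` for a finite place `v`. -/
def finEval (v : HeightOneSpectrum (𝓞 F)) : FiniteAdeleRing (𝓞 F) F →+* v.adicCompletion F where
  toFun x := x v
  map_one' := rfl
  map_mul' _ _ := rfl
  map_zero' := rfl
  map_add' _ _ := rfl

open scoped Classical in
/-- The embedding `F_v → 𝔸` of monoids, `x ↦ (1, …, 1, x, 1, …)`. -/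
def localIncl (v : HeightOneSpectrum (𝓞 F)) : v.adicCompletion F →* AdeleRing (𝓞 F) F where
  toFun x := ((1 : InfiniteAdeleRing F),
    (RestrictedProduct.mulSingle (fun w : HeightOneSpectrum (𝓞 F) => w.adicCompletionIntegers F) v
      x : FiniteAdeleRing (𝓞 F) F))
  map_one' := Prod.ext rfl (RestrictedProduct.mulSingle_one _ _)
  map_mul' _ _ := Prod.ext (one_mul _).symm (RestrictedProduct.mulSingle_mul _ _ _ _)

section real
variable [IsTotallyReal F]

/-- The real embedding `σ_v : F → ℝ`. -/
def realEmb (v : InfinitePlace F) : F →+* ℝ :=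
  InfinitePlace.embedding_of_isReal (IsTotallyReal.isReal v)

/-- `x ↦ x_v ∈ F_v = ℝ` for an archimedean place `v`. -/
def realAt (v : InfinitePlace F) : InfiniteAdeleRing F →+* ℝ :=
  (extensionEmbeddingOfIsReal (IsTotallyReal.isReal v)).comp
    (Pi.evalRingHom (fun w : InfinitePlace F => w.Completion) v)

end real

/-- `I_v = I 𝔬_v ⊆ F_v`. -/
def locIdeal (v : HeightOneSpectrum (𝓞 F)) (I : FractionalIdeal (𝓞 F)⁰ F) :
    Submodule (v.adicCompletionIntegers F) (v.adicCompletion F) :=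
  Submodule.span _ ((fun x : F => algebraMap F (v.adicCompletion F) x) '' (I : Set F))

theorem locIdeal_mono (v : HeightOneSpectrum (𝓞 F)) {I J : FractionalIdeal (𝓞 F)⁰ F} (h : I ≤ J) :
    locIdeal v I ≤ locIdeal v J :=
  Submodule.span_mono (Set.image_mono h)

theorem locIdeal_mul (v : HeightOneSpectrum (𝓞 F)) {I J : FractionalIdeal (𝓞 F)⁰ F}
    {x y : v.adicCompletion F} (hx : x ∈ locIdeal v I) (hy : y ∈ locIdeal v J) :
    x * y ∈ locIdeal v (I * J) := by
  have h := Submodule.mul_mem_mul hx hy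
  rw [locIdeal, locIdeal, Submodule.span_mul_span] at h
  refine Submodule.span_mono ?_ h
  rintro _ ⟨_, ⟨a, ha, rfl⟩, _, ⟨b, hb, rfl⟩, rfl⟩
  exact ⟨a * b, FractionalIdeal.mul_mem_mul ha hb, map_mul _ _ _⟩

theorem mem_locIdeal_one (v : HeightOneSpectrum (𝓞 F)) (x : v.adicCompletion F) :
    x ∈ locIdeal v 1 ↔ x ∈ v.adicCompletionIntegers F := by
  constructor
  · intro h
    refine Submodule.span_induction ?_ (zero_mem _) (fun _ _ _ _ h1 h2 => add_mem h1 h2)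
      (fun a y _ h => mul_mem a.2 h) h
    rintro _ ⟨y, hy, rfl⟩
    obtain ⟨z, rfl⟩ := (FractionalIdeal.mem_one_iff _).1 hy
    exact v.coe_mem_adicCompletionIntegers z
  · intro h
    have h1 : (1 : v.adicCompletion F) ∈ locIdeal v 1 :=
      Submodule.subset_span ⟨1, FractionalIdeal.one_mem_one _, map_one _⟩
    have h2 := (locIdeal v 1).smul_mem (⟨x, h⟩ : v.adicCompletionIntegers F) h1
    rwa [show (⟨x, h⟩ : v.adicCompletionIntegers F) • (1 : v.adicCompletion F) = x from
      mul_one x] at h2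

/-- All entries of `A` lie in `I_v` for every finite place `v`. -/
def MatHat {m p : Type*} (I : FractionalIdeal (𝓞 F)⁰ F)
    (A : Matrix m p (FiniteAdeleRing (𝓞 F) F)) : Prop :=
  ∀ v i j, A i j v ∈ locIdeal v I

namespace MatHat
variable {m p s : Type*} {I J : FractionalIdeal (𝓞 F)⁰ F}

theorem mono (h : I ≤ J) {A : Matrix m p (FiniteAdeleRing (𝓞 F) F)} (hA : MatHat I A) :
    MatHat J A := fun v i j => locIdeal_mono v h (hA v i j)

theorem add {A B : Matrix m p (FiniteAdeleRing (𝓞 F) F)} (hA : MatHat I A) (hB : MatHat I B) :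
    MatHat I (A + B) := fun v i j => add_mem (hA v i j) (hB v i j)

theorem neg {A : Matrix m p (FiniteAdeleRing (𝓞 F) F)} (hA : MatHat I A) :
    MatHat I (-A) := fun v i j => neg_mem (hA v i j)

theorem sub {A B : Matrix m p (FiniteAdeleRing (𝓞 F) F)} (hA : MatHat I A) (hB : MatHat I B) :
    MatHat I (A - B) := by rw [sub_eq_add_neg]; exact hA.add hB.neg

theorem transpose {A : Matrix m p (FiniteAdeleRing (𝓞 F) F)} (hA : MatHat I A) :
    MatHat I Aᵀ := fun v i j => hA v j i

theorem zero : MatHat I (0 : Matrix m p (FiniteAdeleRing (𝓞 F) F)) := fun _ _ _ => zero_mem _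

theorem one [DecidableEq m] : MatHat 1 (1 : Matrix m m (FiniteAdeleRing (𝓞 F) F)) := by
  intro v i j
  rw [mem_locIdeal_one]
  by_cases h : i = j
  · subst h; rw [Matrix.one_apply_eq]; exact one_mem _
  · rw [Matrix.one_apply_ne h]; exact zero_mem _

theorem mul [Fintype p] {A : Matrix m p (FiniteAdeleRing (𝓞 F) F)}
    {B : Matrix p s (FiniteAdeleRing (𝓞 F) F)} (hA : MatHat I A) (hB : MatHat J B) :
    MatHat (I * J) (A * B) := by
  intro v i j
  have : (A * B) i j v = ∑ x, A i x v * B x j v := by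
    rw [Matrix.mul_apply]
    exact map_sum (finEval v) _ _
  rw [this]
  exact sum_mem fun x _ => locIdeal_mul v (hA v i x) (hB v x j)

end MatHat
end places

section levels
variable {F : Type*} [Field F] [NumberField F] {n l : ℕ}

theorem blocks_mul {R : Type*} [CommRing R] (g h : Matrix (Fin n ⊕ Fin n) (Fin n ⊕ Fin n) R) :
    (g * h) = Matrix.fromBlocks
      (g.toBlocks₁₁ * h.toBlocks₁₁ + g.toBlocks₁₂ * h.toBlocks₂₁)
      (g.toBlocks₁₁ * h.toBlocks₁₂ + g.toBlocks₁₂ * h.toBlocks₂₂)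
      (g.toBlocks₂₁ * h.toBlocks₁₁ + g.toBlocks₂₂ * h.toBlocks₂₁)
      (g.toBlocks₂₁ * h.toBlocks₁₂ + g.toBlocks₂₂ * h.toBlocks₂₂) := by
  conv_lhs => rw [← Matrix.fromBlocks_toBlocks g, ← Matrix.fromBlocks_toBlocks h]
  rw [Matrix.fromBlocks_multiply]

theorem blocks_inv {R : Type*} [CommRing R] (g : Matrix.symplecticGroup (Fin n) R) :
    (g⁻¹ : Matrix.symplecticGroup (Fin n) R).1 = Matrix.fromBlocks
      g.1.toBlocks₂₂ᵀ (-g.1.toBlocks₁₂ᵀ) (-g.1.toBlocks₂₁ᵀ) g.1.toBlocks₁₁ᵀ := by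
  rw [SymplecticGroup.coe_inv]
  conv_lhs => rw [← Matrix.fromBlocks_toBlocks g.1]
  rw [Matrix.J, Matrix.fromBlocks_transpose, Matrix.fromBlocks_neg, Matrix.fromBlocks_multiply,
    Matrix.fromBlocks_multiply]
  simp

/-- `D_𝐡[𝔟⁻¹, 𝔟𝔠]` for `𝔟𝔠 = J`, `𝔟⁻¹ = I`. -/
structure DFin (I J : FractionalIdeal (𝓞 F)⁰ F)
    (g : Matrix (Fin n ⊕ Fin n) (Fin n ⊕ Fin n) (FiniteAdeleRing (𝓞 F) F)) : Prop where
  ha : MatHat 1 g.toBlocks₁₁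
  hb : MatHat I g.toBlocks₁₂
  hc : MatHat J g.toBlocks₂₁
  hd : MatHat 1 g.toBlocks₂₂

theorem DFin.mul {I J : FractionalIdeal (𝓞 F)⁰ F} (hIJ : I * J ≤ 1)
    {g h : Matrix (Fin n ⊕ Fin n) (Fin n ⊕ Fin n) (FiniteAdeleRing (𝓞 F) F)}
    (hg : DFin I J g) (hh : DFin I J h) : DFin I J (g * h) := by
  rw [blocks_mul]
  refine ⟨?_, ?_, ?_, ?_⟩ <;> simp only [Matrix.toBlocks_fromBlocks₁₁,
    Matrix.toBlocks_fromBlocks₁₂, Matrix.toBlocks_fromBlocks₂₁, Matrix.toBlocks_fromBlocks₂₂]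
  · exact ((hg.ha.mul hh.ha).mono (one_mul _).le).add ((hg.hb.mul hh.hc).mono hIJ)
  · exact ((hg.ha.mul hh.hb).mono (one_mul _).le).add ((hg.hb.mul hh.hd).mono (mul_one _).le)
  · exact ((hg.hc.mul hh.ha).mono (mul_one _).le).add ((hg.hd.mul hh.hc).mono (one_mul _).le)
  · exact ((hg.hc.mul hh.hb).mono ((mul_comm _ _).trans_le hIJ)).add
      ((hg.hd.mul hh.hd).mono (one_mul _).le)

theorem DFin.inv {I J : FractionalIdeal (𝓞 F)⁰ F}
    {g : Matrix.symplecticGroup (Fin n) (FiniteAdeleRing (𝓞 F) F)}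
    (hg : DFin I J g.1) :
    DFin I J (g⁻¹ : Matrix.symplecticGroup (Fin n) (FiniteAdeleRing (𝓞 F) F)).1 := by
  rw [blocks_inv]
  exact ⟨hg.hd.transpose, hg.hb.transpose.neg, hg.hc.transpose.neg, hg.ha.transpose⟩

/-- `(λ μ)` with `λ` integral and `μ` in `I`. -/
structure RowFin (I : FractionalIdeal (𝓞 F)⁰ F)
    (x : Matrix (Fin l) (Fin n ⊕ Fin n) (FiniteAdeleRing (𝓞 F) F)) : Prop where
  h1 : MatHat 1 x.toCols₁
  h2 : MatHat I x.toCols₂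

theorem RowFin.mul {I J : FractionalIdeal (𝓞 F)⁰ F} (hIJ : I * J ≤ 1)
    {x : Matrix (Fin l) (Fin n ⊕ Fin n) (FiniteAdeleRing (𝓞 F) F)}
    {g : Matrix (Fin n ⊕ Fin n) (Fin n ⊕ Fin n) (FiniteAdeleRing (𝓞 F) F)}
    (hx : RowFin I x) (hg : DFin I J g) : RowFin I (x * g) := by
  have : x * g = Matrix.fromCols
      (x.toCols₁ * g.toBlocks₁₁ + x.toCols₂ * g.toBlocks₂₁)
      (x.toCols₁ * g.toBlocks₁₂ + x.toCols₂ * g.toBlocks₂₂) := by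
    conv_lhs => rw [← Matrix.fromCols_toCols x, ← Matrix.fromBlocks_toBlocks g]
    rw [Matrix.fromCols_mul_fromBlocks]
  rw [this]
  refine ⟨?_, ?_⟩ <;> simp only [Matrix.toCols₁_fromCols, Matrix.toCols₂_fromCols]
  · exact ((hx.h1.mul hg.ha).mono (one_mul _).le).add ((hx.h2.mul hg.hc).mono hIJ)
  · exact ((hx.h1.mul hg.hb).mono (one_mul _).le).add ((hx.h2.mul hg.hd).mono (mul_one _).le)

theorem RowFin.pair {I : FractionalIdeal (𝓞 F)⁰ F}
    {x y : Matrix (Fin l) (Fin n ⊕ Fin n) (FiniteAdeleRing (𝓞 F) F)}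
    (hx : RowFin I x) (hy : RowFin I y) : MatHat I (blockPair x y) :=
  (hx.h1.mul hy.h2.transpose).mono (one_mul _).le

theorem level_aux (b : FractionalIdeal (𝓞 F)⁰ F) (c : Ideal (𝓞 F)) :
    b⁻¹ * (b * (c : FractionalIdeal (𝓞 F)⁰ F)) ≤ 1 := by
  by_cases hb : b = 0
  · simp [hb]
  · rw [← mul_assoc, inv_mul_cancel₀ hb, one_mul]
    exact FractionalIdeal.coeIdeal_le_one

/-- `K_𝐡[𝔟, 𝔠] = C_𝐡[𝔬, 𝔟⁻¹, 𝔟⁻¹] ⋊ D_𝐡[𝔟⁻¹, 𝔟𝔠]`. -/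
def levelFin (n l : ℕ) (b : FractionalIdeal (𝓞 F)⁰ F) (c : Ideal (𝓞 F)) :
    Subgroup (JacobiGroup n l (FiniteAdeleRing (𝓞 F) F)) where
  carrier := {x | MatHat 1 x.lam ∧ MatHat b⁻¹ x.mu ∧ MatHat b⁻¹ x.kap ∧
    DFin b⁻¹ (b * (c : FractionalIdeal (𝓞 F)⁰ F)) x.g.1}
  one_mem' := by
    refine ⟨MatHat.zero, MatHat.zero, MatHat.zero, ?_⟩
    have : (1 : JacobiGroup n l (FiniteAdeleRing (𝓞 F) F)).g.1 = Matrix.fromBlocks 1 0 0 1 :=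
      Matrix.fromBlocks_one.symm
    rw [this]
    exact ⟨MatHat.one, MatHat.zero, MatHat.zero, MatHat.one⟩
  mul_mem' := by
    rintro x y ⟨hx1, hx2, hx3, hx4⟩ ⟨hy1, hy2, hy3, hy4⟩
    have hx : RowFin b⁻¹ x.row := ⟨hx1, hx2⟩
    have hy : RowFin b⁻¹ y.row := ⟨hy1, hy2⟩
    have hz := hy.mul (level_aux b c) hx4.inv
    have hk : MatHat b⁻¹ (x * y).kap := by
      rw [JacobiGroup.kap_mul]
      exact ((((hx3.add hy3).add (hx.pair hz)).add (hx.pair hz).transpose).add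
        (hz.pair hz)).sub (hy.pair hy)
    exact ⟨hx1.add hz.h1, hx2.add hz.h2, hk, hx4.mul (level_aux b c) hy4⟩
  inv_mem' := by
    rintro x ⟨hx1, hx2, hx3, hx4⟩
    have hx : RowFin b⁻¹ x.row := ⟨hx1, hx2⟩
    have hz := hx.mul (level_aux b c) hx4
    refine ⟨hz.h1.neg, hz.h2.neg, ?_, hx4.inv⟩
    rw [JacobiGroup.kap_inv]
    exact (hx3.neg.add (hx.pair hx).transpose).add (hz.pair hz)

/-- `K[𝔟, 𝔠] = K_𝐡[𝔟, 𝔠] 𝐆_𝐚 ⊆ 𝐆(𝔸)`. -/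
def level (n l : ℕ) (b : FractionalIdeal (𝓞 F)⁰ F) (c : Ideal (𝓞 F)) :
    Subgroup (JacobiGroup n l (AdeleRing (𝓞 F) F)) :=
  (levelFin n l b c).comap (JacobiGroup.mapHom (toFin F))

def archFin {m p : Type*} (A : Matrix m p (InfiniteAdeleRing F))
    (B : Matrix m p (FiniteAdeleRing (𝓞 F) F)) : Matrix m p (AdeleRing (𝓞 F) F) :=
  Matrix.of fun i j => (A i j, B i j)

theorem archFin_ext {m p : Type*} {A B : Matrix m p (AdeleRing (𝓞 F) F)}
    (h1 : A.map (toArch F) = B.map (toArch F)) (h2 : A.map (toFin F) = B.map (toFin F)) :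
    A = B := by
  ext i j
  exact Prod.ext (congrFun (congrFun h1 i) j) (congrFun (congrFun h2 i) j)

/-- The element of `𝐆(𝔸)` with archimedean part `x` and finite part `y`. -/
def ofParts (x : JacobiGroup n l (InfiniteAdeleRing F))
    (y : JacobiGroup n l (FiniteAdeleRing (𝓞 F) F)) : JacobiGroup n l (AdeleRing (𝓞 F) F) where
  lam := archFin x.lam y.lam
  mu := archFin x.mu y.mu
  kap := archFin x.kap y.kap
  kap_symm := archFin_ext x.kap_symm y.kap_symm
  g := ⟨archFin x.g.1 y.g.1, by
    rw [SymplecticGroup.mem_iff]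
    refine archFin_ext ?_ ?_
    · have := SymplecticGroup.mem_iff.1 x.g.2
      rw [Matrix.map_mul, Matrix.map_mul, Matrix.map_J, Matrix.transpose_map]
      exact this
    · have := SymplecticGroup.mem_iff.1 y.g.2
      rw [Matrix.map_mul, Matrix.map_mul, Matrix.map_J, Matrix.transpose_map]
      exact this⟩

theorem map_toArch_ofParts (x : JacobiGroup n l (InfiniteAdeleRing F))
    (y : JacobiGroup n l (FiniteAdeleRing (𝓞 F) F)) :
    JacobiGroup.map (toArch F) (ofParts x y) = x := rfl

theorem map_toFin_ofParts (x : JacobiGroup n l (InfiniteAdeleRing F))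
    (y : JacobiGroup n l (FiniteAdeleRing (𝓞 F) F)) :
    JacobiGroup.map (toFin F) (ofParts x y) = y := rfl

/-- `𝐆(F) ∩ g K g⁻¹` for `g ∈ 𝐆_𝐡`. -/
def congrSubgroup (K : Subgroup (JacobiGroup n l (AdeleRing (𝓞 F) F)))
    (g : JacobiGroup n l (FiniteAdeleRing (𝓞 F) F)) : Subgroup (JacobiGroup n l F) :=
  (K.map (MulAut.conj (ofParts 1 g)).toMonoidHom).comap
    (JacobiGroup.mapHom (algebraMap F (AdeleRing (𝓞 F) F)))

end levels

/-! ### The additive character `Ψ` -/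

section character
variable {F : Type*} [Field F] [NumberField F]

/-- `ℚ_p ⊆ F_v`, realised as the closure of `ℚ` in `F_v`. -/
def ratClosure (v : HeightOneSpectrum (𝓞 F)) : Subfield (v.adicCompletion F) :=
  (algebraMap ℚ (v.adicCompletion F)).fieldRange.topologicalClosure

/-- `Tr_{F_v/ℚ_p}(x)`, viewed inside `F_v`. -/
def localTrace (v : HeightOneSpectrum (𝓞 F)) (x : v.adicCompletion F) : v.adicCompletion F :=
  (Algebra.trace (ratClosure v) (v.adicCompletion F) x : ratClosure v)

/-- `y ∈ ℤ[1/p]` (where `p` is the residue characteristic of `v`) and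
`Tr_{F_v/ℚ_p}(x) - y ∈ ℤ_p`. -/
def IsFractionalPart (v : HeightOneSpectrum (𝓞 F)) (x : v.adicCompletion F) (y : ℚ) : Prop :=
  (∃ (m : ℕ) (a : ℤ), y = a / (ringChar (𝓞 F ⧸ v.asIdeal) : ℚ) ^ m) ∧
    localTrace v x - algebraMap ℚ (v.adicCompletion F) y ∈ v.adicCompletionIntegers F

/-- `Ψ_v` for `v` finite: `Ψ_v(x) = e(-y)`. -/
def psiLocal (v : HeightOneSpectrum (𝓞 F)) (x : v.adicCompletion F) : ℂ :=
  expC (-((Classical.epsilon (IsFractionalPart v x) : ℚ) : ℂ))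

/-- `∏_{v ∈ 𝐡} Ψ_v`; almost all factors are `1`. -/
def psiFin (x : FiniteAdeleRing (𝓞 F) F) : ℂ := ∏ᶠ v, psiLocal v (x v)

/-- `𝐞_𝐚(x) = ∏_{v ∣ ∞} e(x_v)`. -/
def expArch (x : InfinitePlace F → ℂ) : ℂ := ∏ v, expC (x v)

variable [IsTotallyReal F]

/-- `Ψ = 𝐞_𝔸`. -/
def psi (x : AdeleRing (𝓞 F) F) : ℂ :=
  expArch (fun v => (realAt v (toArch F x) : ℂ)) * psiFin (toFin F x)

end character

/-! ### Siegel–Jacobi forms -/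

section jacobi

/-- Coercion of a real matrix to a complex one. -/
abbrev toC {m p : Type*} (A : Matrix m p ℝ) : Matrix m p ℂ := A.map (fun x : ℝ => (x : ℂ))

variable {n l : ℕ}

/-- `c_v τ_v + d_v`. -/
def autDen (h : JacobiGroup n l ℝ) (z : Matrix (Fin n) (Fin n) ℂ × Matrix (Fin l) (Fin n) ℂ) :
    Matrix (Fin n) (Fin n) ℂ :=
  toC h.g.1.toBlocks₂₁ * z.1 + toC h.g.1.toBlocks₂₂

/-- The action of `𝐆(ℝ)` on one factor: `(τ,w) ↦ (gτ, w(cτ+d)⁻¹ + λ·gτ + μ)`. -/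
def locAct (h : JacobiGroup n l ℝ) (z : Matrix (Fin n) (Fin n) ℂ × Matrix (Fin l) (Fin n) ℂ) :
    Matrix (Fin n) (Fin n) ℂ × Matrix (Fin l) (Fin n) ℂ :=
  let gz := (toC h.g.1.toBlocks₁₁ * z.1 + toC h.g.1.toBlocks₁₂) * (autDen h z)⁻¹
  (gz, z.2 * (autDen h z)⁻¹ + toC h.lam * gz + toC h.mu)

/-- `j(g,τ)^k 𝒥_S(h,τ,w)` at one archimedean place, where
`𝒥_S = e(-tr(Sκ) + tr(S[w](cτ+d)⁻¹c) - 2tr(ᵗλ S w (cτ+d)⁻¹) - tr(S[λ]·gτ))`. -/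
def locFactor (k : ℤ) (S : Matrix (Fin l) (Fin l) ℝ) (h : JacobiGroup n l ℝ)
    (z : Matrix (Fin n) (Fin n) ℂ × Matrix (Fin l) (Fin n) ℂ) : ℂ :=
  (autDen h z).det ^ k *
    expC (-(toC S * toC h.kap).trace
      + (z.2ᵀ * toC S * z.2 * (autDen h z)⁻¹ * toC h.g.1.toBlocks₂₁).trace
      - 2 * ((toC h.lam)ᵀ * toC S * z.2 * (autDen h z)⁻¹).trace
      - ((toC h.lam)ᵀ * toC S * toC h.lam * (locAct h z).1).trace)

variable {F : Type*} [Field F]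

/-- The ambient space of `ℍ_{n,l}`. -/
abbrev Point (F : Type*) [Field F] (n l : ℕ) : Type _ :=
  InfinitePlace F → Matrix (Fin n) (Fin n) ℂ × Matrix (Fin l) (Fin n) ℂ

/-- `ℍ_{n,l} = (ℍ_n × M_{l,n}(ℂ))^𝐚`. -/
def upperSpace (F : Type*) [Field F] (n l : ℕ) : Set (Point F n l) :=
  {z | ∀ v, (z v).1.IsSymm ∧ ((z v).1.map Complex.im).PosDef}

/-- `𝐢₀ = (i 1_n, 0)`. -/
def basePoint (F : Type*) [Field F] (n l : ℕ) : Point F n l := fun _ => (Complex.I • 1, 0)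

variable [NumberField F] [IsTotallyReal F]

/-- The componentwise action of `𝐆_𝐚` on `ℍ_{n,l}`. -/
def act (y : JacobiGroup n l (InfiniteAdeleRing F)) (z : Point F n l) : Point F n l :=
  fun v => locAct (y.map (realAt v)) (z v)

/-- `J_{k,S}`. -/
def autFactor (k : InfinitePlace F → ℤ) (S : Matrix (Fin l) (Fin l) F)
    (y : JacobiGroup n l (InfiniteAdeleRing F)) (z : Point F n l) : ℂ :=
  ∏ v, locFactor (k v) (S.map (realEmb v)) (y.map (realAt v)) (z v)

/-- `f|_{k,S} y`. -/
def slash (k : InfinitePlace F → ℤ) (S : Matrix (Fin l) (Fin l) F) (f : Point F n l → ℂ)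
    (y : JacobiGroup n l (InfiniteAdeleRing F)) (z : Point F n l) : ℂ :=
  (autFactor k S y z)⁻¹ * f (act y z)

/-- `t ≥ 0`. -/
def TotNonneg (t : Matrix (Fin n) (Fin n) F) : Prop :=
  ∀ v : InfinitePlace F, (t.map (realEmb v)).PosSemidef

/-- `L` is a (full) lattice in the `ℚ`-subspace `W` of `M_{m,p}(F)`. -/
def IsLatticeIn {m p : Type*} (W : Set (Matrix m p F)) (L : Submodule ℤ (Matrix m p F)) : Prop :=
  L.FG ∧ (Submodule.span ℚ (L : Set (Matrix m p F)) : Set (Matrix m p F)) = W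

/-- `φ(τ,w) = ∑_{t ∈ L, t ≥ 0} ∑_{r ∈ M} c(t,r) 𝐞_𝐚(tr(tτ)) 𝐞_𝐚(tr(ᵗr w))` on `ℍ_{n,l}`. -/
def HasFourierExpansion (L : Submodule ℤ (Matrix (Fin n) (Fin n) F))
    (M : Submodule ℤ (Matrix (Fin l) (Fin n) F))
    (c : Matrix (Fin n) (Fin n) F → Matrix (Fin l) (Fin n) F → ℂ) (φ : Point F n l → ℂ) : Prop :=
  ∀ z ∈ upperSpace F n l, HasSum
    (fun p : {t : Matrix (Fin n) (Fin n) F // t ∈ L ∧ TotNonneg t} × M =>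
      c p.1 p.2 * expArch (fun v => (toC (p.1.1.map (realEmb v)) * (z v).1).trace)
        * expArch (fun v => ((toC (p.2.1.map (realEmb v)))ᵀ * (z v).2).trace)) (φ z)

/-- Siegel–Jacobi modular forms of weight `k`, index `S`, level `Γ` and Nebentypus `χ`. -/
structure IsSiegelJacobiForm (k : InfinitePlace F → ℤ) (S : Matrix (Fin l) (Fin l) F)
    (Γ : Subgroup (JacobiGroup n l F)) (χ : Γ →* ℂˣ) (f : Point F n l → ℂ) : Prop where
  holo : DifferentiableOn ℂ f (upperSpace F n l)
  automorphy : ∀ γ : Γ, ∀ z ∈ upperSpace F n l,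
    slash k S f (γ.1.map (algebraMap F (InfiniteAdeleRing F))) z = (χ γ : ℂ) * f z
  fourier : ∀ g : Matrix.symplecticGroup (Fin n) F, ∃ L M c,
    IsLatticeIn {t : Matrix (Fin n) (Fin n) F | t.IsSymm} L ∧
    IsLatticeIn (Set.univ : Set (Matrix (Fin l) (Fin n) F)) M ∧
    HasFourierExpansion L M c
      (slash k S f ((JacobiGroup.ofSp g : JacobiGroup n l F).map
        (algebraMap F (InfiniteAdeleRing F))))

end jacobi

/-! ### Adelic Siegel–Jacobi forms -/

section adelic
variable {F : Type*} [Field F] [NumberField F]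

/-- A Hecke character `χ : 𝔸ˣ/Fˣ → ℂˣ` of finite order with `χ_v(x) = 1` for all `v ∈ 𝐡` and
`x ∈ 𝔬_vˣ` with `x - 1 ∈ 𝔠_v`. -/
structure IsHeckeChar (c : Ideal (𝓞 F)) (χ : (AdeleRing (𝓞 F) F)ˣ →* ℂˣ) : Prop where
  continuous : Continuous χ
  trivial_on_global : ∀ x : Fˣ, χ (Units.map (algebraMap F (AdeleRing (𝓞 F) F)).toMonoidHom x) = 1
  finite_order : ∃ m : ℕ, 0 < m ∧ χ ^ m = 1
  conductor : ∀ (v : HeightOneSpectrum (𝓞 F)) (x : (v.adicCompletion F)ˣ),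
    Valued.v (x : v.adicCompletion F) = 1 →
    (x : v.adicCompletion F) - 1 ∈ locIdeal v (c : FractionalIdeal (𝓞 F)⁰ F) →
    χ (Units.map (localIncl v) x) = 1

open scoped Classical in
/-- `χ_v(x)` for `x ∈ F_vˣ`, extended by `0`. -/
def localChar (χ : (AdeleRing (𝓞 F) F)ˣ →* ℂˣ) (v : HeightOneSpectrum (𝓞 F))
    (x : v.adicCompletion F) : ℂ :=
  if h : x = 0 then 0 else (χ (Units.map (localIncl v) (Units.mk0 x h)) : ℂ)

variable {n l : ℕ}

/-- `χ(w) = ∏_{v ∣ 𝔠} χ_v(det a_g)⁻¹` for `w = hg`. -/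
def levelChar (c : Ideal (𝓞 F)) (χ : (AdeleRing (𝓞 F) F)ˣ →* ℂˣ)
    (w : JacobiGroup n l (AdeleRing (𝓞 F) F)) : ℂ :=
  ∏ᶠ v ∈ {v : HeightOneSpectrum (𝓞 F) | v.asIdeal ∣ c},
    (localChar χ v (finEval v (toFin F (w.g.1.toBlocks₁₁).det)))⁻¹

/-- `𝒯_n = {x ∈ Sym_n(F) : tr(xy) ∈ 𝔬 for all y ∈ Sym_n(𝔬)}`. -/
def dualSym (F : Type*) [Field F] [NumberField F] (n : ℕ) :
    Submodule (𝓞 F) (Matrix (Fin n) (Fin n) F) where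
  carrier := {x | x.IsSymm ∧ ∀ y : Matrix (Fin n) (Fin n) (𝓞 F), y.IsSymm →
    (x * y.map (algebraMap (𝓞 F) F)).trace ∈ (algebraMap (𝓞 F) F).range}
  add_mem' := by
    rintro x x' ⟨h1, h2⟩ ⟨h1', h2'⟩
    refine ⟨h1.add h1', fun y hy => ?_⟩
    rw [Matrix.add_mul, Matrix.trace_add]
    exact add_mem (h2 y hy) (h2' y hy)
  zero_mem' := ⟨by simp [Matrix.IsSymm], fun y _ => by simp⟩
  smul_mem' := by
    rintro a x ⟨h1, h2⟩
    refine ⟨h1.smul a, fun y hy => ?_⟩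
    rw [Matrix.smul_mul, Matrix.trace_smul, Algebra.smul_def]
    exact mul_mem ⟨a, rfl⟩ (h2 y hy)

/-- The lattice `𝔟𝔡⁻¹𝒯_n`. -/
def indexLattice (n : ℕ) (b : FractionalIdeal (𝓞 F)⁰ F) :
    Submodule (𝓞 F) (Matrix (Fin n) (Fin n) F) :=
  ((b * (differentIdeal ℤ (𝓞 F) : FractionalIdeal (𝓞 F)⁰ F)⁻¹ : FractionalIdeal (𝓞 F)⁰ F) :
    Submodule (𝓞 F) F) • dualSym F n

/-- `N_v = 𝔬_v N` for an `𝔬`-lattice `N` of matrices. -/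
def locLattice (v : HeightOneSpectrum (𝓞 F)) (N : Submodule (𝓞 F) (Matrix (Fin n) (Fin n) F)) :
    Submodule (v.adicCompletionIntegers F) (Matrix (Fin n) (Fin n) (v.adicCompletion F)) :=
  Submodule.span _ ((fun x : Matrix (Fin n) (Fin n) F => x.map (algebraMap F (v.adicCompletion F))) ''
    (N : Set (Matrix (Fin n) (Fin n) F)))

variable [IsTotallyReal F]

/-- `K₀[𝔟,𝔠] = K_𝐡[𝔟,𝔠] × K_∞`, with `K_∞` the stabilizer of `𝐢₀`. -/
def level0 (n l : ℕ) (b : FractionalIdeal (𝓞 F)⁰ F) (c : Ideal (𝓞 F)) :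
    Set (JacobiGroup n l (AdeleRing (𝓞 F) F)) :=
  {w | w.map (toFin F) ∈ levelFin n l b c ∧
    act (w.map (toArch F)) (basePoint F n l) = basePoint F n l}

/-- Adelic Siegel–Jacobi modular forms of weight `k`, index `S`, character `χ`, with respect
to `K ≤ K[𝔟,𝔠]`. In `classical`, `g ∈ 𝐆_𝐡` and the Nebentypus `ε` of `f_g` on `𝐆(F) ∩ gKg⁻¹` is
determined by `automorphy` whenever `f_g ≠ 0`. -/
structure IsAdelicSiegelJacobiForm (b : FractionalIdeal (𝓞 F)⁰ F) (c : Ideal (𝓞 F))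
    (K : Subgroup (JacobiGroup n l (AdeleRing (𝓞 F) F)))
    (k : InfinitePlace F → ℤ) (S : Matrix (Fin l) (Fin l) F)
    (χ : (AdeleRing (𝓞 F) F)ˣ →* ℂˣ) (f : JacobiGroup n l (AdeleRing (𝓞 F) F) → ℂ) : Prop where
  automorphy : ∀ (κ : Matrix (Fin l) (Fin l) (AdeleRing (𝓞 F) F)) (hκ : κ.IsSymm)
    (γ : JacobiGroup n l F) (g w : JacobiGroup n l (AdeleRing (𝓞 F) F)),
    w ∈ K → w ∈ level0 n l b c →
    f (JacobiGroup.central κ hκ * γ.map (algebraMap F (AdeleRing (𝓞 F) F)) * g * w) =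
      levelChar c χ w * (autFactor k S (w.map (toArch F)) (basePoint F n l))⁻¹ *
        psi (S.map (algebraMap F (AdeleRing (𝓞 F) F)) * κ).trace * f g
  classical : ∀ g : JacobiGroup n l (FiniteAdeleRing (𝓞 F) F),
    ∃ (fg : Point F n l → ℂ) (ε : congrSubgroup K g →* ℂˣ),
      (∀ y : JacobiGroup n l (InfiniteAdeleRing F),
        slash k S fg y (basePoint F n l) = f (ofParts 1 g * ofParts y 1)) ∧
      IsSiegelJacobiForm k S (congrSubgroup K g) ε fg

/-- `(λ, μ, 0) · [[q, σ q̃], [0, q̃]]`, where `q̃ = ᵗq⁻¹`. -/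
def siegelElt {R : Type*} [CommRing R] (lam mu : Matrix (Fin l) (Fin n) R)
    (q : GL (Fin n) R) (σ : Matrix (Fin n) (Fin n) R) (hσ : σ.IsSymm) : JacobiGroup n l R where
  lam := lam
  mu := mu
  kap := 0
  kap_symm := by simp [Matrix.IsSymm]
  g := ⟨Matrix.fromBlocks q.1 (σ * (q⁻¹).1ᵀ) 0 (q⁻¹).1ᵀ, by
    have h1 : q.1 * (q⁻¹).1 = 1 := by rw [← Units.val_mul, mul_inv_cancel, Units.val_one]
    have h2 : (q⁻¹).1ᵀ * q.1ᵀ = 1 := by rw [← Matrix.transpose_mul, h1, Matrix.transpose_one]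
    generalize (q⁻¹).1 = p at h1 h2 ⊢
    rw [SymplecticGroup.mem_iff, Matrix.J, Matrix.fromBlocks_transpose,
      Matrix.fromBlocks_multiply, Matrix.fromBlocks_multiply]
    simp [Matrix.transpose_mul, hσ.eq, h1, h2, Matrix.mul_assoc]
    rw [← Matrix.mul_assoc, h1, Matrix.one_mul, add_neg_cancel]⟩

/-- The coefficient
`c(t,r;q,λ) = Ψ(tr(S[λ]σ)) 𝐞_𝐚(tr(S[λ](i q ᵗq))) (det q)_𝐚^k 𝐞_𝐚(i tr(ᵗq t q + ᵗq ᵗr λ q)) c₀`,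
where `c₀ = c₀(t,r;q_𝐡,λ_𝐡)`. -/
def jacobiCoeff (k : InfinitePlace F → ℤ) (S : Matrix (Fin l) (Fin l) F)
    (c₀ : Matrix (Fin n) (Fin n) F → Matrix (Fin l) (Fin n) F →
      GL (Fin n) (FiniteAdeleRing (𝓞 F) F) → Matrix (Fin l) (Fin n) (FiniteAdeleRing (𝓞 F) F) → ℂ)
    (t : Matrix (Fin n) (Fin n) F) (r : Matrix (Fin l) (Fin n) F)
    (q : GL (Fin n) (AdeleRing (𝓞 F) F)) (lam : Matrix (Fin l) (Fin n) (AdeleRing (𝓞 F) F))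
    (σ : Matrix (Fin n) (Fin n) (AdeleRing (𝓞 F) F)) : ℂ :=
  let qv : InfinitePlace F → Matrix (Fin n) (Fin n) ℝ :=
    fun v => q.1.map fun x => realAt v (toArch F x)
  let lamv : InfinitePlace F → Matrix (Fin l) (Fin n) ℝ :=
    fun v => lam.map fun x => realAt v (toArch F x)
  psi (lamᵀ * S.map (algebraMap F (AdeleRing (𝓞 F) F)) * lam * σ).trace *
    expArch (fun v => Complex.I *
      (((lamv v)ᵀ * S.map (realEmb v) * lamv v * (qv v * (qv v)ᵀ)).trace : ℝ)) *
    (∏ v, (((qv v).det : ℝ) : ℂ) ^ k v) *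
    expArch (fun v => Complex.I *
      (((qv v)ᵀ * t.map (realEmb v) * qv v + (qv v)ᵀ * (r.map (realEmb v))ᵀ * lamv v * qv v).trace
        : ℝ)) *
    c₀ t r (Matrix.GeneralLinearGroup.map (toFin F) q) (lam.map (toFin F))

end adelic

end
end SiegelJacobi

open SiegelJacobi

/-!
Fix `q` and `λ`. On the Siegel parabolic subgroup the values of `𝐟` are governed by the function
`G(σ, m) = Ψ(-tr(S[λ]σ)) 𝐟((λ, m - λσ, 0) [[q, σ q̃], [0, q̃]])` (`normalizedForm`) of a symmetric
adelic matrix `σ` and an adelic matrix `m`. The shift by `λσ` and the phase are chosen so that the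
Heisenberg cocycle disappears: `G` is invariant under all rational translations
(`IsAdelicSiegelJacobiForm.normalizedForm_add_rational`), and under all translations at the finite
places which come from the level group and have trivial quadratic phase
(`IsAdelicSiegelJacobiForm.normalizedForm_add_fin`). The latter include those by a sufficiently
small lattice (`IsAdelicSiegelJacobiForm.exists_invariant_lattice`). The assertion is that `G` is an
absolutely convergent series of the characters `(σ, m) ↦ Ψ(tr(tσ)) Ψ(tr(ᵗr m))` (`fourierChar`).

For `(σ, m)` supported at the archimedean places this is the Fourier expansion of the classical form
attached to `(λ, 0, 0) diag(q, q̃)` at the finite places, evaluated at `τ = i q ᵗq + σ` and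
`w = λτ + m - λσ` (`IsAdelicSiegelJacobiForm.exists_arch_expansion`). Its coefficients depend on
`q_𝐡` and `λ_𝐡` only, up to the explicit factor `archFactor` from the automorphy factor and from the
imaginary part of `τ`. The coefficients are unique: averaging over the multiples of a translation
shows that an absolutely convergent series of distinct unitary characters vanishes only if all its
coefficients do (`eq_zero_of_hasSum_characters`, `fourier_coeff_eq`). Hence whenever the series is
invariant under a translation, all characters which occur are trivial on that translation
(`fourierChar_eq_one_of_invariant`). A rational translation lying in the invariant lattice acts
through its archimedean part alone, so the characters which occur are trivial on that archimedean
part; as `Ψ` is trivial on `F`, they are trivial on its finite part. Since `F` is dense in the finite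
adeles (`exists_algebraMap_sub_small`), they are trivial on the whole lattice, and every `(σ, m)` is
the sum of a rational, an archimedean, and a lattice translation. This gives the expansion at all
places (`IsAdelicSiegelJacobiForm.hasSum_normalizedForm`).

The equivariance under `GL_n(F)` follows from the invariance of `𝐟` under `diag(a, ᵗa⁻¹)` and
uniqueness (`IsAdelicSiegelJacobiForm.coeff_indexEquiv`); the factor `χ(det a)` is `1`, as `χ` is
trivial on `Fˣ`. If `λq` is integral at the finite places, then the quadratic phases are trivial on
the whole level group, because `S ∈ 𝔟𝔡⁻¹𝒯_l`
(`IsAdelicSiegelJacobiForm.normalizedForm_add_of_integral`). The characters which occur are then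
trivial on `q s ᵗq` for symmetric `s` over `𝔟⁻¹` and on `x ᵗq` for `x` over `𝔟⁻¹`, and the duality of
`𝔟_v⁻¹` and `𝔟_v 𝔡_v⁻¹` under `Ψ_v` (`mem_locIdeal_of_psiLocal`, `mem_locLattice_of_psiLocal`)
turns this into the local conditions (`IsAdelicSiegelJacobiForm.local_conditions`).

The properties of `Ψ` used here rest on the isomorphism of `F ⊗ ℚ_p` with the product of the
completions of `F` above `p`. It appears in the form that an integral basis of `F` is a `ℚ_p`-basis
of that product (`padicBasis`) and a `ℤ_p`-basis of its maximal order (`norm_coeff_le_one`). Thus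
the global trace is the sum of the local ones (`trace_eq_sum_local`), whence `Ψ` is trivial on `F`
(`psi_algebraMap`), and `𝔡_v⁻¹` is the dual of `𝔬_v` (`psiLocal_eq_one_of_mem`,
`mem_locIdeal_invDifferent`).
-/

namespace SiegelJacobi
noncomputable section

/-! ### Approximation in the finite adeles -/

section approximation
variable {F : Type*} [Field F] [NumberField F]

theorem valued_algebraMap (v : HeightOneSpectrum (𝓞 F)) (x : F) :
    Valued.v (algebraMap F (v.adicCompletion F) x) = v.valuation F x :=
  v.valuedAdicCompletion_eq_valuation' x

theorem valued_algebraMap_int_le_one (v : HeightOneSpectrum (𝓞 F)) (x : 𝓞 F) :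
    Valued.v (algebraMap F (v.adicCompletion F) (x : F)) ≤ 1 := by
  rw [valued_algebraMap]; exact v.valuation_le_one x

theorem valued_le_iff_norm_le (v : HeightOneSpectrum (𝓞 F)) (x y : v.adicCompletion F) :
    Valued.v x ≤ Valued.v y ↔ ‖x‖ ≤ ‖y‖ := by
  rw [FinitePlace.norm_def, FinitePlace.norm_def, NNReal.coe_le_coe]
  exact (WithZeroMulInt.toNNReal_strictMono
    (HeightOneSpectrum.one_lt_absNorm_nnreal v)).le_iff_le.symm

theorem valued_le_one_iff (v : HeightOneSpectrum (𝓞 F)) (x : v.adicCompletion F) :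
    Valued.v x ≤ 1 ↔ ‖x‖ ≤ 1 := by
  rw [← map_one (Valued.v : Valuation (v.adicCompletion F) _), valued_le_iff_norm_le, norm_one]

/-- `𝔬` is dense in `𝔬_v`. -/
theorem exists_int_valued_sub_le (v : HeightOneSpectrum (𝓞 F)) {x : v.adicCompletion F}
    (hx : Valued.v x ≤ 1) {M : 𝓞 F} (hM : M ≠ 0) :
    ∃ a : 𝓞 F, Valued.v (algebraMap F (v.adicCompletion F) a - x) ≤
      Valued.v (algebraMap F (v.adicCompletion F) (M : F)) := by
  have hM' : (M : F) ≠ 0 := by exact_mod_cast hM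
  have hm : algebraMap F (v.adicCompletion F) (M : F) ≠ 0 := by simpa using hM
  have hd := v.denseRange_algebraMap (K := F)
  obtain ⟨y, hy⟩ := hd.exists_dist_lt x (norm_pos_iff.2 hm)
  have hy' : Valued.v (algebraMap F (v.adicCompletion F) y - x) ≤
      Valued.v (algebraMap F (v.adicCompletion F) (M : F)) := by
    rw [valued_le_iff_norm_le, ← dist_eq_norm, dist_comm]; exact hy.le
  have hy1 : v.valuation F y ≤ 1 := by
    rw [← valued_algebraMap]
    have := Valued.v.map_add (algebraMap F (v.adicCompletion F) y - x) x
    rw [sub_add_cancel] at this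
    exact this.trans (max_le (hy'.trans (valued_algebraMap_int_le_one v M)) hx)
  have hu : v.valuation F (M : F) ≠ 0 := (Valuation.ne_zero_iff _).2 hM'
  obtain ⟨a, ha⟩ := v.exists_valuation_sub_lt_of_integer hy1 (Units.mk0 _ hu)
  refine ⟨a, ?_⟩
  rw [← sub_add_sub_cancel _ (algebraMap F (v.adicCompletion F) y) x]
  refine (Valued.v.map_add _ _).trans (max_le ?_ hy')
  rw [← map_sub, valued_algebraMap, valued_algebraMap]
  exact ha.le

/-- Simultaneous approximation at finitely many places by an integer of the field (the Chinese
remainder theorem). -/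
theorem exists_int_forall_valued_sub_le (T : Finset (HeightOneSpectrum (𝓞 F)))
    (x : ∀ v : HeightOneSpectrum (𝓞 F), v.adicCompletion F) (hx : ∀ v, Valued.v (x v) ≤ 1)
    {M : 𝓞 F} (hM : M ≠ 0) :
    ∃ a : 𝓞 F, ∀ v ∈ T, Valued.v (algebraMap F (v.adicCompletion F) a - x v) ≤
      Valued.v (algebraMap F (v.adicCompletion F) (M : F)) := by
  choose y hy using fun v => exists_int_valued_sub_le v (hx v) hM
  have hn : ∀ v : HeightOneSpectrum (𝓞 F), ∃ n : ℕ,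
      WithZero.exp (-(n : ℤ)) ≤ v.intValuation M := by
    intro v
    have h0 : v.intValuation M ≠ 0 := v.intValuation_ne_zero _ hM
    refine ⟨(-(WithZero.log (v.intValuation M))).toNat, ?_⟩
    rw [← WithZero.exp_log h0, WithZero.exp_le_exp, WithZero.log_exp]
    omega
  choose n hn using hn
  obtain ⟨a, ha⟩ := IsDedekindDomain.exists_forall_sub_mem_ideal (s := T)
    (fun v : HeightOneSpectrum (𝓞 F) => v.asIdeal) n (fun v _ => v.prime)
    (fun v _ w _ hvw h => hvw (HeightOneSpectrum.ext h)) (fun v => y v.1)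
  refine ⟨a, fun v hv => ?_⟩
  rw [← sub_add_sub_cancel _ (algebraMap F (v.adicCompletion F) (y v)) (x v)]
  refine (Valued.v.map_add _ _).trans (max_le ?_ (hy v))
  rw [← map_sub, valued_algebraMap, valued_algebraMap, ← map_sub (algebraMap (𝓞 F) F),
    v.valuation_of_algebraMap, v.valuation_of_algebraMap]
  exact ((v.intValuation_le_pow_iff_mem _ _).2 (ha v hv)).trans (hn v)

theorem finite_setOf_mem_asIdeal {M : 𝓞 F} (hM : M ≠ 0) :
    {v : HeightOneSpectrum (𝓞 F) | M ∈ v.asIdeal}.Finite := by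
  have := Ideal.finite_factors (I := Ideal.span {M}) (by simpa using hM)
  refine this.subset fun v hv => ?_
  exact Ideal.dvd_iff_le.2 ((Ideal.span_singleton_le_iff_mem _).2 hv)

/-- A common denominator of a finite adele. -/
theorem exists_int_mul_integral (x : FiniteAdeleRing (𝓞 F) F) :
    ∃ d : 𝓞 F, d ≠ 0 ∧ ∀ v, Valued.v (algebraMap F (v.adicCompletion F) d * x v) ≤ 1 := by
  classical
  have hfin : {v | ¬ x v ∈ v.adicCompletionIntegers F}.Finite := x.2
  choose b hb hb' using fun v : HeightOneSpectrum (𝓞 F) =>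
    HeightOneSpectrum.adicCompletion.mul_nonZeroDivisor_mem_adicCompletionIntegers v (x v)
  refine ⟨∏ v ∈ hfin.toFinset, b v, Finset.prod_ne_zero_iff.2 fun v _ =>
    nonZeroDivisors.ne_zero (hb v), fun v => ?_⟩
  by_cases hv : x v ∈ v.adicCompletionIntegers F
  · rw [map_mul]
    exact mul_le_one' (valued_algebraMap_int_le_one v _) hv
  · rw [← Finset.mul_prod_erase _ _ (hfin.mem_toFinset.2 hv), mul_comm (b v),
      show ∀ y z : 𝓞 F, ((y * z : 𝓞 F) : F) = y * z from map_mul (algebraMap (𝓞 F) F),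
      map_mul (algebraMap F (v.adicCompletion F)), mul_assoc, map_mul]
    refine mul_le_one' (valued_algebraMap_int_le_one v _) ?_
    rw [mul_comm]
    exact hb' v

/-- `F` is dense in the finite adeles. -/
theorem exists_algebraMap_sub_small (x : FiniteAdeleRing (𝓞 F) F) {M : 𝓞 F} (hM : M ≠ 0) :
    ∃ a : F, ∀ v, Valued.v (algebraMap F (v.adicCompletion F) a - x v) ≤
      Valued.v (algebraMap F (v.adicCompletion F) (M : F)) := by
  obtain ⟨d, hd, hdx⟩ := exists_int_mul_integral x
  have hd' : (d : F) ≠ 0 := by exact_mod_cast hd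
  have hdM : d * M ≠ 0 := mul_ne_zero hd hM
  obtain ⟨a, ha⟩ := exists_int_forall_valued_sub_le (finite_setOf_mem_asIdeal hdM).toFinset
    (fun v => algebraMap F (v.adicCompletion F) d * x v) hdx hdM
  refine ⟨a / d, fun v => ?_⟩
  have hdv : Valued.v (algebraMap F (v.adicCompletion F) (d : F)) ≠ 0 := by
    rw [valued_algebraMap]; exact (Valuation.ne_zero_iff _).2 hd'
  have key : Valued.v (algebraMap F (v.adicCompletion F) a - algebraMap F (v.adicCompletion F) d *
      x v) ≤ Valued.v (algebraMap F (v.adicCompletion F) ((d * M : 𝓞 F) : F)) := by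
    by_cases hv : d * M ∈ v.asIdeal
    · exact ha v (by simpa using hv)
    · have h1 : Valued.v (algebraMap F (v.adicCompletion F) ((d * M : 𝓞 F) : F)) = 1 := by
        rw [valued_algebraMap]; exact v.valuation_eq_one_iff_notMem.2 hv
      rw [h1]
      exact (Valued.v.map_sub _ _).trans (max_le (valued_algebraMap_int_le_one v a) (hdx v))
  have e : algebraMap F (v.adicCompletion F) a - algebraMap F (v.adicCompletion F) d * x v =
      algebraMap F (v.adicCompletion F) d * (algebraMap F (v.adicCompletion F) (a / d) - x v) := by
    rw [mul_sub, ← map_mul, mul_div_cancel₀ _ hd']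
  rw [e, show ((d * M : 𝓞 F) : F) = d * M from map_mul (algebraMap (𝓞 F) F) d M,
    map_mul (algebraMap F (v.adicCompletion F)), map_mul, map_mul] at key
  exact (mul_le_mul_iff_of_pos_left (zero_lt_iff.2 hdv)).1 key

end approximation

/-! ### The embedding of `ℚ_p` into the completions above `p` -/

section padic
variable {F : Type*} [Field F] [NumberField F] {p : ℕ}

theorem algebraMap_rat_adicCompletion (v : HeightOneSpectrum (𝓞 F)) (q : ℚ) :
    algebraMap ℚ (v.adicCompletion F) q = algebraMap F (v.adicCompletion F) (q : F) := by
  rw [IsScalarTower.algebraMap_apply ℚ F (v.adicCompletion F), eq_ratCast (algebraMap ℚ F)]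

theorem valued_rat_eq (v : HeightOneSpectrum (𝓞 F)) (q : ℚ) :
    Valued.v (algebraMap ℚ (v.adicCompletion F) q) = v.valuation F (q : F) := by
  rw [algebraMap_rat_adicCompletion, valued_algebraMap]

theorem norm_prime_lt_one {v : HeightOneSpectrum (𝓞 F)} (hv : (p : 𝓞 F) ∈ v.asIdeal) :
    ‖algebraMap ℚ (v.adicCompletion F) (p : ℚ)‖ < 1 := by
  have h := (FinitePlace.norm_lt_one_iff_mem F v (p : 𝓞 F)).2 hv
  rw [map_natCast, FinitePlace.embedding_apply] at h
  rw [algebraMap_rat_adicCompletion, Rat.cast_natCast]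
  exact h

variable [Fact p.Prime]

theorem valuation_natCast_eq_one {v : HeightOneSpectrum (𝓞 F)} (hv : (p : 𝓞 F) ∈ v.asIdeal)
    {m : ℕ} (hm : ¬ p ∣ m) : v.valuation F (m : F) = 1 := by
  have h : (m : 𝓞 F) ∉ v.asIdeal := by
    intro h
    have hc : IsCoprime (p : ℤ) (m : ℤ) :=
      Nat.isCoprime_iff_coprime.2 (((Fact.out : p.Prime).coprime_iff_not_dvd).2 hm)
    obtain ⟨a, b, hab⟩ := hc
    have h1 : (a : 𝓞 F) * (p : 𝓞 F) + b * (m : 𝓞 F) = 1 := by exact_mod_cast congrArg (Int.cast : ℤ → 𝓞 F) hab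
    exact v.isPrime.ne_top ((Ideal.eq_top_iff_one _).2 (h1 ▸ add_mem (Ideal.mul_mem_left _ _ hv)
      (Ideal.mul_mem_left _ _ h)))
  have := v.valuation_eq_one_iff_notMem (K := F).2 h
  rwa [map_natCast] at this

theorem valuation_intCast_le_one (v : HeightOneSpectrum (𝓞 F)) (m : ℤ) :
    v.valuation F (m : F) ≤ 1 := by
  have : v.valuation F (algebraMap (𝓞 F) F m) ≤ 1 := v.valuation_le_one _
  rwa [map_intCast] at this

theorem not_dvd_den_of_norm_le_one {q : ℚ} (hq : ‖(q : ℚ_[p])‖ ≤ 1) : ¬ p ∣ q.den := by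
  intro h
  have h1 : ‖(q.den : ℚ_[p])‖ < 1 := (Padic.norm_natCast_lt_one_iff).2 h
  have h2 : ¬ ‖(q.num : ℚ_[p])‖ < 1 := by
    rw [Padic.norm_intCast_lt_one_iff, Int.natCast_dvd]
    intro h2
    have := Nat.dvd_gcd h2 h
    rw [q.reduced] at this
    exact (Fact.out : p.Prime).one_lt.ne' (Nat.dvd_one.1 this)
  apply h2
  have e : (q.num : ℚ_[p]) = q * q.den := by exact_mod_cast (Rat.mul_den_eq_num q).symm
  rw [e, norm_mul]
  exact (mul_le_of_le_one_left (norm_nonneg _) hq).trans_lt h1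

theorem valued_rat_le_one {v : HeightOneSpectrum (𝓞 F)} (hv : (p : 𝓞 F) ∈ v.asIdeal) {q : ℚ}
    (hq : ‖(q : ℚ_[p])‖ ≤ 1) : Valued.v (algebraMap ℚ (v.adicCompletion F) q) ≤ 1 := by
  have hd : ¬ p ∣ q.den := not_dvd_den_of_norm_le_one hq
  rw [valued_rat_eq, Rat.cast_def, map_div₀, valuation_natCast_eq_one hv hd, div_one]
  exact valuation_intCast_le_one v _

/-- `ℚ → F_v` is uniformly continuous for the `p`-adic uniformity of `ℚ`, which is the one carried by
`WithVal (Rat.padicValuation p)`. -/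
theorem uniformContinuous_rat_adicCompletion {v : HeightOneSpectrum (𝓞 F)}
    (hv : (p : 𝓞 F) ∈ v.asIdeal) :
    UniformContinuous ((algebraMap ℚ (v.adicCompletion F)).comp
      (WithVal.equiv (Rat.padicValuation p)).toRingHom) := by
  have hi := Padic.isUniformInducing_cast_withVal (p := p)
  rw [UniformContinuous, ← hi.comap_uniformity]
  refine ((Metric.uniformity_basis_dist.comap _).tendsto_iff Metric.uniformity_basis_dist).2 ?_
  intro ε hε
  obtain ⟨N, hN⟩ := exists_pow_lt_of_lt_one hε (norm_prime_lt_one hv)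
  have hp0 : (p : ℚ) ≠ 0 := by exact_mod_cast (Fact.out : p.Prime).ne_zero
  have hpp : (0 : ℝ) < p := by exact_mod_cast (Fact.out : p.Prime).pos
  refine ⟨(p : ℝ)⁻¹ ^ N, by positivity, ?_⟩
  rintro ⟨x, y⟩ hxy
  set x' : ℚ := WithVal.equiv (Rat.padicValuation p) x with hx
  set y' : ℚ := WithVal.equiv (Rat.padicValuation p) y with hy
  change dist (x' : ℚ_[p]) (y' : ℚ_[p]) < _ at hxy
  change dist (algebraMap ℚ (v.adicCompletion F) x') (algebraMap ℚ (v.adicCompletion F) y') < _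
  rw [dist_eq_norm] at hxy ⊢
  have hz : ‖(((x' - y') / (p : ℚ) ^ N : ℚ) : ℚ_[p])‖ ≤ 1 := by
    push_cast
    rw [norm_div, norm_pow, Padic.norm_p]
    exact div_le_one_of_le₀ hxy.le (by positivity)
  have h2 := (valued_le_one_iff v _).1 (valued_rat_le_one hv hz)
  have e : algebraMap ℚ (v.adicCompletion F) x' - algebraMap ℚ (v.adicCompletion F) y' =
      algebraMap ℚ (v.adicCompletion F) (p : ℚ) ^ N *
        algebraMap ℚ (v.adicCompletion F) ((x' - y') / (p : ℚ) ^ N) := by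
    rw [← map_sub, ← map_pow, ← map_mul, mul_div_cancel₀ _ (pow_ne_zero _ hp0)]
  rw [e, norm_mul, norm_pow]
  exact (mul_le_of_le_one_right (by positivity) h2).trans_lt hN

/-- The embedding `ℚ_p → F_v` for a finite place `v` above `p`. -/
def padicEmb (v : HeightOneSpectrum (𝓞 F)) (hv : (p : 𝓞 F) ∈ v.asIdeal) :
    ℚ_[p] →+* v.adicCompletion F :=
  IsDenseInducing.extendRingHom (Padic.isUniformInducing_cast_withVal (p := p))
    (Padic.isDenseInducing_cast_withVal (p := p)).dense (uniformContinuous_rat_adicCompletion hv)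

variable {v : HeightOneSpectrum (𝓞 F)} (hv : (p : 𝓞 F) ∈ v.asIdeal)

theorem continuous_padicEmb : Continuous (padicEmb v hv) :=
  (uniformContinuous_uniformly_extend (Padic.isUniformInducing_cast_withVal (p := p))
    (Padic.isDenseInducing_cast_withVal (p := p)).dense
      (uniformContinuous_rat_adicCompletion hv)).continuous

theorem padicEmb_ratCast (q : ℚ) : padicEmb v hv q = algebraMap ℚ (v.adicCompletion F) q := by
  rw [map_ratCast, eq_ratCast]

/-- `ℚ_p ∩ 𝔬_v = ℤ_p`. -/
theorem valued_padicEmb_le_one_iff (x : ℚ_[p]) :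
    Valued.v (padicEmb v hv x) ≤ 1 ↔ ‖x‖ ≤ 1 := by
  have h1 : ∀ x : ℚ_[p], ‖x‖ ≤ 1 → Valued.v (padicEmb v hv x) ≤ 1 := by
    intro x hx
    have hc : IsClosed {x : ℚ_[p] | ‖padicEmb v hv x‖ ≤ 1} :=
      isClosed_le (continuous_norm.comp (continuous_padicEmb hv)) continuous_const
    rw [valued_le_one_iff]
    have hd := PadicInt.denseRange_intCast (p := p)
    have : (⟨x, hx⟩ : ℤ_[p]) ∈ {y : ℤ_[p] | ‖padicEmb v hv (y : ℚ_[p])‖ ≤ 1} := by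
      have hc' : IsClosed {y : ℤ_[p] | ‖padicEmb v hv (y : ℚ_[p])‖ ≤ 1} :=
        hc.preimage continuous_subtype_val
      refine hc'.closure_subset_iff.2 ?_ (hd _)
      rintro _ ⟨m, rfl⟩
      simp only [Set.mem_ofPred_eq, PadicInt.coe_intCast, map_intCast]
      rw [← valued_le_one_iff]
      have := valuation_intCast_le_one v m
      rwa [← valued_algebraMap, map_intCast] at this
    exact this
  refine ⟨fun h => ?_, h1 x⟩
  by_contra hx
  push Not at hx
  have hx0 : x ≠ 0 := by rintro rfl; simp at hx; linarith
  have hpp : (0 : ℝ) < p := by exact_mod_cast (Fact.out : p.Prime).pos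
  -- `1 < ‖x‖` forces `‖x⁻¹‖ ≤ p⁻¹`, as the norm takes values in powers of `p`
  have h2 : ‖(p : ℚ_[p])⁻¹ * x⁻¹‖ ≤ 1 := by
    rw [norm_mul, norm_inv, norm_inv, Padic.norm_p, inv_inv]
    have h3 : ‖x⁻¹‖ < 1 := by rw [norm_inv]; exact inv_lt_one_of_one_lt₀ hx
    have h4 := (Padic.norm_le_pow_iff_norm_lt_pow_add_one x⁻¹ (-1)).2 (by simpa using h3)
    rw [norm_inv, _root_.zpow_neg_one] at h4
    calc (p : ℝ) * ‖x‖⁻¹ ≤ p * (p : ℝ)⁻¹ := by gcongr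
      _ = 1 := mul_inv_cancel₀ hpp.ne'
  have h5 := (valued_le_one_iff v _).1 (h1 _ h2)
  rw [valued_le_one_iff] at h
  have hp1 := norm_prime_lt_one (F := F) hv
  have hp0 : (p : ℚ_[p]) ≠ 0 := by exact_mod_cast (Fact.out : p.Prime).ne_zero
  have e : padicEmb v hv ((p : ℚ_[p])⁻¹ * x⁻¹) * padicEmb v hv x *
      algebraMap ℚ (v.adicCompletion F) (p : ℚ) = 1 := by
    have : algebraMap ℚ (v.adicCompletion F) (p : ℚ) = padicEmb v hv (p : ℚ_[p]) := by
      rw [map_natCast, map_natCast]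
    rw [this, ← map_mul, ← map_mul, ← map_one (padicEmb v hv)]
    congr 1
    field_simp
  have e2 := congrArg norm e
  rw [norm_mul, norm_mul, norm_one] at e2
  have : ‖padicEmb v hv ((p : ℚ_[p])⁻¹ * x⁻¹)‖ * ‖padicEmb v hv x‖ *
      ‖algebraMap ℚ (v.adicCompletion F) (p : ℚ)‖ < 1 := by
    calc _ ≤ 1 * ‖algebraMap ℚ (v.adicCompletion F) (p : ℚ)‖ := by
          gcongr
          exact mul_le_one₀ h5 (norm_nonneg _) h
      _ < 1 := by rwa [one_mul]
  linarith

end padic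

/-! ### The algebra `F ⊗ ℚ_p` and its trace -/

theorem trace_pi {ι R : Type*} {A : ι → Type*} [Fintype ι] [CommRing R] [∀ i, CommRing (A i)]
    [∀ i, Algebra R (A i)] [∀ i, Module.Free R (A i)] [∀ i, Module.Finite R (A i)]
    (x : ∀ i, A i) : Algebra.trace R (∀ i, A i) x = ∑ i, Algebra.trace R (A i) (x i) := by
  classical
  let b := fun i => Module.Free.chooseBasis R (A i)
  rw [Algebra.trace_eq_matrix_trace (Pi.basis b)]
  simp only [Algebra.trace_eq_matrix_trace (b _), Matrix.trace, Fintype.sum_sigma, Matrix.diag,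
    Algebra.leftMulMatrix_eq_repr_mul, Pi.basis_repr, Pi.mul_apply, Pi.basis_apply,
    Pi.single_eq_same]

theorem norm_inv_prime_mul_le_one {p : ℕ} [Fact p.Prime] {x : ℚ_[p]} (hx : ‖x‖ < 1) :
    ‖(p : ℚ_[p])⁻¹ * x‖ ≤ 1 := by
  have hpp : (0 : ℝ) < p := by exact_mod_cast (Fact.out : p.Prime).pos
  rw [norm_mul, norm_inv, Padic.norm_p, inv_inv]
  have h4 := (Padic.norm_le_pow_iff_norm_lt_pow_add_one x (-1)).2 (by simpa using hx)
  rw [_root_.zpow_neg_one] at h4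
  calc (p : ℝ) * ‖x‖ ≤ p * (p : ℝ)⁻¹ := by gcongr
    _ = 1 := mul_inv_cancel₀ hpp.ne'

section padic
variable {F : Type*} [Field F] [NumberField F]

/-- The finite places of `F` above `p`. -/
abbrev PlacesAbove (F : Type*) [Field F] [NumberField F] (p : ℕ) : Type _ :=
  {v : HeightOneSpectrum (𝓞 F) // (p : 𝓞 F) ∈ v.asIdeal}

variable {p : ℕ}

theorem valuation_prime_eq_one {v : HeightOneSpectrum (𝓞 F)} (hv : (p : 𝓞 F) ∉ v.asIdeal) :
    v.valuation F (p : F) = 1 := by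
  have := v.valuation_eq_one_iff_notMem (K := F).2 hv
  rwa [map_natCast] at this

variable [Fact p.Prime]

instance : Finite (PlacesAbove F p) :=
  (finite_setOf_mem_asIdeal (M := (p : 𝓞 F))
    (by exact_mod_cast (Fact.out : p.Prime).ne_zero)).to_subtype

noncomputable instance : Fintype (PlacesAbove F p) := Fintype.ofFinite _

instance algebraPadicCompletion (v : PlacesAbove F p) : Algebra ℚ_[p] (v.1.adicCompletion F) :=
  (padicEmb v.1 v.2).toAlgebra

instance (v : PlacesAbove F p) : ContinuousSMul ℚ_[p] (v.1.adicCompletion F) :=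
  continuousSMul_of_algebraMap _ _ (continuous_padicEmb v.2)

/-- `F ⊗ ℚ_p`, realised as the product of the completions of `F` above `p`. -/
abbrev CompletionAbove (F : Type*) [Field F] [NumberField F] (p : ℕ) : Type _ :=
  ∀ v : PlacesAbove F p, v.1.adicCompletion F

/-- If `∑ cᵢ ωᵢ` is divisible by `p` in all completions above `p`, for an integral basis `ω` and
`p`-adic integers `cᵢ`, then all `cᵢ` are divisible by `p`. -/
theorem norm_coeff_lt_one (c : Module.Free.ChooseBasisIndex ℤ (𝓞 F) → ℚ_[p])
    (hc : ∀ i, ‖c i‖ ≤ 1)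
    (h : ∀ v : PlacesAbove F p, Valued.v (∑ i, padicEmb v.1 v.2 (c i) *
      algebraMap F (v.1.adicCompletion F) (integralBasis F i)) ≤
        Valued.v (algebraMap F (v.1.adicCompletion F) (p : F))) (i) : ‖c i‖ < 1 := by
  have hpp : (0 : ℝ) < p := by exact_mod_cast (Fact.out : p.Prime).pos
  have hp0 : (p : ℚ_[p]) ≠ 0 := by exact_mod_cast (Fact.out : p.Prime).ne_zero
  have hpF : (p : F) ≠ 0 := by exact_mod_cast (Fact.out : p.Prime).ne_zero
  -- modulo `p` the `cᵢ` are integers `Aᵢ`, and `α = ∑ Aᵢ ωᵢ` is divisible by `p` at all places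
  have hA : ∀ i, ∃ A : ℤ, ‖c i - A‖ < 1 := by
    intro i
    obtain ⟨A, hA⟩ := PadicInt.denseRange_intCast (p := p) |>.exists_dist_lt
      (⟨c i, hc i⟩ : ℤ_[p]) one_pos
    refine ⟨A, ?_⟩
    have hA' : dist (c i) ((A : ℤ_[p]) : ℚ_[p]) < 1 := hA
    rwa [dist_eq_norm, PadicInt.coe_intCast] at hA'
  choose A hA using hA
  have hd : ∀ i, ‖(p : ℚ_[p])⁻¹ * (c i - A i)‖ ≤ 1 := fun i => norm_inv_prime_mul_le_one (hA i)
  set α : 𝓞 F := ∑ i, A i • RingOfIntegers.basis F i with hα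
  have hα' : (α : F) = ∑ i, (A i : F) * integralBasis F i := by
    rw [hα, show ((∑ i, A i • RingOfIntegers.basis F i : 𝓞 F) : F) =
      ∑ i, algebraMap (𝓞 F) F (A i • RingOfIntegers.basis F i) from map_sum (algebraMap (𝓞 F) F) _ _]
    refine Finset.sum_congr rfl fun i _ => ?_
    rw [integralBasis_apply, zsmul_eq_mul, map_mul, map_intCast]
  have hdiv : ∀ v : HeightOneSpectrum (𝓞 F), v.valuation F ((α : F) / p) ≤ 1 := by
    intro v
    rw [map_div₀]
    by_cases hv : (p : 𝓞 F) ∈ v.asIdeal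
    · refine div_le_one_of_le₀ ?_ zero_le
      have e : algebraMap F (v.adicCompletion F) (α : F) =
          ∑ i, padicEmb v hv (c i) * algebraMap F (v.adicCompletion F) (integralBasis F i) -
          algebraMap F (v.adicCompletion F) (p : F) * ∑ i, padicEmb v hv ((p : ℚ_[p])⁻¹ * (c i - A i)) *
            algebraMap F (v.adicCompletion F) (integralBasis F i) := by
        rw [hα', map_sum, Finset.mul_sum, ← Finset.sum_sub_distrib]
        refine Finset.sum_congr rfl fun i _ => ?_
        rw [← mul_assoc, map_natCast, ← map_natCast (padicEmb v hv), ← map_mul, ← mul_assoc,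
          mul_inv_cancel₀ hp0, one_mul, map_sub, map_mul, map_intCast, map_intCast]
        ring
      rw [← valued_algebraMap, e, ← valued_algebraMap]
      refine (Valued.v.map_sub _ _).trans (max_le (h ⟨v, hv⟩) ?_)
      rw [map_mul]
      refine mul_le_of_le_one_right' (Valued.v.map_sum_le fun i _ => ?_)
      rw [map_mul]
      refine mul_le_one' ((valued_padicEmb_le_one_iff hv _).2 (hd i)) ?_
      rw [integralBasis_apply]
      exact valued_algebraMap_int_le_one v _
    · rw [valuation_prime_eq_one hv, div_one]
      exact v.valuation_le_one α
  obtain ⟨β, hβ⟩ := HeightOneSpectrum.mem_integers_of_valuation_le_one F _ hdiv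
  have hαβ : α = p * β := by
    apply RingOfIntegers.ext
    rw [show ((p * β : 𝓞 F) : F) = p * β by
      rw [show ((p * β : 𝓞 F) : F) = algebraMap (𝓞 F) F (p * β) from rfl, map_mul, map_natCast],
      show (β : F) = α / p from hβ, mul_div_cancel₀ _ hpF]
  have hAi : A i = p * (RingOfIntegers.basis F).repr β i := by
    have h1 : (RingOfIntegers.basis F).repr α i = A i := by
      rw [hα, (RingOfIntegers.basis F).repr_sum_self]
    rw [← h1, hαβ, ← nsmul_eq_mul, map_nsmul]
    simp
  rw [← sub_add_cancel (c i) (A i)]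
  refine (IsUltrametricDist.norm_add_le_max _ _).trans_lt (max_lt (hA i) ?_)
  rw [Padic.norm_intCast_lt_one_iff, hAi]
  exact dvd_mul_right _ _

/-- `𝔬 ⊗ ℤ_p` is the maximal order `∏ 𝔬_v` of `F ⊗ ℚ_p`. -/
theorem norm_coeff_le_one (a : Module.Free.ChooseBasisIndex ℤ (𝓞 F) → ℚ_[p])
    (h : ∀ v : PlacesAbove F p, Valued.v (∑ i, padicEmb v.1 v.2 (a i) *
      algebraMap F (v.1.adicCompletion F) (integralBasis F i)) ≤ 1) (i) : ‖a i‖ ≤ 1 := by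
  have hpp : (0 : ℝ) < p := by exact_mod_cast (Fact.out : p.Prime).pos
  have hp1 : (1 : ℝ) < p := by exact_mod_cast (Fact.out : p.Prime).one_lt
  -- the least power of `p` clearing the denominators is `p ^ 0`
  have hex : ∃ k : ℕ, ∀ i, ‖(p : ℚ_[p]) ^ k * a i‖ ≤ 1 := by
    have h1 : ∀ i, ∀ᶠ k : ℕ in Filter.atTop, ‖(p : ℚ_[p]) ^ k * a i‖ ≤ 1 := by
      intro i
      have h2 : Filter.Tendsto (fun k : ℕ => ‖(p : ℚ_[p]) ^ k * a i‖) Filter.atTop (nhds 0) := by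
        have := (tendsto_pow_atTop_nhds_zero_of_lt_one (by positivity)
          (inv_lt_one_of_one_lt₀ hp1)).mul_const ‖a i‖
        simpa using this
      exact (h2.eventually_lt_const one_pos).mono fun _ h => h.le
    exact (Filter.eventually_all.2 h1).exists
  classical
  have hk := Nat.find_spec hex
  rcases Nat.eq_zero_or_pos (Nat.find hex) with h0 | h0
  · rw [h0] at hk; simpa using hk i
  · exfalso
    apply Nat.find_min hex (Nat.sub_lt h0 one_pos)
    set k := Nat.find hex
    have hlt := norm_coeff_lt_one (F := F) (fun i => (p : ℚ_[p]) ^ k * a i) hk (by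
      intro v
      have e : ∑ i, padicEmb v.1 v.2 ((p : ℚ_[p]) ^ k * a i) *
          algebraMap F (v.1.adicCompletion F) (integralBasis F i) =
          algebraMap F (v.1.adicCompletion F) ((p : 𝓞 F) : F) ^ k * ∑ i, padicEmb v.1 v.2 (a i) *
          algebraMap F (v.1.adicCompletion F) (integralBasis F i) := by
        rw [Finset.mul_sum]
        refine Finset.sum_congr rfl fun i _ => ?_
        rw [map_mul, map_pow, map_natCast, mul_assoc]
        simp
      rw [e, map_mul, map_pow]
      have h3 := valued_algebraMap_int_le_one v.1 (p : 𝓞 F)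
      have e2 : ((p : 𝓞 F) : F) = p := map_natCast (algebraMap (𝓞 F) F) p
      calc _ ≤ Valued.v (algebraMap F (v.1.adicCompletion F) ((p : 𝓞 F) : F)) ^ k * 1 := by
            gcongr; exact h v
        _ ≤ _ := by
            rw [mul_one, ← e2]
            exact pow_le_of_le_one zero_le h3 h0.ne')
    intro i
    have hp0 : (p : ℚ_[p]) ≠ 0 := by exact_mod_cast (Fact.out : p.Prime).ne_zero
    have e : (p : ℚ_[p]) ^ (k - 1) * a i = (p : ℚ_[p])⁻¹ * ((p : ℚ_[p]) ^ k * a i) := by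
      conv_rhs => rw [← Nat.sub_add_cancel h0, pow_succ]
      field_simp
    rw [e]
    exact norm_inv_prime_mul_le_one (hlt i)

/-- An integral basis of `F` is linearly independent over `ℚ_p`: the coefficients of a relation, being
divisible by all powers of `p`, vanish. -/
theorem linearIndependent_integralBasis :
    LinearIndependent ℚ_[p] (fun i => algebraMap F (CompletionAbove F p) (integralBasis F i)) := by
  rw [Fintype.linearIndependent_iff]
  intro a ha i
  have hp1 : (1 : ℝ) < p := by exact_mod_cast (Fact.out : p.Prime).one_lt
  have hp0 : (p : ℚ_[p]) ≠ 0 := by exact_mod_cast (Fact.out : p.Prime).ne_zero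
  have hm : ∀ m : ℕ, ‖a i‖ ≤ (p : ℝ)⁻¹ ^ m := by
    intro m
    have h1 := norm_coeff_le_one (F := F) (fun i => ((p : ℚ_[p]) ^ m)⁻¹ * a i) (by
      intro v
      have h2 := congrFun ha v
      rw [Finset.sum_apply] at h2
      change ∑ i, padicEmb v.1 v.2 (a i) *
        algebraMap F (v.1.adicCompletion F) (integralBasis F i) = 0 at h2
      simp only [map_mul, mul_assoc]
      rw [← Finset.mul_sum, h2, mul_zero, map_zero]
      exact zero_le) i
    rw [norm_mul, norm_inv, norm_pow, Padic.norm_p] at h1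
    have h3 : (0 : ℝ) < (p : ℝ)⁻¹ ^ m := by positivity
    rwa [inv_mul_le_iff₀ h3, mul_one] at h1
  have h0 : ‖a i‖ ≤ 0 := ge_of_tendsto' (tendsto_pow_atTop_nhds_zero_of_lt_one (by positivity)
          (inv_lt_one_of_one_lt₀ hp1)) hm
  exact norm_le_zero_iff.1 h0

theorem algebraMap_smul_padic (q : ℚ) (x : F) : algebraMap F (CompletionAbove F p) (q • x) =
    (q : ℚ_[p]) • algebraMap F (CompletionAbove F p) x := by
  funext v
  change algebraMap F (v.1.adicCompletion F) (q • x) =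
    padicEmb v.1 v.2 (q : ℚ_[p]) * algebraMap F (v.1.adicCompletion F) x
  rw [padicEmb_ratCast, algebraMap_rat_adicCompletion, Algebra.smul_def, map_mul,
    eq_ratCast (algebraMap ℚ F)]

/-- An integral basis of `F` spans `F ⊗ ℚ_p`: the span is closed, being of finite dimension, and
contains the dense subset `F`. -/
theorem span_integralBasis :
    ⊤ ≤ Submodule.span ℚ_[p]
      (Set.range fun i => algebraMap F (CompletionAbove F p) (integralBasis F i)) := by
  classical
  set W := Submodule.span ℚ_[p]
      (Set.range fun i => algebraMap F (CompletionAbove F p) (integralBasis F i)) with hW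
  have : FiniteDimensional ℚ_[p] W := FiniteDimensional.span_of_finite _ (Set.finite_range _)
  have hcl : IsClosed (W : Set (CompletionAbove F p)) := W.closed_of_finiteDimensional
  have hF : ∀ x : F, algebraMap F (CompletionAbove F p) x ∈ W := by
    intro x
    rw [← (integralBasis F).sum_repr x, map_sum]
    refine sum_mem fun i _ => ?_
    rw [algebraMap_smul_padic]
    exact W.smul_mem _ (Submodule.subset_span ⟨i, rfl⟩)
  intro X _
  rw [← SetLike.mem_coe, ← hcl.closure_eq, Metric.mem_closure_iff]
  intro ε hε
  -- approximate the finite adele which is `X` above `p` and `0` elsewhere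
  let x : FiniteAdeleRing (𝓞 F) F := ⟨fun v => if h : (p : 𝓞 F) ∈ v.asIdeal then X ⟨v, h⟩ else 0, by
    refine (finite_setOf_mem_asIdeal (M := (p : 𝓞 F))
      (by exact_mod_cast (Fact.out : p.Prime).ne_zero)).subset fun v hv => ?_
    by_contra h
    apply hv
    simp only [Set.mem_ofPred_eq] at h
    simp [dif_neg h]⟩
  have hx : ∀ v : PlacesAbove F p, x v.1 = X v := fun v => dif_pos v.2
  have hN : ∀ v : PlacesAbove F p, ∀ᶠ N : ℕ in Filter.atTop,
      ‖algebraMap ℚ (v.1.adicCompletion F) (p : ℚ)‖ ^ N < ε := fun v =>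
    (tendsto_pow_atTop_nhds_zero_of_lt_one (norm_nonneg _)
      (norm_prime_lt_one v.2)).eventually_lt_const hε
  obtain ⟨N, hN⟩ := (Filter.eventually_all.2 hN).exists
  obtain ⟨a, ha⟩ := exists_algebraMap_sub_small x (M := (p : 𝓞 F) ^ N)
    (pow_ne_zero _ (by exact_mod_cast (Fact.out : p.Prime).ne_zero))
  refine ⟨_, hF a, (dist_pi_lt_iff hε).2 fun v => ?_⟩
  have h1 := ha v.1
  rw [valued_le_iff_norm_le, hx, ← dist_eq_norm, dist_comm] at h1
  refine h1.trans_lt (lt_of_le_of_lt (le_of_eq ?_) (hN v))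
  rw [← norm_pow, ← map_pow, algebraMap_rat_adicCompletion]
  congr 2
  rw [show (((p : 𝓞 F) ^ N : 𝓞 F) : F) = algebraMap (𝓞 F) F ((p : 𝓞 F) ^ N) from rfl]
  simp

/-- An integral basis of `F`, as a `ℚ_p`-basis of `F ⊗ ℚ_p`. -/
def padicBasis (F : Type*) [Field F] [NumberField F] (p : ℕ) [Fact p.Prime] :
    Module.Basis (Module.Free.ChooseBasisIndex ℤ (𝓞 F)) ℚ_[p] (CompletionAbove F p) :=
  Module.Basis.mk linearIndependent_integralBasis span_integralBasis

theorem padicBasis_apply (i) :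
    padicBasis F p i = algebraMap F (CompletionAbove F p) (integralBasis F i) :=
  Module.Basis.mk_apply _ _ _

instance : Module.Finite ℚ_[p] (CompletionAbove F p) := Module.Finite.of_basis (padicBasis F p)

instance (v : PlacesAbove F p) : Module.Finite ℚ_[p] (v.1.adicCompletion F) :=
  Module.Finite.of_surjective (LinearMap.proj (R := ℚ_[p])
    (φ := fun v : PlacesAbove F p => v.1.adicCompletion F) v) (LinearMap.proj_surjective v)

theorem padicBasis_repr_algebraMap (x : F) (i) :
    (padicBasis F p).repr (algebraMap F (CompletionAbove F p) x) i =
      ((integralBasis F).repr x i : ℚ) := by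
  have : algebraMap F (CompletionAbove F p) x =
      ∑ i, ((integralBasis F).repr x i : ℚ_[p]) • padicBasis F p i := by
    conv_lhs => rw [← (integralBasis F).sum_repr x, map_sum]
    simp only [algebraMap_smul_padic, padicBasis_apply]
  rw [this, (padicBasis F p).repr_sum_self]

theorem trace_algebraMap_padic (x : F) :
    Algebra.trace ℚ_[p] (CompletionAbove F p) (algebraMap F (CompletionAbove F p) x) =
      (Algebra.trace ℚ F x : ℚ) := by
  classical
  rw [Algebra.trace_eq_matrix_trace (padicBasis F p), Algebra.trace_eq_matrix_trace (integralBasis F)]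
  simp only [Matrix.trace, Matrix.diag, Algebra.leftMulMatrix_eq_repr_mul, Rat.cast_sum]
  refine Finset.sum_congr rfl fun i _ => ?_
  rw [padicBasis_apply, ← map_mul, padicBasis_repr_algebraMap]

/-- The global trace is the sum of the local traces. -/
theorem trace_eq_sum_local (x : F) :
    ((Algebra.trace ℚ F x : ℚ) : ℚ_[p]) = ∑ v : PlacesAbove F p,
      Algebra.trace ℚ_[p] (v.1.adicCompletion F) (algebraMap F (v.1.adicCompletion F) x) := by
  rw [← trace_algebraMap_padic, trace_pi]
  rfl

end padic

/-! ### The local components of `Ψ` -/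

theorem expC_add (x y : ℂ) : expC (x + y) = expC x * expC y := by
  simp only [expC, mul_add, Complex.exp_add]

theorem expC_zero : expC 0 = 1 := by simp [expC]

theorem expC_neg (x : ℂ) : expC (-x) = (expC x)⁻¹ := by
  simp only [expC, mul_neg, Complex.exp_neg]

theorem expC_ne_zero (x : ℂ) : expC x ≠ 0 := Complex.exp_ne_zero _

theorem expC_sum {ι : Type*} (s : Finset ι) (f : ι → ℂ) :
    expC (∑ i ∈ s, f i) = ∏ i ∈ s, expC (f i) := by
  simp only [expC, Finset.mul_sum, Complex.exp_sum]

theorem expC_eq_one_iff (x : ℂ) : expC x = 1 ↔ ∃ m : ℤ, x = m := by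
  rw [expC, Complex.exp_eq_one_iff]
  have h : (2 * Real.pi * Complex.I : ℂ) ≠ 0 := Complex.two_pi_I_ne_zero
  refine exists_congr fun m => ?_
  rw [mul_comm _ x, mul_left_inj' h]

theorem expC_intCast (m : ℤ) : expC m = 1 := (expC_eq_one_iff _).2 ⟨m, rfl⟩

section padic
variable {F : Type*} [Field F] [NumberField F] {p : ℕ} [Fact p.Prime]

/-- The closure of `ℚ` in `F_v` is the image of `ℚ_p`, which is closed because `F_v` is of finite
dimension over `ℚ_p`. -/
theorem ratClosure_eq_fieldRange (v : PlacesAbove F p) :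
    ratClosure v.1 = (padicEmb v.1 v.2).fieldRange := by
  apply le_antisymm
  · refine Subfield.topologicalClosure_minimal _ ?_ ?_
    · rintro _ ⟨q, rfl⟩
      exact ⟨(q : ℚ_[p]), padicEmb_ratCast v.2 q⟩
    · exact (LinearMap.range
        (Algebra.linearMap ℚ_[p] (v.1.adicCompletion F))).closed_of_finiteDimensional
  · rintro _ ⟨x, rfl⟩
    change padicEmb v.1 v.2 x ∈ closure
      (((algebraMap ℚ (v.1.adicCompletion F)).fieldRange : Subfield _) : Set (v.1.adicCompletion F))
    refine map_mem_closure (continuous_padicEmb v.2) (Padic.denseRange_ratCast p x) ?_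
    rintro _ ⟨q, rfl⟩
    exact ⟨q, (padicEmb_ratCast v.2 q).symm⟩

/-- The trace over the closure of `ℚ` in `F_v` is the trace over `ℚ_p`. -/
theorem localTrace_eq (v : PlacesAbove F p) (x : v.1.adicCompletion F) :
    localTrace v.1 x = padicEmb v.1 v.2 (Algebra.trace ℚ_[p] (v.1.adicCompletion F) x) := by
  let e : ratClosure v.1 ≃+* ℚ_[p] :=
    ((RingEquiv.subringCongr (congrArg Subfield.toSubring (ratClosure_eq_fieldRange v))).trans
      (RingEquiv.ofBijective (padicEmb v.1 v.2).rangeRestrict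
        ⟨fun a b h => (padicEmb v.1 v.2).injective (congrArg Subtype.val h),
          (padicEmb v.1 v.2).rangeRestrict_surjective⟩).symm)
  have he : ∀ y : ratClosure v.1, padicEmb v.1 v.2 (e y) = y := by
    intro y
    exact congrArg Subtype.val (RingEquiv.apply_symm_apply (RingEquiv.ofBijective
      (padicEmb v.1 v.2).rangeRestrict
        ⟨fun a b h => (padicEmb v.1 v.2).injective (congrArg Subtype.val h),
          (padicEmb v.1 v.2).rangeRestrict_surjective⟩)
      ((RingEquiv.subringCongr (congrArg Subfield.toSubring (ratClosure_eq_fieldRange v))) y))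
  have h := Algebra.trace_eq_of_equiv_equiv e (RingEquiv.refl (v.1.adicCompletion F))
    (RingHom.ext fun y => he y) x
  rw [localTrace, h, ← he, RingEquiv.apply_symm_apply]
  rfl

/-- `ℚ_p = ℤ[1/p] + ℤ_p`. -/
theorem exists_fractional_part (z : ℚ_[p]) :
    ∃ (m : ℕ) (a : ℤ), ‖z - ((a / (p : ℚ) ^ m : ℚ) : ℚ_[p])‖ ≤ 1 := by
  have hp1 : (1 : ℝ) < p := by exact_mod_cast (Fact.out : p.Prime).one_lt
  have hp0 : (p : ℚ_[p]) ≠ 0 := by exact_mod_cast (Fact.out : p.Prime).ne_zero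
  obtain ⟨m, hm⟩ : ∃ m : ℕ, ‖(p : ℚ_[p]) ^ m * z‖ < 1 := by
    have h2 : Filter.Tendsto (fun k : ℕ => ‖(p : ℚ_[p]) ^ k * z‖) Filter.atTop (nhds 0) := by
      have := (tendsto_pow_atTop_nhds_zero_of_lt_one (by positivity)
        (inv_lt_one_of_one_lt₀ hp1)).mul_const ‖z‖
      simpa using this
    exact (h2.eventually_lt_const one_pos).exists
  obtain ⟨a, ha⟩ := (PadicInt.denseRange_intCast (p := p)).exists_dist_lt
    (⟨(p : ℚ_[p]) ^ m * z, hm.le⟩ : ℤ_[p]) (ε := (p : ℝ)⁻¹ ^ m) (by positivity)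
  have ha' : dist ((p : ℚ_[p]) ^ m * z) ((a : ℤ_[p]) : ℚ_[p]) < (p : ℝ)⁻¹ ^ m := ha
  rw [dist_eq_norm, PadicInt.coe_intCast] at ha'
  refine ⟨m, a, ?_⟩
  have e : (p : ℚ_[p]) ^ m * z - a =
      (p : ℚ_[p]) ^ m * (z - ((a / (p : ℚ) ^ m : ℚ) : ℚ_[p])) := by
    push_cast
    field_simp
  rw [e, norm_mul, norm_pow, Padic.norm_p] at ha'
  have h3 : (0 : ℝ) < (p : ℝ)⁻¹ ^ m := by positivity
  exact ((mul_lt_iff_lt_one_right h3).1 ha').le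

/-- `ℤ[1/p] ∩ ℤ_p = ℤ`. -/
theorem exists_int_of_norm_le_one {q : ℚ} {m : ℕ} {a : ℤ} (hq : q = a / (p : ℚ) ^ m)
    (h : ‖(q : ℚ_[p])‖ ≤ 1) : ∃ k : ℤ, q = k := by
  have hd := not_dvd_den_of_norm_le_one h
  have hp0 : (p : ℚ) ≠ 0 := by exact_mod_cast (Fact.out : p.Prime).ne_zero
  have h1 : q.den ∣ p ^ m := by
    have : q = Rat.divInt a ((p ^ m : ℕ) : ℤ) := by
      rw [hq, Rat.divInt_eq_div]; push_cast; rfl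
    rw [this]
    exact_mod_cast Rat.den_dvd a ((p ^ m : ℕ) : ℤ)
  obtain ⟨j, _, hj⟩ := (Nat.dvd_prime_pow (Fact.out : p.Prime)).1 h1
  rcases Nat.eq_zero_or_pos j with rfl | hj0
  · exact ⟨q.num, (Rat.den_eq_one_iff q).1 (by simpa using hj) |>.symm⟩
  · exact absurd (hj ▸ dvd_pow_self p hj0.ne') hd

theorem ringChar_quotient (v : PlacesAbove F p) : ringChar (𝓞 F ⧸ v.1.asIdeal) = p := by
  have h : ((p : ℕ) : 𝓞 F ⧸ v.1.asIdeal) = 0 := by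
    rw [← map_natCast (Ideal.Quotient.mk v.1.asIdeal)]
    exact Ideal.Quotient.eq_zero_iff_mem.2 v.2
  have : Nontrivial (𝓞 F ⧸ v.1.asIdeal) := Ideal.Quotient.nontrivial_iff.2 v.1.isPrime.ne_top
  rcases (Nat.dvd_prime (Fact.out : p.Prime)).1 (ringChar.dvd h) with h1 | h1
  · exact absurd h1 (CharP.ringChar_ne_one)
  · exact h1

theorem isFractionalPart_iff (v : PlacesAbove F p) (x : v.1.adicCompletion F) (y : ℚ) :
    IsFractionalPart v.1 x y ↔ (∃ (m : ℕ) (a : ℤ), y = a / (p : ℚ) ^ m) ∧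
      ‖Algebra.trace ℚ_[p] (v.1.adicCompletion F) x - (y : ℚ_[p])‖ ≤ 1 := by
  rw [IsFractionalPart, ringChar_quotient v, localTrace_eq, ← padicEmb_ratCast v.2, ← map_sub,
    HeightOneSpectrum.mem_adicCompletionIntegers, valued_padicEmb_le_one_iff]

theorem exists_isFractionalPart (v : PlacesAbove F p) (x : v.1.adicCompletion F) :
    ∃ y, IsFractionalPart v.1 x y := by
  obtain ⟨m, a, h⟩ := exists_fractional_part (Algebra.trace ℚ_[p] (v.1.adicCompletion F) x)
  exact ⟨_, (isFractionalPart_iff v x _).2 ⟨⟨m, a, rfl⟩, h⟩⟩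

/-- Fractional parts are unique up to integers. -/
theorem IsFractionalPart.sub_int (v : PlacesAbove F p) {x : v.1.adicCompletion F} {y y' : ℚ}
    (h : IsFractionalPart v.1 x y) (h' : IsFractionalPart v.1 x y') : ∃ k : ℤ, y - y' = k := by
  obtain ⟨⟨m, a, hm⟩, hy⟩ := (isFractionalPart_iff v x _).1 h
  obtain ⟨⟨m', a', hm'⟩, hy'⟩ := (isFractionalPart_iff v x _).1 h'
  have hp0 : (p : ℚ) ≠ 0 := by exact_mod_cast (Fact.out : p.Prime).ne_zero
  refine exists_int_of_norm_le_one (p := p) (m := m + m') (a := a * p ^ m' - a' * p ^ m) ?_ ?_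
  · rw [hm, hm']; push_cast; rw [pow_add]; field_simp
  · have e : ((y - y' : ℚ) : ℚ_[p]) = (Algebra.trace ℚ_[p] (v.1.adicCompletion F) x - y') -
      (Algebra.trace ℚ_[p] (v.1.adicCompletion F) x - y) := by push_cast; ring
    rw [e, sub_eq_add_neg]
    exact (IsUltrametricDist.norm_add_le_max _ _).trans (max_le hy' (by rwa [norm_neg]))

/-- `Ψ_v(x)` may be computed from any fractional part of the trace of `x`. -/
theorem psiLocal_eq (v : PlacesAbove F p) {x : v.1.adicCompletion F} {y : ℚ}
    (h : IsFractionalPart v.1 x y) : psiLocal v.1 x = expC (-(y : ℂ)) := by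
  have h1 : IsFractionalPart v.1 x (Classical.epsilon (IsFractionalPart v.1 x)) :=
    Classical.epsilon_spec ⟨y, h⟩
  obtain ⟨k, hk⟩ := h.sub_int v h1
  rw [psiLocal]
  have : -((Classical.epsilon (IsFractionalPart v.1 x) : ℚ) : ℂ) = -(y : ℂ) + k := by
    have : ((y - Classical.epsilon (IsFractionalPart v.1 x) : ℚ) : ℂ) = k := by
      rw [hk]; push_cast; rfl
    push_cast at this
    linear_combination this
  rw [this, expC_add, expC_intCast, mul_one]

theorem psiLocal_eq_one_iff_trace (v : PlacesAbove F p) (x : v.1.adicCompletion F) :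
    psiLocal v.1 x = 1 ↔ ‖Algebra.trace ℚ_[p] (v.1.adicCompletion F) x‖ ≤ 1 := by
  obtain ⟨y, hy⟩ := exists_isFractionalPart v x
  rw [psiLocal_eq v hy, expC_neg, inv_eq_one, expC_eq_one_iff]
  constructor
  · rintro ⟨k, hk⟩
    have hk' : y = k := by exact_mod_cast hk
    obtain ⟨_, h⟩ := (isFractionalPart_iff v x _).1 hy
    rw [hk', Rat.cast_intCast] at h
    rw [← sub_add_cancel (Algebra.trace ℚ_[p] (v.1.adicCompletion F) x) (k : ℚ_[p])]
    exact (IsUltrametricDist.norm_add_le_max _ _).trans (max_le h (Padic.norm_int_le_one k))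
  · intro h
    have h0 : IsFractionalPart v.1 x 0 :=
      (isFractionalPart_iff v x 0).2 ⟨⟨0, 0, by simp⟩, by simpa using h⟩
    obtain ⟨k, hk⟩ := hy.sub_int v h0
    exact ⟨k, by rw [sub_zero] at hk; rw [hk]; push_cast; rfl⟩

theorem psiLocal_add_above (v : PlacesAbove F p) (x y : v.1.adicCompletion F) :
    psiLocal v.1 (x + y) = psiLocal v.1 x * psiLocal v.1 y := by
  obtain ⟨a, ha⟩ := exists_isFractionalPart v x
  obtain ⟨b, hb⟩ := exists_isFractionalPart v y
  have hab : IsFractionalPart v.1 (x + y) (a + b) := by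
    obtain ⟨⟨m, s, hm⟩, h⟩ := (isFractionalPart_iff v x _).1 ha
    obtain ⟨⟨m', s', hm'⟩, h'⟩ := (isFractionalPart_iff v y _).1 hb
    have hp0 : (p : ℚ) ≠ 0 := by exact_mod_cast (Fact.out : p.Prime).ne_zero
    refine (isFractionalPart_iff v _ _).2 ⟨⟨m + m', s * p ^ m' + s' * p ^ m, ?_⟩, ?_⟩
    · rw [hm, hm']; push_cast; rw [pow_add]; field_simp
    · rw [map_add, Rat.cast_add, add_sub_add_comm]
      exact (IsUltrametricDist.norm_add_le_max _ _).trans (max_le h h')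
  rw [psiLocal_eq v ha, psiLocal_eq v hb, psiLocal_eq v hab, ← expC_add]
  push_cast
  ring_nf

end padic

section
variable {F : Type*} [Field F] [NumberField F]

/-- Every finite place lies above a rational prime. -/
theorem exists_prime_mem (v : HeightOneSpectrum (𝓞 F)) :
    ∃ p : ℕ, p.Prime ∧ (p : 𝓞 F) ∈ v.asIdeal := by
  have hfin : Finite (𝓞 F ⧸ v.asIdeal) := v.asIdeal.finiteQuotientOfFreeOfNeBot v.ne_bot
  have := v.isPrime
  have : IsDomain (𝓞 F ⧸ v.asIdeal) := Ideal.Quotient.isDomain _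
  refine ⟨ringChar (𝓞 F ⧸ v.asIdeal), ?_, ?_⟩
  · rcases CharP.char_is_prime_or_zero (𝓞 F ⧸ v.asIdeal) (ringChar (𝓞 F ⧸ v.asIdeal)) with h | h
    · exact h
    · exact absurd h (CharP.char_ne_zero_of_finite (𝓞 F ⧸ v.asIdeal) _)
  · rw [← Ideal.Quotient.eq_zero_iff_mem, map_natCast]
    exact ringChar.Nat.cast_ringChar

theorem psiLocal_add (v : HeightOneSpectrum (𝓞 F)) (x y : v.adicCompletion F) :
    psiLocal v (x + y) = psiLocal v x * psiLocal v y := by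
  obtain ⟨p, hp, hv⟩ := exists_prime_mem v
  have := Fact.mk hp
  exact psiLocal_add_above (p := p) ⟨v, hv⟩ x y

theorem psiLocal_zero (v : HeightOneSpectrum (𝓞 F)) : psiLocal v (0 : v.adicCompletion F) = 1 := by
  have h := psiLocal_add v 0 0
  rw [add_zero] at h
  exact mul_left_cancel₀ (a := psiLocal v (0 : v.adicCompletion F)) (expC_ne_zero _)
    (by rw [← h, mul_one])

/-- The inverse different as a fractional ideal. -/
abbrev invDifferent (F : Type*) [Field F] [NumberField F] : FractionalIdeal (𝓞 F)⁰ F :=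
  (differentIdeal ℤ (𝓞 F) : FractionalIdeal (𝓞 F)⁰ F)⁻¹

theorem mem_invDifferent {x : F} :
    x ∈ invDifferent F ↔ ∀ a : 𝓞 F, ∃ m : ℤ, Algebra.trace ℚ F (x * a) = m := by
  rw [invDifferent, coeIdeal_differentIdeal ℤ ℚ F (𝓞 F), inv_inv,
    FractionalIdeal.mem_dual (one_ne_zero (α := FractionalIdeal (𝓞 F)⁰ F))]
  constructor
  · intro h a
    obtain ⟨m, hm⟩ := h a ((FractionalIdeal.mem_one_iff _).2 ⟨a, rfl⟩)
    exact ⟨m, by rw [← Algebra.traceForm_apply, ← hm]; simp⟩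
  · rintro h _ ha
    obtain ⟨a, rfl⟩ := (FractionalIdeal.mem_one_iff _).1 ha
    obtain ⟨m, hm⟩ := h a
    exact ⟨m, by rw [Algebra.traceForm_apply, hm]; simp⟩

open Classical in
/-- The trace of `F_v` computed inside `F ⊗ ℚ_p`. -/
theorem trace_single {p : ℕ} [Fact p.Prime] (v : PlacesAbove F p) (x : v.1.adicCompletion F)
    (Y : CompletionAbove F p) : Algebra.trace ℚ_[p] (CompletionAbove F p) (Pi.single v x * Y) =
      Algebra.trace ℚ_[p] (v.1.adicCompletion F) (x * Y v) := by
  rw [trace_pi, Finset.sum_eq_single v]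
  · simp
  · intro w _ hw
    simp [Pi.single_eq_of_ne hw]
  · simp

/-- `Ψ_v` is trivial on `𝔡_v⁻¹`: an element of `𝔬_v` has coefficients in `ℤ_p` with respect to an
integral basis of `F`, and the trace of `F` is integral on the products of the basis elements with
elements of `𝔡⁻¹`. -/
theorem psiLocal_eq_one_of_mem (v : HeightOneSpectrum (𝓞 F)) {x : v.adicCompletion F}
    (hx : x ∈ locIdeal v (invDifferent F)) : psiLocal v x = 1 := by
  classical
  obtain ⟨p, hp, hv⟩ := exists_prime_mem v
  have := Fact.mk hp
  refine Submodule.closure_induction (p := fun x _ => psiLocal v x = 1) (psiLocal_zero v)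
    (fun x y _ _ h1 h2 => by rw [psiLocal_add, h1, h2, one_mul]) ?_ hx
  rintro a _ ⟨y, hy, rfl⟩
  have e : a • algebraMap F (v.adicCompletion F) y =
    (a : v.adicCompletion F) * algebraMap F (v.adicCompletion F) y := rfl
  beta_reduce
  rw [e, psiLocal_eq_one_iff_trace (p := p) ⟨v, hv⟩]
  let w : PlacesAbove F p := ⟨v, hv⟩
  have h1 := trace_single w (a : v.adicCompletion F) (algebraMap F (CompletionAbove F p) y)
  rw [show (algebraMap F (CompletionAbove F p) y) w = algebraMap F (v.adicCompletion F) y from rfl]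
    at h1
  rw [← h1]
  set X : CompletionAbove F p := Pi.single w (a : v.adicCompletion F) with hX
  have hc := norm_coeff_le_one (fun i => (padicBasis F p).repr X i) (by
    intro u
    have h2 : ∑ i, padicEmb u.1 u.2 ((padicBasis F p).repr X i) *
        algebraMap F (u.1.adicCompletion F) (integralBasis F i) = X u := by
      conv_rhs => rw [← (padicBasis F p).sum_repr X, Finset.sum_apply]
      refine Finset.sum_congr rfl fun i _ => ?_
      rw [padicBasis_apply]; rfl
    rw [h2]
    by_cases huw : u = w
    · subst huw
      rw [hX, Pi.single_eq_same]; exact a.2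
    · rw [hX, Pi.single_eq_of_ne huw, map_zero]; exact zero_le)
  rw [← (padicBasis F p).sum_repr X, Finset.sum_mul, map_sum]
  refine IsUltrametricDist.norm_sum_le_of_forall_le_of_nonneg zero_le_one fun i _ => ?_
  rw [smul_mul_assoc, map_smul, smul_eq_mul, norm_mul, padicBasis_apply, ← map_mul,
    trace_algebraMap_padic]
  obtain ⟨m, hm⟩ := mem_invDifferent.1 hy (RingOfIntegers.basis F i)
  rw [integralBasis_apply, mul_comm (algebraMap (𝓞 F) F _), hm, Rat.cast_intCast]
  exact mul_le_one₀ (hc i) (norm_nonneg _) (Padic.norm_int_le_one m)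

/-- `𝔡_v⁻¹` contains the dual of `𝔬_v` under `Ψ_v`, as one sees by expanding an element of `F ⊗ ℚ_p`
in the trace dual of an integral basis. -/
theorem mem_locIdeal_invDifferent (v : HeightOneSpectrum (𝓞 F)) {x : v.adicCompletion F}
    (hx : ∀ z : 𝓞 F, psiLocal v (x * algebraMap F (v.adicCompletion F) z) = 1) :
    x ∈ locIdeal v (invDifferent F) := by
  classical
  obtain ⟨p, hp, hv⟩ := exists_prime_mem v
  have := Fact.mk hp
  let w : PlacesAbove F p := ⟨v, hv⟩
  set β := (integralBasis F).traceDual with hβ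
  have hβmem : ∀ i, β i ∈ invDifferent F := by
    intro i
    rw [mem_invDifferent]
    intro a
    refine ⟨(RingOfIntegers.basis F).repr a i, ?_⟩
    conv_lhs => rw [← (RingOfIntegers.basis F).sum_repr a]
    rw [show ((∑ j, (RingOfIntegers.basis F).repr a j • RingOfIntegers.basis F j : 𝓞 F) : F) =
      ∑ j, algebraMap (𝓞 F) F ((RingOfIntegers.basis F).repr a j • RingOfIntegers.basis F j)
      from map_sum (algebraMap (𝓞 F) F) _ _, Finset.mul_sum, map_sum]
    have h1 : ∀ j, Algebra.trace ℚ F (β i * algebraMap (𝓞 F) F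
        ((RingOfIntegers.basis F).repr a j • RingOfIntegers.basis F j)) =
        if j = i then ((RingOfIntegers.basis F).repr a j : ℚ) else 0 := by
      intro j
      rw [map_zsmul, ← integralBasis_apply, mul_smul_comm, map_zsmul, hβ,
        Module.Basis.trace_traceDual_mul]
      simp [zsmul_eq_mul]
    simp only [h1, Finset.sum_ite_eq', Finset.mem_univ, if_true]
  -- the expansion in the dual basis extends from `F` to `F ⊗ ℚ_p` by linearity
  have key : ∀ X : CompletionAbove F p, X = ∑ i, Algebra.trace ℚ_[p] (CompletionAbove F p)
      (X * algebraMap F (CompletionAbove F p) (integralBasis F i)) •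
        algebraMap F (CompletionAbove F p) (β i) := by
    have hlin : LinearMap.id = ∑ i, ((Algebra.trace ℚ_[p] (CompletionAbove F p)).comp
        (LinearMap.mulRight ℚ_[p] (algebraMap F (CompletionAbove F p) (integralBasis F i)))).smulRight
          (algebraMap F (CompletionAbove F p) (β i)) := by
      refine (padicBasis F p).ext fun k => ?_
      simp only [LinearMap.id_apply, LinearMap.sum_apply, LinearMap.smulRight_apply,
        LinearMap.comp_apply, LinearMap.mulRight_apply, padicBasis_apply, ← map_mul,
        trace_algebraMap_padic, ← algebraMap_smul_padic, ← map_sum]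
      congr 1
      conv_lhs => rw [← β.sum_repr (integralBasis F k)]
      refine Finset.sum_congr rfl fun i _ => ?_
      rw [hβ, Module.Basis.traceDual_repr_apply, Algebra.traceForm_apply]
    intro X
    have := LinearMap.congr_fun hlin X
    simpa only [LinearMap.id_apply, LinearMap.sum_apply, LinearMap.smulRight_apply,
        LinearMap.comp_apply, LinearMap.mulRight_apply] using this
  have h := congrFun (key (Pi.single w x)) w
  rw [Pi.single_eq_same, Finset.sum_apply] at h
  rw [h]
  refine sum_mem fun i _ => ?_
  rw [trace_single]
  have h1 := (psiLocal_eq_one_iff_trace w _).1 (hx (RingOfIntegers.basis F i))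
  rw [show ((RingOfIntegers.basis F i : 𝓞 F) : F) = integralBasis F i from
    (integralBasis_apply F i).symm] at h1
  exact (locIdeal v (invDifferent F)).smul_mem
    (⟨padicEmb w.1 w.2 _, (valued_padicEmb_le_one_iff w.2 _).2 h1⟩ : v.adicCompletionIntegers F)
    (Submodule.subset_span ⟨β i, hβmem i, rfl⟩)

/-- `𝔟_v𝔡_v⁻¹` contains the dual of `𝔟_v⁻¹` under `Ψ_v`. -/
theorem mem_locIdeal_of_psiLocal {b : FractionalIdeal (𝓞 F)⁰ F} (hb : b ≠ 0)
    (v : HeightOneSpectrum (𝓞 F)) {x : v.adicCompletion F}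
    (hx : ∀ z ∈ locIdeal v b⁻¹, psiLocal v (x * z) = 1) :
    x ∈ locIdeal v (b * invDifferent F) := by
  have h1 : ∀ β ∈ b⁻¹, x * algebraMap F (v.adicCompletion F) β ∈ locIdeal v (invDifferent F) := by
    intro β hβ
    refine mem_locIdeal_invDifferent v fun z => ?_
    rw [mul_assoc, ← map_mul]
    refine hx _ (Submodule.subset_span ⟨_, ?_, rfl⟩)
    have := Submodule.smul_mem (b⁻¹ : FractionalIdeal (𝓞 F)⁰ F).coeToSubmodule z hβ
    rwa [Algebra.smul_def, mul_comm] at this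
  have h2 : ∀ c ∈ b⁻¹ * b, x * algebraMap F (v.adicCompletion F) c ∈
      locIdeal v (b * invDifferent F) := by
    intro c hc
    refine FractionalIdeal.mul_induction_on hc ?_ ?_
    · intro i hi j hj
      rw [map_mul, ← mul_assoc, mul_comm b]
      exact locIdeal_mul v (h1 i hi) (Submodule.subset_span ⟨j, hj, rfl⟩)
    · intro i j hi hj
      rw [map_add, mul_add]
      exact add_mem hi hj
  have h3 := h2 1 (by rw [inv_mul_cancel₀ hb]; exact FractionalIdeal.one_mem_one _)
  rwa [map_one, mul_one] at h3

end

/-! ### The global character `Ψ` -/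

section
variable {F : Type*} [Field F] [NumberField F]

theorem one_le_invDifferent : (1 : FractionalIdeal (𝓞 F)⁰ F) ≤ invDifferent F := by
  intro x hx
  obtain ⟨y, rfl⟩ := (FractionalIdeal.mem_one_iff _).1 hx
  refine mem_invDifferent.2 fun a => ?_
  refine ⟨Algebra.trace ℤ (𝓞 F) (y * a), ?_⟩
  have := Algebra.trace_localization ℤ (nonZeroDivisors ℤ) (Rₘ := ℚ) (Sₘ := F) (y * a)
  rw [show algebraMap (𝓞 F) F y * (a : F) = algebraMap (𝓞 F) F (y * a) from (map_mul _ _ _).symm,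
    this]
  simp

theorem psiLocal_eq_one_of_integral (v : HeightOneSpectrum (𝓞 F)) {x : v.adicCompletion F}
    (hx : x ∈ v.adicCompletionIntegers F) : psiLocal v x = 1 :=
  psiLocal_eq_one_of_mem v (locIdeal_mono v one_le_invDifferent ((mem_locIdeal_one v x).2 hx))

theorem finite_mulSupport_psiLocal (x : FiniteAdeleRing (𝓞 F) F) :
    (Function.mulSupport fun v => psiLocal v (x v)).Finite := by
  have hfin : {v | ¬ x v ∈ v.adicCompletionIntegers F}.Finite := x.2
  exact hfin.subset fun v hv h => hv (psiLocal_eq_one_of_integral v h)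

theorem psiFin_add (x y : FiniteAdeleRing (𝓞 F) F) : psiFin (x + y) = psiFin x * psiFin y := by
  rw [psiFin, psiFin, psiFin, ← finprod_mul_distrib (finite_mulSupport_psiLocal x)
    (finite_mulSupport_psiLocal y)]
  exact finprod_congr fun v => psiLocal_add v _ _

theorem psiFin_eq_one {x : FiniteAdeleRing (𝓞 F) F} (h : ∀ v, psiLocal v (x v) = 1) :
    psiFin x = 1 := by
  rw [psiFin, finprod_congr h, finprod_one]

theorem psiFin_zero : psiFin (0 : FiniteAdeleRing (𝓞 F) F) = 1 :=
  psiFin_eq_one fun v => psiLocal_zero v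

theorem expArch_add (x y : InfinitePlace F → ℂ) : expArch (x + y) = expArch x * expArch y := by
  simp only [expArch, Pi.add_apply, expC_add, Finset.prod_mul_distrib]

theorem expArch_zero : expArch (0 : InfinitePlace F → ℂ) = 1 := by
  simp [expArch, expC_zero]

theorem norm_expArch_ofReal (x : InfinitePlace F → ℝ) : ‖expArch fun v => (x v : ℂ)‖ = 1 := by
  rw [expArch, norm_prod]
  refine Finset.prod_eq_one fun v _ => ?_
  rw [expC, Complex.norm_exp]
  simp

variable [IsTotallyReal F]

theorem psi_add (x y : AdeleRing (𝓞 F) F) : psi (x + y) = psi x * psi y := by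
  rw [psi, psi, psi, map_add, map_add, psiFin_add, mul_mul_mul_comm, ← expArch_add]
  congr 2
  funext v
  simp

theorem psi_zero : psi (0 : AdeleRing (𝓞 F) F) = 1 := by
  rw [psi, map_zero, map_zero, psiFin_zero, mul_one]
  simp [expArch, expC_zero]

theorem psi_neg (x : AdeleRing (𝓞 F) F) : psi (-x) = (psi x)⁻¹ := by
  refine eq_inv_of_mul_eq_one_left ?_
  rw [← psi_add, neg_add_cancel, psi_zero]

theorem psi_ne_zero (x : AdeleRing (𝓞 F) F) : psi x ≠ 0 := by
  intro h
  have := psi_add x (-x)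
  rw [add_neg_cancel, psi_zero, h, zero_mul] at this
  exact one_ne_zero this

theorem realAt_algebraMap (v : InfinitePlace F) (x : F) :
    realAt v (toArch F (algebraMap F (AdeleRing (𝓞 F) F) x)) = realEmb v x :=
  InfinitePlace.Completion.extensionEmbeddingOfIsReal_coe _ _

/-- The trace to `ℚ` is the sum over the real places. -/
theorem trace_eq_sum_realEmb (x : F) :
    ((Algebra.trace ℚ F x : ℚ) : ℂ) = ∑ v : InfinitePlace F, ((realEmb v x : ℝ) : ℂ) := by
  have h := trace_eq_sum_embeddings (K := ℚ) (L := F) ℂ (x := x)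
  rw [eq_ratCast] at h
  rw [h]
  symm
  refine Fintype.sum_equiv (⟨fun v => RingHom.equivRatAlgHom F ℂ v.embedding,
    fun φ => InfinitePlace.mk (φ : F →+* ℂ), fun v => InfinitePlace.mk_embedding v, fun φ => ?_⟩ :
      InfinitePlace F ≃ (F →ₐ[ℚ] ℂ)) _ _ fun v => ?_
  · ext x
    exact congrArg (fun f : F →+* ℂ => f x)
      (InfinitePlace.embedding_mk_eq_of_isReal (IsTotallyReal.complexEmbedding_isReal _))
  · exact InfinitePlace.embedding_of_isReal_apply _ _

theorem norm_padic_fraction_le_one {p q : ℕ} [Fact p.Prime] (hq : q.Prime) (hpq : p ≠ q) (m : ℕ)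
    (a : ℤ) : ‖((a / (q : ℚ) ^ m : ℚ) : ℚ_[p])‖ ≤ 1 := by
  push_cast
  have h : ‖(q : ℚ_[p])‖ = 1 := by
    rw [Padic.norm_natCast_eq_one_iff]
    exact (Nat.coprime_primes Fact.out hq).2 hpq
  rw [norm_div, norm_pow, h, one_pow, div_one]
  exact Padic.norm_int_le_one a

/-- `Ψ` is trivial on `F`: the trace of `x` minus the fractional parts of its local traces is a
rational number which is a `p`-adic integer for all `p`. -/
theorem psi_algebraMap (x : F) : psi (algebraMap F (AdeleRing (𝓞 F) F) x) = 1 := by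
  classical
  -- fractional parts `y v`, chosen to be `0` wherever `Ψ_v(x) = 1`, so that almost all of them vanish
  have hy : ∀ v : HeightOneSpectrum (𝓞 F), ∃ y : ℚ, psiLocal v (algebraMap F _ x) = expC (-y) ∧
      (psiLocal v (algebraMap F _ x) = 1 → y = 0) ∧
      ∀ p : ℕ, ∀ [Fact p.Prime], ∀ hv : (p : 𝓞 F) ∈ v.asIdeal,
        IsFractionalPart (⟨v, hv⟩ : PlacesAbove F p).1 (algebraMap F _ x) y := by
    intro v
    obtain ⟨p, hp, hv⟩ := exists_prime_mem v
    have := Fact.mk hp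
    let w : PlacesAbove F p := ⟨v, hv⟩
    by_cases h : psiLocal w.1 (algebraMap F _ x) = 1
    · refine ⟨0, by rw [show psiLocal v _ = 1 from h]; simp [expC_zero], fun _ => rfl, fun q _ hq => ?_⟩
      exact (isFractionalPart_iff w _ _).2 ⟨⟨0, 0, by simp⟩, by
        simpa using (psiLocal_eq_one_iff_trace w _).1 h⟩
    · obtain ⟨y, hy⟩ := exists_isFractionalPart w (algebraMap F _ x)
      exact ⟨y, psiLocal_eq w hy, fun h' => absurd h' h, fun q _ hq => hy⟩
  choose y hy1 hy2 hy3 using hy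
  have hfin := finite_mulSupport_psiLocal (algebraMap F (FiniteAdeleRing (𝓞 F) F) x)
  set T := hfin.toFinset with hT
  have hy0 : ∀ v ∉ T, y v = 0 := by
    intro v hv
    apply hy2
    by_contra h
    exact hv (hfin.mem_toFinset.2 h)
  have hpsi : psiFin (toFin F (algebraMap F (AdeleRing (𝓞 F) F) x)) =
      expC (-((∑ v ∈ T, y v : ℚ) : ℂ)) := by
    have h1 : psiFin (toFin F (algebraMap F (AdeleRing (𝓞 F) F) x)) =
        ∏ v ∈ T, psiLocal v (algebraMap F _ x) :=
      finprod_eq_prod_of_mulSupport_subset _ (by rw [hT, hfin.coe_toFinset]; exact subset_rfl)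
    rw [h1, Finset.prod_congr rfl fun v _ => hy1 v, ← expC_sum]
    push_cast
    rw [Finset.sum_neg_distrib]
  have harch : expArch (fun v => (realAt v (toArch F (algebraMap F (AdeleRing (𝓞 F) F) x)) : ℂ)) =
      expC ((Algebra.trace ℚ F x : ℚ) : ℂ) := by
    simp only [realAt_algebraMap]
    rw [trace_eq_sum_realEmb, expC_sum]
    rfl
  rw [psi, harch, hpsi, ← expC_add, expC_eq_one_iff]
  set r : ℚ := Algebra.trace ℚ F x - ∑ v ∈ T, y v with hr
  -- `r` is a `p`-adic integer for all primes `p`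
  have hint : ∀ p : ℕ, ∀ [Fact p.Prime], ‖(r : ℚ_[p])‖ ≤ 1 := by
    intro p _
    set U : Finset (HeightOneSpectrum (𝓞 F)) :=
      T ∪ Finset.univ.map (Function.Embedding.subtype fun v : HeightOneSpectrum (𝓞 F) =>
        (p : 𝓞 F) ∈ v.asIdeal) with hU
    have h1 : ∑ v ∈ T, y v = ∑ v ∈ U, y v :=
      Finset.sum_subset Finset.subset_union_left fun v _ hv => hy0 v hv
    have h2 : ∑ v ∈ U with (p : 𝓞 F) ∈ v.asIdeal, y v = ∑ v : PlacesAbove F p, y v.1 := by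
      refine Finset.sum_subtype _ (fun v => ?_) _
      simp only [Finset.mem_filter, hU, Finset.mem_union, Finset.mem_map, Finset.mem_univ, true_and]
      exact ⟨fun h => h.2, fun h => ⟨Or.inr ⟨⟨v, h⟩, rfl⟩, h⟩⟩
    have h3 : (r : ℚ_[p]) = (∑ v : PlacesAbove F p, (Algebra.trace ℚ_[p] (v.1.adicCompletion F)
        (algebraMap F (v.1.adicCompletion F) x) - y v.1)) +
        ∑ v ∈ U with ¬ (p : 𝓞 F) ∈ v.asIdeal, -(y v : ℚ_[p]) := by
      rw [hr, h1, ← Finset.sum_filter_add_sum_filter_not U (fun v => (p : 𝓞 F) ∈ v.asIdeal), h2]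
      push_cast
      rw [trace_eq_sum_local, Finset.sum_sub_distrib, Finset.sum_neg_distrib]
      ring
    rw [h3]
    refine (IsUltrametricDist.norm_add_le_max _ _).trans (max_le ?_ ?_)
    · exact IsUltrametricDist.norm_sum_le_of_forall_le_of_nonneg zero_le_one fun v _ =>
        ((isFractionalPart_iff v _ _).1 (hy3 v.1 p v.2)).2
    · refine IsUltrametricDist.norm_sum_le_of_forall_le_of_nonneg zero_le_one fun v hv => ?_
      obtain ⟨q, hq, hqv⟩ := exists_prime_mem v
      have := Fact.mk hq
      obtain ⟨⟨m, a, hm⟩, -⟩ := (isFractionalPart_iff (p := q) ⟨v, hqv⟩ _ _).1 (hy3 v q hqv)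
      rw [norm_neg, hm]
      refine norm_padic_fraction_le_one hq ?_ m a
      rintro rfl
      exact (Finset.mem_filter.1 hv).2 hqv
  have hden : r.den = 1 := by
    by_contra h
    obtain ⟨p, hp, hpd⟩ := Nat.exists_prime_and_dvd h
    have := Fact.mk hp
    exact not_dvd_den_of_norm_le_one (hint p) hpd
  refine ⟨r.num, ?_⟩
  have h4 : ((r : ℚ) : ℂ) = r.num := by
    conv_lhs => rw [← (Rat.den_eq_one_iff r).1 hden]
    push_cast; rfl
  rw [← h4, hr]
  push_cast
  ring

end

/-! ### Uniqueness of Fourier coefficients -/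

section uniqueness

theorem norm_average_le {z : ℂ} (hz : ‖z‖ = 1) (N : ℕ) :
    ‖(N : ℂ)⁻¹ * ∑ k ∈ Finset.range N, z ^ k‖ ≤ 1 := by
  rw [norm_mul, norm_inv, Complex.norm_natCast]
  have h : ‖∑ k ∈ Finset.range N, z ^ k‖ ≤ N := by
    refine (norm_sum_le _ _).trans ?_
    simp [norm_pow, hz]
  calc (N : ℝ)⁻¹ * ‖∑ k ∈ Finset.range N, z ^ k‖ ≤ (N : ℝ)⁻¹ * N := by gcongr
    _ ≤ 1 := inv_mul_le_one

theorem tendsto_average {z : ℂ} (hz : ‖z‖ = 1) [Decidable (z = 1)] :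
    Filter.Tendsto (fun N : ℕ => (N : ℂ)⁻¹ * ∑ k ∈ Finset.range N, z ^ k) Filter.atTop
      (nhds (if z = 1 then 1 else 0)) := by
  split_ifs with h
  · refine tendsto_const_nhds.congr' ?_
    filter_upwards [Filter.eventually_gt_atTop 0] with N hN
    have : (N : ℂ) ≠ 0 := by exact_mod_cast hN.ne'
    simp [h, this]
  · have h1 : Filter.Tendsto (fun N : ℕ => (N : ℝ)⁻¹ * (2 / ‖z - 1‖)) Filter.atTop (nhds 0) := by
      have := (tendsto_inv_atTop_nhds_zero_nat (𝕜 := ℝ)).mul_const (2 / ‖z - 1‖)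
      simpa using this
    refine squeeze_zero_norm (fun N => ?_) h1
    rw [geom_sum_eq h, norm_mul, norm_inv, Complex.norm_natCast, norm_div]
    have h2 : ‖z ^ N - 1‖ ≤ 2 := by
      refine (norm_sub_le _ _).trans ?_
      rw [norm_pow, hz, one_pow, norm_one]
      norm_num
    gcongr

variable {V P : Type*} [AddCommGroup V]

/-- Averaging along the multiples of `x₀` singles out the characters which are trivial at `x₀`. -/
theorem hasSum_ite_of_hasSum_zero {a : P → ℂ} {ψ : P → V → ℂ} (ha : Summable a)
    (hadd : ∀ p x y, ψ p (x + y) = ψ p x * ψ p y) (hnorm : ∀ p x, ‖ψ p x‖ = 1)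
    (h : ∀ x, HasSum (fun p => a p * ψ p x) 0) (x₀ : V) [∀ p, Decidable (ψ p x₀ = 1)] (x : V) :
    HasSum (fun p => (if ψ p x₀ = 1 then a p else 0) * ψ p x) 0 := by
  have hsm : ∀ p (k : ℕ), ψ p (x + k • x₀) = ψ p x * ψ p x₀ ^ k := by
    intro p k
    induction k with
    | zero => simp
    | succ k ih => rw [succ_nsmul, ← add_assoc, hadd, ih, pow_succ, mul_assoc]
  have hN : ∀ N : ℕ, HasSum (fun p => a p * ψ p x *
      ((N : ℂ)⁻¹ * ∑ k ∈ Finset.range N, ψ p x₀ ^ k)) 0 := by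
    intro N
    have h1 := (hasSum_sum fun k (_ : k ∈ Finset.range N) => h (x + k • x₀)).mul_left (N : ℂ)⁻¹
    simp only [Finset.sum_const_zero, mul_zero] at h1
    refine h1.congr_fun fun p => ?_
    simp only [hsm, Finset.mul_sum]
    refine Finset.sum_congr rfl fun k _ => by ring
  have hlim := tendsto_tsum_of_dominated_convergence (𝓕 := Filter.atTop)
    (f := fun (N : ℕ) p => a p * ψ p x * ((N : ℂ)⁻¹ * ∑ k ∈ Finset.range N, ψ p x₀ ^ k))
    (g := fun p => a p * ψ p x * (if ψ p x₀ = 1 then 1 else 0)) (bound := fun p => ‖a p‖)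
    ha.norm (fun p => (tendsto_average (hnorm p x₀)).const_mul _)
    (Filter.Eventually.of_forall fun N p => by
      rw [norm_mul, norm_mul, hnorm, mul_one]
      exact mul_le_of_le_one_right (norm_nonneg _) (norm_average_le (hnorm p x₀) N))
  simp only [(hN _).tsum_eq] at hlim
  have h0 := tendsto_nhds_unique hlim tendsto_const_nhds
  have hs : Summable fun p => (if ψ p x₀ = 1 then a p else 0) * ψ p x := by
    refine Summable.of_norm_bounded ha.norm fun p => ?_
    rw [norm_mul, hnorm, mul_one]
    split_ifs
    · exact le_rfl
    · simp
  have e : (fun p => a p * ψ p x * (if ψ p x₀ = 1 then 1 else 0)) =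
      fun p => (if ψ p x₀ = 1 then a p else 0) * ψ p x := by
    funext p; split_ifs <;> simp
  rw [e] at h0
  have := hs.hasSum
  rwa [h0] at this

/-- An absolutely convergent series of pairwise distinct unitary characters of an abelian group
vanishes identically only if all its coefficients are zero. -/
theorem eq_zero_of_hasSum_characters {a : P → ℂ} {χ : P → V → ℂ} (ha : Summable a)
    (hadd : ∀ p x y, χ p (x + y) = χ p x * χ p y) (hnorm : ∀ p x, ‖χ p x‖ = 1)
    (hinj : ∀ p q, a p ≠ 0 → a q ≠ 0 → p ≠ q → ∃ x, χ p x ≠ χ q x)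
    (h : ∀ x, HasSum (fun p => a p * χ p x) 0) (q : P) : a q = 0 := by
  classical
  by_contra hq
  have hne : ∀ p x, χ p x ≠ 0 := fun p x h0 => by simpa [h0] using hnorm p x
  -- dividing by `χ q` makes the character with index `q` trivial; imposing triviality at more and
  -- more points `y ∈ T` then leaves only the term with index `q`
  let ψ : P → V → ℂ := fun p x => χ p x / χ q x
  have ψadd : ∀ p x y, ψ p (x + y) = ψ p x * ψ p y := by
    intro p x y
    simp only [ψ, hadd, mul_div_mul_comm]
  have ψnorm : ∀ p x, ‖ψ p x‖ = 1 := by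
    intro p x
    simp only [ψ, norm_div, hnorm, div_one]
  have hψ : ∀ x, HasSum (fun p => a p * ψ p x) 0 := by
    intro x
    have := (h x).div_const (χ q x)
    rw [zero_div] at this
    exact this.congr_fun fun p => by simp only [ψ]; ring
  have hT : ∀ T : Finset V, ∀ x, HasSum (fun p => (if ∀ y ∈ T, ψ p y = 1 then a p else 0) * ψ p x) 0 := by
    intro T
    induction T using Finset.induction_on with
    | empty => simpa using hψ
    | insert y T hy ih =>
      intro x
      have hs : Summable fun p => if ∀ y ∈ T, ψ p y = 1 then a p else 0 := by
        refine Summable.of_norm_bounded ha.norm fun p => ?_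
        split_ifs
        · exact le_rfl
        · simp
      refine (hasSum_ite_of_hasSum_zero hs ψadd ψnorm ih y x).congr_fun fun p => ?_
      congr 1
      by_cases h1 : ψ p y = 1 <;> simp [h1]
  have hlim := tendsto_tsum_of_dominated_convergence (𝓕 := (Filter.atTop : Filter (Finset V)))
    (f := fun T p => (if ∀ y ∈ T, ψ p y = 1 then a p else 0) * ψ p 0)
    (g := fun p => if p = q then a q else 0) (bound := fun p => ‖a p‖) ha.norm (by
      intro p
      have hp0 : ψ p 0 = 1 := by
        have := ψadd p 0 0
        rw [add_zero] at this
        have h0 : ψ p 0 ≠ 0 := div_ne_zero (hne _ _) (hne _ _)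
        exact (mul_left_cancel₀ h0 (by rw [← this, mul_one]))
      refine tendsto_const_nhds.congr' ?_
      by_cases hpq : p = q
      · subst hpq
        refine Filter.Eventually.of_forall fun T => ?_
        simp [ψ, hne]
      · by_cases hap : a p = 0
        · simp [hpq, hap]
        · obtain ⟨x, hx⟩ := hinj p q hap hq hpq
          filter_upwards [Filter.eventually_ge_atTop {x}] with T hT
          have : ¬ ∀ y ∈ T, ψ p y = 1 := fun h1 =>
            hx ((div_eq_one_iff_eq (hne q x)).1 (h1 x (hT (Finset.mem_singleton_self x))))
          rw [if_neg hpq, if_neg this, zero_mul])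
    (Filter.Eventually.of_forall fun T p => by
      rw [norm_mul, ψnorm, mul_one]
      split_ifs
      · exact le_rfl
      · simp)
  simp only [(hT _ _).tsum_eq, tsum_ite_eq] at hlim
  exact hq (tendsto_nhds_unique hlim tendsto_const_nhds)

end uniqueness

section
variable {F : Type*} [Field F] [NumberField F] {n l : ℕ}

theorem trace_map_toFin {m : ℕ} (A : Matrix (Fin m) (Fin m) (AdeleRing (𝓞 F) F)) :
    toFin F A.trace = (A.map (toFin F)).trace :=
  AddMonoidHom.map_trace (toFin F) A

variable [IsTotallyReal F]

/-- An archimedean adele. -/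
def ofArch (y : InfiniteAdeleRing F) : AdeleRing (𝓞 F) F := (y, 0)

theorem exists_psi_ofArch_ne_one {x : F} (hx : x ≠ 0) :
    ∃ y : InfiniteAdeleRing F, psi (ofArch y * algebraMap F (AdeleRing (𝓞 F) F) x) ≠ 1 := by
  classical
  let v : InfinitePlace F := Classical.arbitrary _
  have hv : realEmb v x ≠ 0 := (map_ne_zero _).2 hx
  obtain ⟨s, hs⟩ := InfinitePlace.Completion.surjective_extensionEmbeddingOfIsReal
    (IsTotallyReal.isReal v) ((2 * realEmb v x)⁻¹)
  refine ⟨(Pi.single v s : ∀ w : InfinitePlace F, w.Completion), ?_⟩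
  have h2 : toFin F (ofArch (Pi.single v s : ∀ w : InfinitePlace F, w.Completion) *
      algebraMap F (AdeleRing (𝓞 F) F) x) = 0 := zero_mul _
  have h1 : ∀ w : InfinitePlace F, realAt w (toArch F (ofArch
      (Pi.single v s : ∀ w : InfinitePlace F, w.Completion) * algebraMap F (AdeleRing (𝓞 F) F) x)) =
      if w = v then 2⁻¹ else 0 := by
    intro w
    rw [map_mul, map_mul, realAt_algebraMap]
    split_ifs with hw
    · rw [hw]
      have : realAt v (toArch F (ofArch
        (Pi.single v s : ∀ w : InfinitePlace F, w.Completion))) = (2 * realEmb v x)⁻¹ := by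
        rw [← hs]
        exact congrArg (InfinitePlace.Completion.extensionEmbeddingOfIsReal (IsTotallyReal.isReal v))
          (Pi.single_eq_same (M := fun w : InfinitePlace F => w.Completion) v s)
      rw [this]
      field_simp
    · have : realAt w (toArch F (ofArch
        (Pi.single v s : ∀ w : InfinitePlace F, w.Completion))) = 0 := by
        rw [← map_zero (InfinitePlace.Completion.extensionEmbeddingOfIsReal
          (IsTotallyReal.isReal w))]
        exact congrArg (InfinitePlace.Completion.extensionEmbeddingOfIsReal (IsTotallyReal.isReal w))
          (Pi.single_eq_of_ne (M := fun w : InfinitePlace F => w.Completion) hw s)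
      rw [this, zero_mul]
  rw [psi, h2, psiFin_zero, mul_one]
  simp only [h1]
  rw [expArch, Finset.prod_eq_single v]
  · rw [if_pos rfl, ne_eq, expC_eq_one_iff]
    rintro ⟨m, hm⟩
    have h3 : (2 : ℂ)⁻¹ = m := by rw [← hm]; push_cast; rfl
    have h4 : (1 : ℂ) = 2 * m := by rw [← h3]; norm_num
    have h5 : (1 : ℤ) = 2 * m := by exact_mod_cast h4
    omega
  · intro w _ hw
    rw [if_neg hw]; simp [expC_zero]
  · simp

/-- The trace form `d ↦ tr(ᵗd d)` is anisotropic, because `F` is real. -/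
theorem trace_transpose_mul_self_ne_zero {m p : ℕ} {d : Matrix (Fin m) (Fin p) F} (hd : d ≠ 0) :
    (dᵀ * d).trace ≠ 0 := by
  intro h
  let v : InfinitePlace F := Classical.arbitrary _
  have h1 : ((d.map (realEmb v))ᴴ * d.map (realEmb v)).trace = 0 := by
    rw [Matrix.conjTranspose_eq_transpose_of_trivial, ← Matrix.transpose_map, ← Matrix.map_mul,
      ← AddMonoidHom.map_trace, h, map_zero]
  rw [Matrix.trace_conjTranspose_mul_self_eq_zero_iff] at h1
  apply hd
  ext i j
  have := congrFun (congrFun h1 i) j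
  simpa using this

/-- Matrices over `𝔸`, from matrices over `F`. -/
abbrev toAdele {m p : Type*} (x : Matrix m p F) : Matrix m p (AdeleRing (𝓞 F) F) :=
  x.map (algebraMap F (AdeleRing (𝓞 F) F))

theorem norm_psi_of_toFin_eq_zero {x : AdeleRing (𝓞 F) F} (hx : toFin F x = 0) : ‖psi x‖ = 1 := by
  rw [psi, hx, psiFin_zero, mul_one]
  exact norm_expArch_ofReal _

/-- The translations at the archimedean places. -/
def archTranslations (F : Type*) [Field F] [NumberField F] (n l : ℕ) :
    AddSubgroup (Matrix (Fin n) (Fin n) (AdeleRing (𝓞 F) F) ×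
      Matrix (Fin l) (Fin n) (AdeleRing (𝓞 F) F)) where
  carrier := {x | x.1.IsSymm ∧ x.1.map (toFin F) = 0 ∧ x.2.map (toFin F) = 0}
  add_mem' := by
    rintro x y ⟨h1, h2, h3⟩ ⟨h1', h2', h3'⟩
    exact ⟨h1.add h1', by rw [Prod.fst_add, Matrix.map_add _ (map_add _), h2, h2', add_zero],
      by rw [Prod.snd_add, Matrix.map_add _ (map_add _), h3, h3', add_zero]⟩
  zero_mem' := ⟨Matrix.isSymm_zero, Matrix.map_zero _ (map_zero _), Matrix.map_zero _ (map_zero _)⟩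
  neg_mem' := by
    rintro x ⟨h1, h2, h3⟩
    exact ⟨h1.neg, by rw [Prod.fst_neg, Matrix.map_neg _ (map_neg _), h2, neg_zero],
      by rw [Prod.snd_neg, Matrix.map_neg _ (map_neg _), h3, neg_zero]⟩

/-- The character `(σ, m) ↦ Ψ(tr(tσ)) Ψ(tr(ᵗr m))`. -/
def fourierChar (p : Matrix (Fin n) (Fin n) F × Matrix (Fin l) (Fin n) F)
    (x : Matrix (Fin n) (Fin n) (AdeleRing (𝓞 F) F) × Matrix (Fin l) (Fin n) (AdeleRing (𝓞 F) F)) :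
    ℂ :=
  psi (toAdele p.1 * x.1).trace * psi ((toAdele p.2)ᵀ * x.2).trace

theorem fourierChar_add (p : Matrix (Fin n) (Fin n) F × Matrix (Fin l) (Fin n) F)
    (x y : Matrix (Fin n) (Fin n) (AdeleRing (𝓞 F) F) ×
      Matrix (Fin l) (Fin n) (AdeleRing (𝓞 F) F)) :
    fourierChar p (x + y) = fourierChar p x * fourierChar p y := by
  simp only [fourierChar, Prod.fst_add, Prod.snd_add, Matrix.mul_add, Matrix.trace_add, psi_add]
  ring

theorem norm_fourierChar_arch (p : Matrix (Fin n) (Fin n) F × Matrix (Fin l) (Fin n) F)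
    {x} (hx : x ∈ archTranslations F n l) : ‖fourierChar p x‖ = 1 := by
  rw [fourierChar, norm_mul, norm_psi_of_toFin_eq_zero, norm_psi_of_toFin_eq_zero, mul_one]
  · rw [trace_map_toFin, Matrix.map_mul, hx.2.2, Matrix.mul_zero, Matrix.trace_zero]
  · rw [trace_map_toFin, Matrix.map_mul, hx.2.1, Matrix.mul_zero, Matrix.trace_zero]

theorem fourierChar_zero (p : Matrix (Fin n) (Fin n) F × Matrix (Fin l) (Fin n) F) :
    fourierChar p 0 = 1 := by
  simp [fourierChar, psi_zero]

/-- Distinct indices give characters which differ on the archimedean translations, namely on real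
multiples of the difference `d` of the indices, as `tr(ᵗd d) ≠ 0`. -/
theorem exists_fourierChar_ne {p q : Matrix (Fin n) (Fin n) F × Matrix (Fin l) (Fin n) F}
    (hp : p.1.IsSymm) (hq : q.1.IsSymm) (hpq : p ≠ q) :
    ∃ x ∈ archTranslations F n l, fourierChar p x ≠ fourierChar q x := by
  have hz : ∀ (m : ℕ) (A : Matrix (Fin m) (Fin n) F) (y : InfiniteAdeleRing F),
      (ofArch y • toAdele A).map (toFin F) = 0 := by
    intro m A y
    ext i j
    exact zero_mul _
  by_cases h1 : p.1 = q.1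
  · have h2 : p.2 - q.2 ≠ 0 := fun h => hpq (Prod.ext h1 (sub_eq_zero.1 h))
    obtain ⟨y, hy⟩ := exists_psi_ofArch_ne_one (trace_transpose_mul_self_ne_zero h2)
    refine ⟨(0, ofArch y • toAdele (p.2 - q.2)), ⟨Matrix.isSymm_zero,
      Matrix.map_zero _ (map_zero _), hz _ _ _⟩, fun h => hy ?_⟩
    simp only [fourierChar, Matrix.mul_zero, Matrix.trace_zero, psi_zero, one_mul] at h
    have e : ofArch y * algebraMap F (AdeleRing (𝓞 F) F) ((p.2 - q.2)ᵀ * (p.2 - q.2)).trace =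
        ((toAdele p.2)ᵀ * (ofArch y • toAdele (p.2 - q.2))).trace -
        ((toAdele q.2)ᵀ * (ofArch y • toAdele (p.2 - q.2))).trace := by
      rw [← Matrix.trace_sub, ← Matrix.sub_mul, Matrix.mul_smul, Matrix.trace_smul,
        ← Matrix.transpose_sub, ← Matrix.map_sub _ (map_sub _), smul_eq_mul, ← Matrix.transpose_map,
        ← Matrix.map_mul]
      congr 1
      exact AddMonoidHom.map_trace (algebraMap F (AdeleRing (𝓞 F) F)) _
    rw [e, sub_eq_add_neg, psi_add, psi_neg, h, mul_inv_cancel₀ (psi_ne_zero _)]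
  · have h2 : p.1 - q.1 ≠ 0 := fun h => h1 (sub_eq_zero.1 h)
    obtain ⟨y, hy⟩ := exists_psi_ofArch_ne_one (trace_transpose_mul_self_ne_zero h2)
    have hs : (p.1 - q.1)ᵀ = p.1 - q.1 := (hp.sub hq).eq
    refine ⟨(ofArch y • toAdele (p.1 - q.1), 0), ⟨((hp.sub hq).map _).smul _,
      hz _ _ _, Matrix.map_zero _ (map_zero _)⟩, fun h => hy ?_⟩
    simp only [fourierChar, Matrix.mul_zero, Matrix.trace_zero, psi_zero, mul_one] at h
    have e : ofArch y * algebraMap F (AdeleRing (𝓞 F) F) ((p.1 - q.1)ᵀ * (p.1 - q.1)).trace =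
        (toAdele p.1 * (ofArch y • toAdele (p.1 - q.1))).trace -
        (toAdele q.1 * (ofArch y • toAdele (p.1 - q.1))).trace := by
      rw [← Matrix.trace_sub, ← Matrix.sub_mul, Matrix.mul_smul, Matrix.trace_smul,
        ← Matrix.map_sub _ (map_sub _), smul_eq_mul, hs, ← Matrix.map_mul]
      congr 1
      exact AddMonoidHom.map_trace (algebraMap F (AdeleRing (𝓞 F) F)) _
    rw [e, sub_eq_add_neg, psi_add, psi_neg, h, mul_inv_cancel₀ (psi_ne_zero _)]

/-- Adelic Fourier coefficients are determined by the values of the series at the archimedean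
translations. -/
theorem fourier_coeff_eq {C D : Matrix (Fin n) (Fin n) F × Matrix (Fin l) (Fin n) F → ℂ}
    (hC : ∀ p, C p ≠ 0 → p.1.IsSymm) (hD : ∀ p, D p ≠ 0 → p.1.IsSymm)
    {g : Matrix (Fin n) (Fin n) (AdeleRing (𝓞 F) F) ×
      Matrix (Fin l) (Fin n) (AdeleRing (𝓞 F) F) → ℂ}
    (h1 : ∀ x ∈ archTranslations F n l, HasSum (fun p => C p * fourierChar p x) (g x))
    (h2 : ∀ x ∈ archTranslations F n l, HasSum (fun p => D p * fourierChar p x) (g x)) : C = D := by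
  have h0 := zero_mem (archTranslations F n l)
  have hs : Summable fun p => C p - D p := by
    have := ((h1 0 h0).sub (h2 0 h0)).summable
    simpa [fourierChar_zero] using this
  have hCD : ∀ p, C p - D p ≠ 0 → p.1.IsSymm := by
    intro p hp
    by_cases h : C p = 0
    · exact hD p fun h' => hp (by rw [h, h', sub_zero])
    · exact hC p h
  funext q
  refine sub_eq_zero.1 (eq_zero_of_hasSum_characters (V := archTranslations F n l)
    (χ := fun p x => fourierChar p x.1) hs (fun p x y => fourierChar_add p _ _)
    (fun p x => norm_fourierChar_arch p x.2) ?_ (fun x => ?_) q)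
  · intro p q hp hq hpq
    obtain ⟨x, hx, h⟩ := exists_fourierChar_ne (hCD p hp) (hCD q hq) hpq
    exact ⟨⟨x, hx⟩, h⟩
  · have := (h1 x.1 x.2).sub (h2 x.1 x.2)
    rw [sub_self] at this
    exact this.congr_fun fun p => sub_mul _ _ _

end

/-! ### Multiplication in the Siegel parabolic subgroup -/

namespace JacobiGroup
variable {n l : ℕ} {R : Type*} [CommRing R]

theorem lam_mul (x y : JacobiGroup n l R) : (x * y).lam = x.lam + (tw x y).toCols₁ := rfl

theorem mu_mul (x y : JacobiGroup n l R) : (x * y).mu = x.mu + (tw x y).toCols₂ := rfl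

theorem kap_mul' (x y : JacobiGroup n l R) : (x * y).kap =
    x.kap + y.kap + x.lam * (tw x y).toCols₂ᵀ + (tw x y).toCols₂ * x.lamᵀ
        + (tw x y).toCols₁ * (tw x y).toCols₂ᵀ - y.lam * y.muᵀ := rfl

theorem tw_central (κ : Matrix (Fin l) (Fin l) R) (hκ : κ.IsSymm) (y : JacobiGroup n l R) :
    tw (central κ hκ) y = Matrix.fromCols y.lam y.mu := by
  have : ((central κ hκ : JacobiGroup n l R).g⁻¹ : Matrix.symplecticGroup (Fin n) R) = 1 :=
    inv_one
  rw [tw, this]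
  exact Matrix.mul_one _

theorem central_mul (κ : Matrix (Fin l) (Fin l) R) (hκ : κ.IsSymm) (y : JacobiGroup n l R) :
    central κ hκ * y = { y with kap := κ + y.kap, kap_symm := hκ.add y.kap_symm } := by
  apply JacobiGroup.ext
  · rw [lam_mul, tw_central]; simp [central]
  · rw [mu_mul, tw_central]; simp [central]
  · rw [kap_mul', tw_central]; simp [central]
  · exact one_mul _

theorem central_zero : (central 0 Matrix.isSymm_zero : JacobiGroup n l R) = 1 := rfl

end JacobiGroup

section siegel
variable {n l : ℕ} {R : Type*} [CommRing R]
open JacobiGroup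

theorem GL_mul_inv (q : GL (Fin n) R) : q.1 * (q⁻¹).1 = 1 := by
  rw [← Units.val_mul, mul_inv_cancel, Units.val_one]

theorem GL_inv_mul (q : GL (Fin n) R) : (q⁻¹).1 * q.1 = 1 := by
  rw [← Units.val_mul, inv_mul_cancel, Units.val_one]

theorem GL_inv_transpose_mul (q : GL (Fin n) R) : (q⁻¹).1ᵀ * q.1ᵀ = 1 := by
  rw [← Matrix.transpose_mul, GL_mul_inv, Matrix.transpose_one]

theorem GL_transpose_mul_inv (q : GL (Fin n) R) : q.1ᵀ * (q⁻¹).1ᵀ = 1 := by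
  rw [← Matrix.transpose_mul, GL_inv_mul, Matrix.transpose_one]

theorem tw_siegelElt (lam mu : Matrix (Fin l) (Fin n) R) (q : GL (Fin n) R)
    (σ : Matrix (Fin n) (Fin n) R) (hσ : σ.IsSymm) (y : JacobiGroup n l R) :
    tw (siegelElt lam mu q σ hσ) y =
      Matrix.fromCols (y.lam * (q⁻¹).1) (y.mu * q.1ᵀ - y.lam * (q⁻¹).1 * σ) := by
  rw [tw, blocks_inv, Matrix.fromCols_mul_fromBlocks]
  simp only [siegelElt, Matrix.toBlocks_fromBlocks₁₁, Matrix.toBlocks_fromBlocks₁₂,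
    Matrix.toBlocks_fromBlocks₂₁, Matrix.toBlocks_fromBlocks₂₂, Matrix.transpose_mul,
    Matrix.transpose_transpose, Matrix.transpose_zero, neg_zero, Matrix.mul_zero, add_zero, hσ.eq,
    Matrix.mul_neg, Matrix.mul_assoc]
  rw [neg_add_eq_sub]

theorem g_siegelElt_mul (lam mu lam' mu' : Matrix (Fin l) (Fin n) R) (q q' : GL (Fin n) R)
    (σ σ' : Matrix (Fin n) (Fin n) R) (hσ : σ.IsSymm) (hσ' : σ'.IsSymm) :
    ((siegelElt lam mu q σ hσ).g * (siegelElt lam' mu' q' σ' hσ').g).1 =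
      Matrix.fromBlocks (q * q').1 ((q.1 * σ' * q.1ᵀ + σ) * ((q * q')⁻¹).1ᵀ) 0 ((q * q')⁻¹).1ᵀ := by
  change Matrix.fromBlocks _ _ _ _ * Matrix.fromBlocks _ _ _ _ = _
  rw [Matrix.fromBlocks_multiply, _root_.mul_inv_rev]
  have h := GL_transpose_mul_inv q
  simp only [Units.val_mul, Matrix.transpose_mul, Matrix.mul_zero, Matrix.zero_mul, add_zero,
    zero_add, Matrix.add_mul]
  congr 2
  · calc q.1 * (σ' * (q'⁻¹).1ᵀ) = q.1 * σ' * 1 * (q'⁻¹).1ᵀ := by simp [Matrix.mul_assoc]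
      _ = _ := by rw [← h]; simp only [Matrix.mul_assoc]
  · rw [Matrix.mul_assoc]

/-- Left translation by `(0, μ', 0) [[1, σ'], [0, 1]]`. -/
theorem unipotent_mul_siegelElt (lam mu mu' : Matrix (Fin l) (Fin n) R) (q : GL (Fin n) R)
    (σ σ' : Matrix (Fin n) (Fin n) R) (hσ : σ.IsSymm) (hσ' : σ'.IsSymm)
    (hκ : (-(lam * σ' * lamᵀ)).IsSymm) :
    siegelElt 0 mu' 1 σ' hσ' * siegelElt lam mu q σ hσ =
      central (-(lam * σ' * lamᵀ)) hκ *
        siegelElt lam (mu + mu' - lam * σ') q (σ + σ') (hσ.add hσ') := by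
  rw [central_mul]
  apply JacobiGroup.ext
  · rw [lam_mul, tw_siegelElt]; simp [siegelElt]
  · rw [mu_mul, tw_siegelElt]; simp [siegelElt]; abel
  · rw [kap_mul', tw_siegelElt]
    simp [siegelElt, Matrix.transpose_mul, Matrix.mul_sub, hσ'.eq, Matrix.mul_assoc]
  · apply Subtype.ext
    refine (g_siegelElt_mul _ _ _ _ _ _ _ _ _ _).trans ?_
    simp [siegelElt]

/-- Right translation by `(0, μ'', 0) [[1, σ''], [0, 1]]`. -/
theorem siegelElt_mul_unipotent (lam mu mu' : Matrix (Fin l) (Fin n) R) (q : GL (Fin n) R)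
    (σ σ' : Matrix (Fin n) (Fin n) R) (hσ : σ.IsSymm) (hσ' : σ'.IsSymm)
    (hκ : (lam * q.1 * mu'ᵀ + (lam * q.1 * mu'ᵀ)ᵀ).IsSymm)
    (hs : (σ + q.1 * σ' * q.1ᵀ).IsSymm) :
    siegelElt lam mu q σ hσ * siegelElt 0 mu' 1 σ' hσ' =
      central (lam * q.1 * mu'ᵀ + (lam * q.1 * mu'ᵀ)ᵀ) hκ *
        siegelElt lam (mu + mu' * q.1ᵀ) q (σ + q.1 * σ' * q.1ᵀ) hs := by
  rw [central_mul]
  apply JacobiGroup.ext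
  · rw [lam_mul, tw_siegelElt]; simp [siegelElt]
  · rw [mu_mul, tw_siegelElt]; simp [siegelElt]
  · rw [kap_mul', tw_siegelElt]
    simp [siegelElt, Matrix.transpose_mul, Matrix.mul_assoc]
  · apply Subtype.ext
    refine (g_siegelElt_mul _ _ _ _ _ _ _ _ _ _).trans ?_
    simp [siegelElt, add_comm]

/-- Left translation by `diag(a, ᵗa⁻¹)`. -/
theorem diag_mul_siegelElt (lam mu : Matrix (Fin l) (Fin n) R) (a q : GL (Fin n) R)
    (σ : Matrix (Fin n) (Fin n) R) (hσ : σ.IsSymm) (hs : (a.1 * σ * a.1ᵀ).IsSymm) :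
    siegelElt 0 0 a 0 Matrix.isSymm_zero * siegelElt lam mu q σ hσ =
        siegelElt (lam * (a⁻¹).1) (mu * a.1ᵀ) (a * q) (a.1 * σ * a.1ᵀ) hs := by
  apply JacobiGroup.ext
  · rw [lam_mul, tw_siegelElt]; simp [siegelElt]
  · rw [mu_mul, tw_siegelElt]; simp [siegelElt]
  · rw [kap_mul', tw_siegelElt]
    have h : lam * (a⁻¹).1 * (a.1 * muᵀ) = lam * muᵀ := by
      rw [Matrix.mul_assoc, ← Matrix.mul_assoc _ a.1, GL_inv_mul, Matrix.one_mul]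
    simp only [siegelElt, Matrix.toCols₁_fromCols, Matrix.toCols₂_fromCols, Matrix.transpose_mul,
      Matrix.mul_zero, sub_zero, Matrix.transpose_transpose, h]
    simp
  · apply Subtype.ext
    refine (g_siegelElt_mul _ _ _ _ _ _ _ _ _ _).trans ?_
    simp [siegelElt]

theorem map_siegelElt {R' : Type*} [CommRing R'] (φ : R →+* R') (lam mu : Matrix (Fin l) (Fin n) R)
    (q : GL (Fin n) R) (σ : Matrix (Fin n) (Fin n) R) (hσ : σ.IsSymm) :
    (siegelElt lam mu q σ hσ).map φ =
      siegelElt (lam.map φ) (mu.map φ) (Matrix.GeneralLinearGroup.map φ q) (σ.map φ) (hσ.map φ) := by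
  have hi : (((Matrix.GeneralLinearGroup.map φ q)⁻¹ : GL (Fin n) R')).1 = (q⁻¹).1.map φ := by
    rw [← map_inv]; rfl
  apply JacobiGroup.ext
  · rfl
  · rfl
  · exact Matrix.map_zero φ (map_zero φ)
  · apply Subtype.ext
    change (Matrix.fromBlocks _ _ _ _).map φ = Matrix.fromBlocks _ _ _ _
    rw [Matrix.fromBlocks_map, hi, Matrix.map_mul, Matrix.transpose_map,
      Matrix.map_zero φ (map_zero φ)]
    rfl

end siegel

/-! ### The archimedean computation -/

section arch
variable {n l : ℕ}

theorem toC_mul {m p s : Type*} [Fintype p] (A : Matrix m p ℝ) (B : Matrix p s ℝ) :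
    toC (A * B) = toC A * toC B := Matrix.map_mul (f := Complex.ofRealHom)

theorem toC_one {m : Type*} [DecidableEq m] : toC (1 : Matrix m m ℝ) = 1 :=
  Matrix.map_one _ Complex.ofReal_zero Complex.ofReal_one

theorem toC_zero {m p : Type*} : toC (0 : Matrix m p ℝ) = 0 :=
  Matrix.map_zero _ Complex.ofReal_zero

theorem trace_toC {m : Type*} [Fintype m] (A : Matrix m m ℝ) :
    (toC A).trace = (A.trace : ℂ) := (AddMonoidHom.map_trace Complex.ofRealHom A).symm

theorem trace_toC_mul {m : Type*} [Fintype m] (A B C : Matrix m m ℝ) :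
    (toC A * (Complex.I • toC B + toC C)).trace =
      Complex.I * ((A * B).trace : ℝ) + ((A * C).trace : ℝ) := by
  rw [Matrix.mul_add, Matrix.mul_smul, Matrix.trace_add, Matrix.trace_smul, ← toC_mul, ← toC_mul,
    trace_toC, trace_toC, smul_eq_mul]

theorem locAct_one (z : Matrix (Fin n) (Fin n) ℂ × Matrix (Fin l) (Fin n) ℂ) :
    locAct (1 : JacobiGroup n l ℝ) z = z := by
  have h : (1 : JacobiGroup n l ℝ).g.1 = Matrix.fromBlocks 1 0 0 1 := Matrix.fromBlocks_one.symm
  have h1 : (1 : JacobiGroup n l ℝ).lam = 0 := rfl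
  have h2 : (1 : JacobiGroup n l ℝ).mu = 0 := rfl
  have hd : autDen (1 : JacobiGroup n l ℝ) z = 1 := by
    rw [autDen, h]
    simp only [Matrix.toBlocks_fromBlocks₂₁, Matrix.toBlocks_fromBlocks₂₂, toC_one, toC_zero,
      Matrix.zero_mul, zero_add]
  simp only [locAct, hd, h, h1, h2, Matrix.toBlocks_fromBlocks₁₁, Matrix.toBlocks_fromBlocks₁₂,
    toC_one, toC_zero, Matrix.one_mul, inv_one, Matrix.mul_one, Matrix.zero_mul, add_zero]

theorem locFactor_one (k : ℤ) (S : Matrix (Fin l) (Fin l) ℝ)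
    (z : Matrix (Fin n) (Fin n) ℂ × Matrix (Fin l) (Fin n) ℂ) :
    locFactor k S (1 : JacobiGroup n l ℝ) z = 1 := by
  have h : (1 : JacobiGroup n l ℝ).g.1 = Matrix.fromBlocks 1 0 0 1 := Matrix.fromBlocks_one.symm
  have h1 : (1 : JacobiGroup n l ℝ).lam = 0 := rfl
  have h3 : (1 : JacobiGroup n l ℝ).kap = 0 := rfl
  have hd : autDen (1 : JacobiGroup n l ℝ) z = 1 := by
    rw [autDen, h]
    simp only [Matrix.toBlocks_fromBlocks₂₁, Matrix.toBlocks_fromBlocks₂₂, toC_one, toC_zero,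
      Matrix.zero_mul, zero_add]
  rw [locFactor, hd, h1, h3, h, Matrix.toBlocks_fromBlocks₂₁, toC_zero, toC_zero, toC_zero]
  simp [expC_zero]

/-- `i q ᵗq + σ`. -/
def siegelPoint (q σ : Matrix (Fin n) (Fin n) ℝ) : Matrix (Fin n) (Fin n) ℂ :=
  Complex.I • toC (q * qᵀ) + toC σ

theorem autDen_siegelElt (lam mu : Matrix (Fin l) (Fin n) ℝ) (q : GL (Fin n) ℝ)
    (σ : Matrix (Fin n) (Fin n) ℝ) (hσ : σ.IsSymm)
    (z : Matrix (Fin n) (Fin n) ℂ × Matrix (Fin l) (Fin n) ℂ) :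
    autDen (siegelElt lam mu q σ hσ) z = toC (q⁻¹).1ᵀ := by
  simp only [autDen, siegelElt, Matrix.toBlocks_fromBlocks₂₁, Matrix.toBlocks_fromBlocks₂₂, toC_zero,
    Matrix.zero_mul, zero_add]

theorem inv_autDen_siegelElt (q : GL (Fin n) ℝ) : (toC (q⁻¹).1ᵀ)⁻¹ = toC q.1ᵀ := by
  apply Matrix.inv_eq_right_inv
  rw [← toC_mul, GL_inv_transpose_mul, toC_one]

theorem locAct_siegelElt (lam mu : Matrix (Fin l) (Fin n) ℝ) (q : GL (Fin n) ℝ)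
    (σ : Matrix (Fin n) (Fin n) ℝ) (hσ : σ.IsSymm) :
    locAct (siegelElt lam mu q σ hσ) (Complex.I • 1, 0) =
      (siegelPoint q.1 σ, toC lam * siegelPoint q.1 σ + toC mu) := by
  have h : (toC q.1 * (Complex.I • 1) + toC (σ * (q⁻¹).1ᵀ)) * toC q.1ᵀ = siegelPoint q.1 σ := by
    rw [Matrix.add_mul, ← toC_mul, Matrix.mul_assoc σ, GL_inv_transpose_mul, Matrix.mul_one,
      Matrix.mul_smul, Matrix.mul_one, Matrix.smul_mul, ← toC_mul, siegelPoint]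
  simp only [locAct, autDen_siegelElt, inv_autDen_siegelElt, Matrix.zero_mul, zero_add]
  simp only [siegelElt, Matrix.toBlocks_fromBlocks₁₁, Matrix.toBlocks_fromBlocks₁₂] at h ⊢
  rw [h]

theorem locFactor_siegelElt (k : ℤ) (S : Matrix (Fin l) (Fin l) ℝ)
    (lam mu : Matrix (Fin l) (Fin n) ℝ) (q : GL (Fin n) ℝ)
    (σ : Matrix (Fin n) (Fin n) ℝ) (hσ : σ.IsSymm) :
    (locFactor k S (siegelElt lam mu q σ hσ) (Complex.I • 1, 0))⁻¹ =
      (q.1.det : ℂ) ^ k * expC ((toC (lamᵀ * S * lam) * siegelPoint q.1 σ).trace) := by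
  have hd : (toC (q⁻¹).1ᵀ).det = (q.1.det : ℂ)⁻¹ := by
    have h1 : (toC (q⁻¹).1ᵀ).det = ((q⁻¹).1ᵀ.det : ℂ) := (RingHom.map_det Complex.ofRealHom _).symm
    have h2 : (q⁻¹).1.det * q.1.det = 1 := by rw [← Matrix.det_mul, GL_inv_mul, Matrix.det_one]
    rw [h1, Matrix.det_transpose]
    refine eq_inv_of_mul_eq_one_left ?_
    exact_mod_cast h2
  rw [locFactor, autDen_siegelElt, hd, locAct_siegelElt, _root_.mul_inv, _root_.inv_zpow, inv_inv,
    ← expC_neg]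
  congr 2
  have e1 : (siegelElt lam mu q σ hσ).kap = 0 := rfl
  have e2 : (siegelElt lam mu q σ hσ).lam = lam := rfl
  have e3 : toC lamᵀ = (toC lam)ᵀ := rfl
  rw [e1, e2, toC_mul, toC_mul, e3]
  simp

theorem siegelPoint_mem (q : GL (Fin n) ℝ) {σ : Matrix (Fin n) (Fin n) ℝ} (hσ : σ.IsSymm) :
    (siegelPoint q.1 σ).IsSymm ∧ ((siegelPoint q.1 σ).map Complex.im).PosDef := by
  have h1 : (q.1 * q.1ᵀ).IsSymm := Matrix.isSymm_mul_transpose_self _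
  refine ⟨((h1.map _).smul _).add (hσ.map _), ?_⟩
  have h2 : (siegelPoint q.1 σ).map Complex.im = q.1 * q.1ᴴ := by
    ext i j
    rw [Matrix.conjTranspose_eq_transpose_of_trivial]
    simp [siegelPoint]
  rw [h2]
  exact Matrix.PosDef.mul_conjTranspose_self _ (Matrix.vecMul_injective_of_isUnit q.isUnit)

/-- One archimedean factor of a term of the Fourier expansion. -/
theorem local_fourier_term (k : ℤ) (S : Matrix (Fin l) (Fin l) ℝ)
    (lam mu r : Matrix (Fin l) (Fin n) ℝ) (q : GL (Fin n) ℝ)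
    (σ t : Matrix (Fin n) (Fin n) ℝ) (hσ : σ.IsSymm) :
    (locFactor k S (siegelElt lam mu q σ hσ) (Complex.I • 1, 0))⁻¹ *
        expC (toC t * siegelPoint q.1 σ).trace *
        expC ((toC r)ᵀ * (toC lam * siegelPoint q.1 σ + toC mu)).trace =
      expC ((lamᵀ * S * lam * σ).trace : ℝ) *
        (expC (Complex.I * ((lamᵀ * S * lam * (q.1 * q.1ᵀ)).trace : ℝ)) * (q.1.det : ℂ) ^ k *
          expC (Complex.I * ((q.1ᵀ * t * q.1 + q.1ᵀ * rᵀ * lam * q.1).trace : ℝ))) *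
        (expC ((t * σ).trace : ℝ) * expC ((rᵀ * (mu + lam * σ)).trace : ℝ)) := by
  have e3 : (toC r)ᵀ = toC rᵀ := rfl
  have hr : ((toC r)ᵀ * (toC lam * siegelPoint q.1 σ + toC mu)).trace =
      (toC (rᵀ * lam) * siegelPoint q.1 σ).trace + ((rᵀ * mu).trace : ℝ) := by
    rw [Matrix.mul_add, Matrix.trace_add, e3, ← toC_mul, trace_toC, toC_mul, Matrix.mul_assoc]
  have h1 : (q.1ᵀ * t * q.1 + q.1ᵀ * rᵀ * lam * q.1).trace =
      (t * (q.1 * q.1ᵀ)).trace + (rᵀ * lam * (q.1 * q.1ᵀ)).trace := by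
    rw [Matrix.trace_add]
    congr 1
    · rw [Matrix.mul_assoc, Matrix.trace_mul_comm, Matrix.mul_assoc]
    · rw [Matrix.mul_assoc, Matrix.mul_assoc, Matrix.trace_mul_comm]
      simp only [Matrix.mul_assoc]
  have h2 : (rᵀ * (mu + lam * σ)).trace = (rᵀ * mu).trace + (rᵀ * lam * σ).trace := by
    rw [Matrix.mul_add, Matrix.trace_add, Matrix.mul_assoc]
  rw [locFactor_siegelElt, hr, h1, h2]
  simp only [siegelPoint, trace_toC_mul]
  simp only [Complex.ofReal_add, mul_add, expC_add]
  ring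

end arch

/-! ### Consequences of the automorphy -/

section auto

theorem map_one_jacobi {n l : ℕ} {R R' : Type*} [CommRing R] [CommRing R'] (φ : R →+* R') :
    (1 : JacobiGroup n l R).map φ = 1 := map_one (JacobiGroup.mapHom φ)

theorem act_one {F : Type*} [Field F] [IsTotallyReal F] {n l : ℕ} (z : Point F n l) :
    act (1 : JacobiGroup n l (InfiniteAdeleRing F)) z = z := by
  funext v
  rw [act, map_one_jacobi, locAct_one]

variable {F : Type*} [Field F] [NumberField F] {n l : ℕ}

theorem jacobi_ext_parts {x y : JacobiGroup n l (AdeleRing (𝓞 F) F)}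
    (h1 : x.map (toArch F) = y.map (toArch F)) (h2 : x.map (toFin F) = y.map (toFin F)) : x = y := by
  apply JacobiGroup.ext
  · exact archFin_ext (congrArg JacobiGroup.lam h1) (congrArg JacobiGroup.lam h2)
  · exact archFin_ext (congrArg JacobiGroup.mu h1) (congrArg JacobiGroup.mu h2)
  · exact archFin_ext (congrArg JacobiGroup.kap h1) (congrArg JacobiGroup.kap h2)
  · exact Subtype.ext (archFin_ext (congrArg (fun z => z.g.1) h1) (congrArg (fun z => z.g.1) h2))

theorem ofParts_mul_ofParts (x : JacobiGroup n l (InfiniteAdeleRing F))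
    (y : JacobiGroup n l (FiniteAdeleRing (𝓞 F) F)) :
    ofParts 1 y * ofParts x 1 = ofParts x y := by
  apply jacobi_ext_parts
  · refine (map_mul (JacobiGroup.mapHom (toArch F)) _ _).trans ?_
    exact one_mul x
  · refine (map_mul (JacobiGroup.mapHom (toFin F)) _ _).trans ?_
    exact mul_one y

theorem levelChar_eq_one (c : Ideal (𝓞 F)) (χ : (AdeleRing (𝓞 F) F)ˣ →* ℂˣ)
    {w : JacobiGroup n l (AdeleRing (𝓞 F) F)} (hw : w.g.1.toBlocks₁₁ = 1) :
    levelChar c χ w = 1 := by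
  rw [levelChar]
  refine finprod_mem_eq_one_of_forall_eq_one fun v _ => ?_
  have h : Units.mk0 (1 : v.adicCompletion F) one_ne_zero = 1 := Units.ext rfl
  rw [hw, Matrix.det_one, map_one, map_one, localChar, dif_neg one_ne_zero, h, map_one, map_one,
    Units.val_one, inv_one]

variable [IsTotallyReal F]

theorem autFactor_one (k : InfinitePlace F → ℤ) (S : Matrix (Fin l) (Fin l) F) (z : Point F n l) :
    autFactor k S (1 : JacobiGroup n l (InfiniteAdeleRing F)) z = 1 := by
  rw [autFactor]
  refine Finset.prod_eq_one fun v _ => ?_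
  rw [map_one_jacobi, locFactor_one]

theorem slash_one (k : InfinitePlace F → ℤ) (S : Matrix (Fin l) (Fin l) F) (φ : Point F n l → ℂ) :
    slash k S φ (1 : JacobiGroup n l (InfiniteAdeleRing F)) = φ := by
  funext z
  rw [slash, act_one, autFactor_one, inv_one, one_mul]

section form
variable {b : FractionalIdeal (𝓞 F)⁰ F} {c : Ideal (𝓞 F)}
  {k : InfinitePlace F → ℤ} {S : Matrix (Fin l) (Fin l) F}
  {χ : (AdeleRing (𝓞 F) F)ˣ →* ℂˣ} {f : JacobiGroup n l (AdeleRing (𝓞 F) F) → ℂ}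
  (hf : IsAdelicSiegelJacobiForm b c (level n l b c) k S χ f)
include hf

/-- Invariance under the elements of the level supported at the finite places with `a = 1`. -/
theorem IsAdelicSiegelJacobiForm.mul_fin {y w : JacobiGroup n l (AdeleRing (𝓞 F) F)}
    (h1 : w.map (toArch F) = 1) (h2 : w.map (toFin F) ∈ levelFin n l b c)
    (h3 : w.g.1.toBlocks₁₁ = 1) : f (y * w) = f y := by
  have h := hf.automorphy 0 Matrix.isSymm_zero 1 y w h2 ⟨h2, by rw [h1, act_one]⟩
  rw [JacobiGroup.central_zero, map_one_jacobi, one_mul, one_mul, levelChar_eq_one c χ h3, h1,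
    autFactor_one, Matrix.mul_zero, Matrix.trace_zero, psi_zero] at h
  simpa using h

theorem IsAdelicSiegelJacobiForm.central_map_mul (κ : Matrix (Fin l) (Fin l) (AdeleRing (𝓞 F) F))
    (hκ : κ.IsSymm) (γ : JacobiGroup n l F) (y : JacobiGroup n l (AdeleRing (𝓞 F) F)) :
    f (JacobiGroup.central κ hκ * γ.map (algebraMap F (AdeleRing (𝓞 F) F)) * y) =
      psi (toAdele S * κ).trace * f y := by
  have h2 : (1 : JacobiGroup n l (AdeleRing (𝓞 F) F)).map (toFin F) ∈ levelFin n l b c := by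
    rw [map_one_jacobi]; exact one_mem _
  have h3 : (1 : JacobiGroup n l (AdeleRing (𝓞 F) F)).g.1.toBlocks₁₁ = 1 := by
    have h : (1 : JacobiGroup n l (AdeleRing (𝓞 F) F)).g.1 = Matrix.fromBlocks 1 0 0 1 :=
      Matrix.fromBlocks_one.symm
    rw [h, Matrix.toBlocks_fromBlocks₁₁]
  have h := hf.automorphy κ hκ γ y 1 h2 ⟨h2, by rw [map_one_jacobi, act_one]⟩
  rw [levelChar_eq_one c χ h3, map_one_jacobi, autFactor_one, mul_one] at h
  simpa using h

theorem IsAdelicSiegelJacobiForm.map_mul (γ : JacobiGroup n l F)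
    (y : JacobiGroup n l (AdeleRing (𝓞 F) F)) :
    f (γ.map (algebraMap F (AdeleRing (𝓞 F) F)) * y) = f y := by
  have h := hf.central_map_mul 0 Matrix.isSymm_zero γ y
  rwa [JacobiGroup.central_zero, one_mul, Matrix.mul_zero, Matrix.trace_zero, psi_zero,
    one_mul] at h

theorem IsAdelicSiegelJacobiForm.central_mul (κ : Matrix (Fin l) (Fin l) (AdeleRing (𝓞 F) F))
    (hκ : κ.IsSymm) (y : JacobiGroup n l (AdeleRing (𝓞 F) F)) :
    f (JacobiGroup.central κ hκ * y) = psi (toAdele S * κ).trace * f y := by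
  have h := hf.central_map_mul κ hκ 1 y
  rwa [map_one_jacobi, mul_one] at h

end form
end auto

/-! ### Normalized values on the Siegel parabolic subgroup -/

section
variable {F : Type*} [Field F] [NumberField F] [IsTotallyReal F] {n l : ℕ}

/-- The component `𝔸 → F_v = ℝ` at an archimedean place. -/
def realPart (v : InfinitePlace F) : AdeleRing (𝓞 F) F →+* ℝ := (realAt v).comp (toArch F)

theorem map_realPart_toAdele {m p : Type*} (v : InfinitePlace F) (A : Matrix m p F) :
    (toAdele A).map (realPart v) = A.map (realEmb v) := by
  ext i j
  exact realAt_algebraMap v (A i j)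

theorem realPart_trace {m : ℕ} (v : InfinitePlace F)
    (A : Matrix (Fin m) (Fin m) (AdeleRing (𝓞 F) F)) :
    realPart v A.trace = (A.map (realPart v)).trace :=
  AddMonoidHom.map_trace (realPart v) A

theorem psi_of_toFin_eq_zero {x : AdeleRing (𝓞 F) F} (hx : toFin F x = 0) :
    psi x = ∏ v, expC (realPart v x : ℂ) := by
  rw [psi, hx, psiFin_zero, mul_one]
  rfl

/-- The factor of `c(t,r;q,λ)` which depends on `q` and `λ` only through `q_𝐚` and `λ_𝐚`, for
`p = (t, r)`. -/
def archFactor (k : InfinitePlace F → ℤ) (S : Matrix (Fin l) (Fin l) F)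
    (q : GL (Fin n) (AdeleRing (𝓞 F) F)) (lam : Matrix (Fin l) (Fin n) (AdeleRing (𝓞 F) F))
    (p : Matrix (Fin n) (Fin n) F × Matrix (Fin l) (Fin n) F) : ℂ :=
  expArch (fun v => Complex.I *
      (((lam.map (realPart v))ᵀ * S.map (realEmb v) * lam.map (realPart v) *
        (q.1.map (realPart v) * (q.1.map (realPart v))ᵀ)).trace : ℝ)) *
    (∏ v, (((q.1.map (realPart v)).det : ℝ) : ℂ) ^ k v) *
    expArch (fun v => Complex.I *
      (((q.1.map (realPart v))ᵀ * p.1.map (realEmb v) * q.1.map (realPart v) +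
        (q.1.map (realPart v))ᵀ * (p.2.map (realEmb v))ᵀ * lam.map (realPart v) *
          q.1.map (realPart v)).trace : ℝ))

/-- The coefficient `c(t,r;q,λ)` is `Ψ(tr(S[λ]σ))` times a quantity independent of `σ`. -/
theorem jacobiCoeff_eq (k : InfinitePlace F → ℤ) (S : Matrix (Fin l) (Fin l) F)
    (c₀ : Matrix (Fin n) (Fin n) F → Matrix (Fin l) (Fin n) F →
      GL (Fin n) (FiniteAdeleRing (𝓞 F) F) → Matrix (Fin l) (Fin n) (FiniteAdeleRing (𝓞 F) F) → ℂ)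
    (t : Matrix (Fin n) (Fin n) F) (r : Matrix (Fin l) (Fin n) F)
    (q : GL (Fin n) (AdeleRing (𝓞 F) F)) (lam : Matrix (Fin l) (Fin n) (AdeleRing (𝓞 F) F))
    (σ : Matrix (Fin n) (Fin n) (AdeleRing (𝓞 F) F)) :
    jacobiCoeff k S c₀ t r q lam σ = psi (lamᵀ * toAdele S * lam * σ).trace *
      (c₀ t r (Matrix.GeneralLinearGroup.map (toFin F) q) (lam.map (toFin F)) *
        archFactor k S q lam (t, r)) := by
  have h : jacobiCoeff k S c₀ t r q lam σ = psi (lamᵀ * toAdele S * lam * σ).trace *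
    expArch (fun v => Complex.I *
      (((lam.map (realPart v))ᵀ * S.map (realEmb v) * lam.map (realPart v) *
        (q.1.map (realPart v) * (q.1.map (realPart v))ᵀ)).trace : ℝ)) *
    (∏ v, (((q.1.map (realPart v)).det : ℝ) : ℂ) ^ k v) *
    expArch (fun v => Complex.I *
      (((q.1.map (realPart v))ᵀ * t.map (realEmb v) * q.1.map (realPart v) +
        (q.1.map (realPart v))ᵀ * (r.map (realEmb v))ᵀ * lam.map (realPart v) *
          q.1.map (realPart v)).trace : ℝ)) *
    c₀ t r (Matrix.GeneralLinearGroup.map (toFin F) q) (lam.map (toFin F)) := rfl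
  rw [h, archFactor]
  ring

/-- `Ψ(-tr(S[λ]σ)) 𝐟((λ, m - λσ, 0) [[q, σ q̃], [0, q̃]])`: as a function of `(σ, m)` it is a Fourier
series without quadratic phases. -/
def normalizedForm (S : Matrix (Fin l) (Fin l) F) (f : JacobiGroup n l (AdeleRing (𝓞 F) F) → ℂ)
    (q : GL (Fin n) (AdeleRing (𝓞 F) F)) (lam : Matrix (Fin l) (Fin n) (AdeleRing (𝓞 F) F))
    (σ : Matrix (Fin n) (Fin n) (AdeleRing (𝓞 F) F)) (hσ : σ.IsSymm)
    (m : Matrix (Fin l) (Fin n) (AdeleRing (𝓞 F) F)) : ℂ :=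
  psi (-(lamᵀ * toAdele S * lam * σ).trace) * f (siegelElt lam (m - lam * σ) q σ hσ)

theorem siegelElt_congr {R : Type*} [CommRing R] {lam lam' mu mu' : Matrix (Fin l) (Fin n) R}
    {q q' : GL (Fin n) R} {σ σ' : Matrix (Fin n) (Fin n) R} {hσ : σ.IsSymm} {hσ' : σ'.IsSymm}
    (h1 : lam = lam') (h2 : mu = mu') (h3 : q = q') (h4 : σ = σ') :
    siegelElt lam mu q σ hσ = siegelElt lam' mu' q' σ' hσ' := by
  subst h1 h2 h3 h4; rfl

theorem normalizedForm_congr {S : Matrix (Fin l) (Fin l) F}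
    {f : JacobiGroup n l (AdeleRing (𝓞 F) F) → ℂ}
    {q q' : GL (Fin n) (AdeleRing (𝓞 F) F)}
    {lam lam' m m' : Matrix (Fin l) (Fin n) (AdeleRing (𝓞 F) F)}
    {σ σ' : Matrix (Fin n) (Fin n) (AdeleRing (𝓞 F) F)} {hσ : σ.IsSymm} {hσ' : σ'.IsSymm}
    (h1 : q = q') (h2 : lam = lam') (h3 : σ = σ') (h4 : m = m') :
    normalizedForm S f q lam σ hσ m = normalizedForm S f q' lam' σ' hσ' m' := by
  subst h1 h2 h3 h4; rfl

theorem apply_siegelElt (S : Matrix (Fin l) (Fin l) F)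
    (f : JacobiGroup n l (AdeleRing (𝓞 F) F) → ℂ)
    (q : GL (Fin n) (AdeleRing (𝓞 F) F)) (lam mu : Matrix (Fin l) (Fin n) (AdeleRing (𝓞 F) F))
    (σ : Matrix (Fin n) (Fin n) (AdeleRing (𝓞 F) F)) (hσ : σ.IsSymm) :
    f (siegelElt lam mu q σ hσ) = psi (lamᵀ * toAdele S * lam * σ).trace *
      normalizedForm S f q lam σ hσ (mu + lam * σ) := by
  rw [normalizedForm, ← mul_assoc, ← psi_add, add_neg_cancel, psi_zero, one_mul]
  congr 1
  exact siegelElt_congr rfl (add_sub_cancel_right _ _).symm rfl rfl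

variable {b : FractionalIdeal (𝓞 F)⁰ F} {c : Ideal (𝓞 F)}
  {k : InfinitePlace F → ℤ} {S : Matrix (Fin l) (Fin l) F}
  {χ : (AdeleRing (𝓞 F) F)ˣ →* ℂˣ} {f : JacobiGroup n l (AdeleRing (𝓞 F) F) → ℂ}

theorem isSymm_mul_mul_transpose {R m p : Type*} [CommRing R] [Fintype p] {σ : Matrix p p R}
    (hσ : σ.IsSymm) (A : Matrix m p R) : (A * σ * Aᵀ).IsSymm := by
  rw [Matrix.IsSymm, Matrix.transpose_mul, Matrix.transpose_mul, hσ.eq, Matrix.transpose_transpose,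
    Matrix.mul_assoc]

/-- Invariance under rational translations: `(0, m', 0) [[1, σ'], [0, 1]]` on the left produces the
central element `-λσ'ᵗλ`, whose phase cancels the change of `Ψ(-tr(S[λ]σ))`. -/
theorem IsAdelicSiegelJacobiForm.normalizedForm_add_rational
    (hf : IsAdelicSiegelJacobiForm b c (level n l b c) k S χ f)
    (q : GL (Fin n) (AdeleRing (𝓞 F) F)) (lam : Matrix (Fin l) (Fin n) (AdeleRing (𝓞 F) F))
    (σ : Matrix (Fin n) (Fin n) (AdeleRing (𝓞 F) F)) (hσ : σ.IsSymm)
    (m : Matrix (Fin l) (Fin n) (AdeleRing (𝓞 F) F)) {σ' : Matrix (Fin n) (Fin n) F}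
    (hσ' : σ'.IsSymm) (m' : Matrix (Fin l) (Fin n) F) :
    normalizedForm S f q lam (σ + toAdele σ') (hσ.add (hσ'.map _)) (m + toAdele m') =
      normalizedForm S f q lam σ hσ m := by
  have hκ : (-(lam * toAdele σ' * lamᵀ)).IsSymm :=
    (isSymm_mul_mul_transpose (hσ'.map _) lam).neg
  have h1 := hf.map_mul (siegelElt 0 m' 1 σ' hσ') (siegelElt lam (m - lam * σ) q σ hσ)
  have h2 : (siegelElt (l := l) 0 m' 1 σ' hσ').map (algebraMap F (AdeleRing (𝓞 F) F)) =
      siegelElt 0 (toAdele m') 1 (toAdele σ') (hσ'.map _) := by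
    rw [map_siegelElt]
    exact siegelElt_congr (Matrix.map_zero _ (_root_.map_zero _)) rfl (_root_.map_one _) rfl
  rw [h2, unipotent_mul_siegelElt _ _ _ _ _ _ hσ (hσ'.map _) hκ, hf.central_mul] at h1
  have h3 : (lamᵀ * toAdele S * lam * toAdele σ').trace =
      (toAdele S * (lam * toAdele σ' * lamᵀ)).trace := by
    rw [Matrix.mul_assoc, Matrix.mul_assoc, Matrix.trace_mul_comm]
    simp only [Matrix.mul_assoc]
  rw [normalizedForm, normalizedForm, ← h1, Matrix.mul_add, Matrix.trace_add, neg_add, psi_add,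
    mul_assoc, h3, Matrix.mul_neg, Matrix.trace_neg]
  congr 3
  exact siegelElt_congr rfl (by rw [Matrix.mul_add]; abel) rfl rfl

/-- Invariance under those finite adelic translations coming from the level for which the
quadratic phases are trivial. -/
theorem IsAdelicSiegelJacobiForm.normalizedForm_add_fin
    (hf : IsAdelicSiegelJacobiForm b c (level n l b c) k S χ f)
    (q : GL (Fin n) (AdeleRing (𝓞 F) F)) (lam : Matrix (Fin l) (Fin n) (AdeleRing (𝓞 F) F))
    (σ : Matrix (Fin n) (Fin n) (AdeleRing (𝓞 F) F)) (hσ : σ.IsSymm)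
    (m : Matrix (Fin l) (Fin n) (AdeleRing (𝓞 F) F))
    {σ' : Matrix (Fin n) (Fin n) (AdeleRing (𝓞 F) F)} (hσ' : σ'.IsSymm)
    {m' : Matrix (Fin l) (Fin n) (AdeleRing (𝓞 F) F)}
    (ha : σ'.map (toArch F) = 0) (ha' : m'.map (toArch F) = 0)
    (hb : MatHat b⁻¹ (σ'.map (toFin F))) (hb' : MatHat b⁻¹ (m'.map (toFin F)))
    (h1 : psi (lamᵀ * toAdele S * lam * (q.1 * σ' * q.1ᵀ)).trace = 1)
    (h2 : psi (toAdele S * (lam * q.1 * m'ᵀ + (lam * q.1 * m'ᵀ)ᵀ)).trace = 1) :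
    normalizedForm S f q lam (σ + q.1 * σ' * q.1ᵀ) (hσ.add (isSymm_mul_mul_transpose hσ' _))
        (m + m' * q.1ᵀ + lam * (q.1 * σ' * q.1ᵀ)) =
      normalizedForm S f q lam σ hσ m := by
  have hκ : (lam * q.1 * m'ᵀ + (lam * q.1 * m'ᵀ)ᵀ).IsSymm :=
    Matrix.isSymm_add_transpose_self _
  have hw : (siegelElt 0 m' 1 σ' hσ').g.1 = Matrix.fromBlocks 1 σ' 0 1 := by
    simp [siegelElt]
  have h3 := hf.mul_fin (y := siegelElt lam (m - lam * σ) q σ hσ)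
    (w := siegelElt 0 m' 1 σ' hσ') ?_ ?_ ?_
  · rw [siegelElt_mul_unipotent _ _ _ _ _ _ hσ hσ' hκ (hσ.add (isSymm_mul_mul_transpose hσ' _)),
      hf.central_mul, h2, one_mul] at h3
    rw [normalizedForm, normalizedForm, ← h3, Matrix.mul_add, Matrix.trace_add, neg_add, psi_add,
      psi_neg (lamᵀ * toAdele S * lam * (q.1 * σ' * q.1ᵀ)).trace, h1, inv_one, mul_one]
    congr 2
    exact siegelElt_congr rfl (by rw [Matrix.mul_add]; abel) rfl rfl
  · rw [map_siegelElt]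
    have h4 : (1 : JacobiGroup n l (InfiniteAdeleRing F)) =
        siegelElt 0 0 1 0 Matrix.isSymm_zero := by
      apply JacobiGroup.ext
      · rfl
      · rfl
      · rfl
      · apply Subtype.ext
        have : (1 : JacobiGroup n l (InfiniteAdeleRing F)).g.1 = 1 := rfl
        rw [this]
        simp [siegelElt]
    rw [h4]
    exact siegelElt_congr (Matrix.map_zero _ (_root_.map_zero _)) ha' (_root_.map_one _) ha
  · have h0 : ∀ {s p : Type} {I : FractionalIdeal (𝓞 F)⁰ F},
        MatHat I ((0 : Matrix s p (AdeleRing (𝓞 F) F)).map (toFin F)) := by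
      intro s p I
      rw [Matrix.map_zero _ (_root_.map_zero _)]
      exact MatHat.zero
    have h1' : MatHat 1 ((1 : Matrix (Fin n) (Fin n) (AdeleRing (𝓞 F) F)).map (toFin F)) := by
      rw [Matrix.map_one _ (_root_.map_zero _) (_root_.map_one _)]
      exact MatHat.one
    have h4 : ((siegelElt 0 m' 1 σ' hσ').map (toFin F)).g.1 = Matrix.fromBlocks
        ((1 : Matrix (Fin n) (Fin n) (AdeleRing (𝓞 F) F)).map (toFin F)) (σ'.map (toFin F))
        ((0 : Matrix (Fin n) (Fin n) (AdeleRing (𝓞 F) F)).map (toFin F))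
        ((1 : Matrix (Fin n) (Fin n) (AdeleRing (𝓞 F) F)).map (toFin F)) := by
      change (siegelElt 0 m' 1 σ' hσ').g.1.map _ = _
      rw [hw, Matrix.fromBlocks_map]
    refine ⟨h0, hb', h0, ?_⟩
    rw [h4]
    exact ⟨h1', hb, h0, h1'⟩
  · rw [hw, Matrix.toBlocks_fromBlocks₁₁]

end

/-! ### The expansion at the archimedean places -/

section
variable {F : Type*} [Field F] [NumberField F] {n l : ℕ}

theorem siegelElt_eq_ofParts (lam mu : Matrix (Fin l) (Fin n) (AdeleRing (𝓞 F) F))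
    (q : GL (Fin n) (AdeleRing (𝓞 F) F)) (σ : Matrix (Fin n) (Fin n) (AdeleRing (𝓞 F) F))
    (hσ : σ.IsSymm) (hmu : mu.map (toFin F) = 0) (hs : σ.map (toFin F) = 0) :
    siegelElt lam mu q σ hσ =
      ofParts 1 (siegelElt (lam.map (toFin F)) 0 (Matrix.GeneralLinearGroup.map (toFin F) q) 0
        Matrix.isSymm_zero) * ofParts ((siegelElt lam mu q σ hσ).map (toArch F)) 1 := by
  rw [ofParts_mul_ofParts]
  apply jacobi_ext_parts
  · rw [map_toArch_ofParts]
  · rw [map_toFin_ofParts, map_siegelElt]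
    exact siegelElt_congr rfl hmu rfl hs

variable [IsTotallyReal F]

theorem map_map_siegelElt (v : InfinitePlace F) (lam mu : Matrix (Fin l) (Fin n) (AdeleRing (𝓞 F) F))
    (q : GL (Fin n) (AdeleRing (𝓞 F) F)) (σ : Matrix (Fin n) (Fin n) (AdeleRing (𝓞 F) F))
    (hσ : σ.IsSymm) :
    ((siegelElt lam mu q σ hσ).map (toArch F)).map (realAt v) =
      siegelElt (lam.map (realPart v)) (mu.map (realPart v))
        (Matrix.GeneralLinearGroup.map (realPart v) q) (σ.map (realPart v)) (hσ.map _) :=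
  map_siegelElt (realPart v) lam mu q σ hσ

/-- The archimedean factors of one term of the Fourier expansion, multiplied together. -/
theorem fourier_term_eq (k : InfinitePlace F → ℤ) (S : Matrix (Fin l) (Fin l) F)
    (q : GL (Fin n) (AdeleRing (𝓞 F) F)) (lam m : Matrix (Fin l) (Fin n) (AdeleRing (𝓞 F) F))
    (σ : Matrix (Fin n) (Fin n) (AdeleRing (𝓞 F) F)) (hσ : σ.IsSymm)
    (hs : σ.map (toFin F) = 0) (hm : m.map (toFin F) = 0)
    (p : Matrix (Fin n) (Fin n) F × Matrix (Fin l) (Fin n) F) (a : ℂ) :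
    let y := (siegelElt lam (m - lam * σ) q σ hσ).map (toArch F)
    psi (-(lamᵀ * toAdele S * lam * σ).trace) * ((autFactor k S y (basePoint F n l))⁻¹ *
      (a * expArch (fun v => (toC (p.1.map (realEmb v)) *
          (act y (basePoint F n l) v).1).trace) *
        expArch (fun v => ((toC (p.2.map (realEmb v)))ᵀ * (act y (basePoint F n l) v).2).trace))) =
      a * archFactor k S q lam p * fourierChar p (σ, m) := by
  intro y
  have hq : ∀ v : InfinitePlace F,
    (Matrix.GeneralLinearGroup.map (realPart v) q).1 = q.1.map (realPart v) := fun _ => rfl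
  have hy : ∀ v, y.map (realAt v) = _ := fun v => map_map_siegelElt v lam (m - lam * σ) q σ hσ
  have hact : ∀ v, act y (basePoint F n l) v = locAct (y.map (realAt v)) (Complex.I • 1, 0) :=
    fun _ => rfl
  have hv := fun v : InfinitePlace F =>
    local_fourier_term (k v) (S.map (realEmb v)) (lam.map (realPart v))
      ((m - lam * σ).map (realPart v)) (p.2.map (realEmb v))
      (Matrix.GeneralLinearGroup.map (realPart v) q) (σ.map (realPart v)) (p.1.map (realEmb v))
      (hσ.map _)
  have hprod := Finset.prod_congr (rfl : (Finset.univ : Finset (InfinitePlace F)) = _)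
    fun v _ => hv v
  simp only [Finset.prod_mul_distrib] at hprod
  have hmm : ∀ v : InfinitePlace F, (m - lam * σ).map (realPart v) +
      lam.map (realPart v) * σ.map (realPart v) = m.map (realPart v) := by
    intro v
    rw [← Matrix.map_mul, ← Matrix.map_add _ (map_add _), sub_add_cancel]
  simp only [hmm] at hprod
  have e1 : psi (lamᵀ * toAdele S * lam * σ).trace = ∏ v, expC
      (((lam.map (realPart v))ᵀ * S.map (realEmb v) * lam.map (realPart v) *
        σ.map (realPart v)).trace : ℝ) := by
    rw [psi_of_toFin_eq_zero]
    · simp only [realPart_trace, Matrix.map_mul, map_realPart_toAdele, ← Matrix.transpose_map]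
    · rw [trace_map_toFin, Matrix.map_mul, hs, Matrix.mul_zero, Matrix.trace_zero]
  have e2 : psi (toAdele p.1 * σ).trace = ∏ v, expC
      ((p.1.map (realEmb v) * σ.map (realPart v)).trace : ℝ) := by
    rw [psi_of_toFin_eq_zero]
    · simp only [realPart_trace, Matrix.map_mul, map_realPart_toAdele]
    · rw [trace_map_toFin, Matrix.map_mul, hs, Matrix.mul_zero, Matrix.trace_zero]
  have e3 : psi ((toAdele p.2)ᵀ * m).trace = ∏ v, expC
      (((p.2.map (realEmb v))ᵀ * m.map (realPart v)).trace : ℝ) := by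
    rw [psi_of_toFin_eq_zero]
    · simp only [realPart_trace, Matrix.map_mul, map_realPart_toAdele, ← Matrix.transpose_map]
    · rw [trace_map_toFin, Matrix.map_mul, hm, Matrix.mul_zero, Matrix.trace_zero]
  rw [← e1, ← e2, ← e3, Finset.prod_inv_distrib] at hprod
  simp only [hq] at hprod
  simp only [autFactor, basePoint, hact, hy, locAct_siegelElt, hq, expArch, archFactor, psi_neg,
    fourierChar]
  rw [inv_mul_eq_iff_eq_mul₀ (psi_ne_zero _)]
  linear_combination a * hprod

/-- The Fourier expansion for translations supported at the archimedean places, with coefficients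
depending only on `q_𝐡` and `λ_𝐡`. -/
theorem IsAdelicSiegelJacobiForm.exists_arch_expansion
    {b : FractionalIdeal (𝓞 F)⁰ F} {c : Ideal (𝓞 F)}
    {k : InfinitePlace F → ℤ} {S : Matrix (Fin l) (Fin l) F}
    {χ : (AdeleRing (𝓞 F) F)ˣ →* ℂˣ} {f : JacobiGroup n l (AdeleRing (𝓞 F) F) → ℂ}
    (hf : IsAdelicSiegelJacobiForm b c (level n l b c) k S χ f)
    (qh : GL (Fin n) (FiniteAdeleRing (𝓞 F) F))
    (lamh : Matrix (Fin l) (Fin n) (FiniteAdeleRing (𝓞 F) F)) :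
    ∃ (L : Submodule ℤ (Matrix (Fin n) (Fin n) F)) (M : Submodule ℤ (Matrix (Fin l) (Fin n) F))
      (a : Matrix (Fin n) (Fin n) F → Matrix (Fin l) (Fin n) F → ℂ),
      IsLatticeIn {t : Matrix (Fin n) (Fin n) F | t.IsSymm} L ∧
      IsLatticeIn (Set.univ : Set (Matrix (Fin l) (Fin n) F)) M ∧
      (∀ t r, a t r ≠ 0 → t ∈ L ∧ TotNonneg t ∧ r ∈ M) ∧
      ∀ (q : GL (Fin n) (AdeleRing (𝓞 F) F)) (lam : Matrix (Fin l) (Fin n) (AdeleRing (𝓞 F) F)),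
        Matrix.GeneralLinearGroup.map (toFin F) q = qh → lam.map (toFin F) = lamh →
        ∀ (σ : Matrix (Fin n) (Fin n) (AdeleRing (𝓞 F) F)) (hσ : σ.IsSymm)
          (m : Matrix (Fin l) (Fin n) (AdeleRing (𝓞 F) F)),
          σ.map (toFin F) = 0 → m.map (toFin F) = 0 →
          HasSum (fun p => a p.1 p.2 * archFactor k S q lam p * fourierChar p (σ, m))
            (normalizedForm S f q lam σ hσ m) := by
  classical
  obtain ⟨fg, ε, hfg, hform⟩ := hf.classical (siegelElt lamh 0 qh 0 Matrix.isSymm_zero)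
  obtain ⟨L, M, a, hL, hM, hfour⟩ := hform.fourier 1
  have h1 : (JacobiGroup.ofSp 1 : JacobiGroup n l F) = 1 := rfl
  rw [h1, map_one_jacobi, slash_one] at hfour
  refine ⟨L, M, fun t r => if t ∈ L ∧ TotNonneg t ∧ r ∈ M then a t r else 0, hL, hM, ?_, ?_⟩
  · intro t r h
    by_contra h'
    exact h (if_neg h')
  rintro q lam rfl rfl σ hσ m hs hm
  set y := (siegelElt lam (m - lam * σ) q σ hσ).map (toArch F) with hy
  have hmu : (m - lam * σ).map (toFin F) = 0 := by
    rw [Matrix.map_sub _ (map_sub _), Matrix.map_mul, hs, hm, Matrix.mul_zero, sub_zero]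
  have hz : act y (basePoint F n l) ∈ upperSpace F n l := by
    intro v
    have hv : act y (basePoint F n l) v = _ :=
      (congrArg (fun x => locAct x (basePoint F n l v)) (map_map_siegelElt v _ _ _ _ _)).trans
        (locAct_siegelElt _ _ _ _ _)
    rw [hv]
    exact siegelPoint_mem (Matrix.GeneralLinearGroup.map (realPart v) q) (hσ.map _)
  have hsum := ((hfour _ hz).mul_left (autFactor k S y (basePoint F n l))⁻¹).mul_left
    (psi (-(lamᵀ * toAdele S * lam * σ).trace))
  have hval : psi (-(lamᵀ * toAdele S * lam * σ).trace) *
      ((autFactor k S y (basePoint F n l))⁻¹ * fg (act y (basePoint F n l))) =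
      normalizedForm S f q lam σ hσ m := by
    rw [normalizedForm, siegelElt_eq_ofParts lam _ q σ hσ hmu hs, ← hfg]
    rfl
  rw [hval] at hsum
  let i : {t : Matrix (Fin n) (Fin n) F // t ∈ L ∧ TotNonneg t} × M →
    Matrix (Fin n) (Fin n) F × Matrix (Fin l) (Fin n) F := fun p => (p.1.1, p.2.1)
  have hi : Function.Injective i := by
    rintro ⟨⟨t, ht⟩, ⟨r, hr⟩⟩ ⟨⟨t', ht'⟩, ⟨r', hr'⟩⟩ h
    obtain ⟨h1, h2⟩ := Prod.mk.inj h
    subst h1 h2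
    rfl
  refine (hi.hasSum_iff ?_).1 (hsum.congr_fun fun p => ?_)
  · intro p hp
    have h0 : ¬ (p.1 ∈ L ∧ TotNonneg p.1 ∧ p.2 ∈ M) := fun ⟨h1, h2, h3⟩ =>
      hp ⟨(⟨p.1, h1, h2⟩, ⟨p.2, h3⟩), rfl⟩
    simp only [if_neg h0, zero_mul]
  · have h0 : (p.1.1 ∈ L ∧ TotNonneg p.1.1 ∧ p.2.1 ∈ M) := ⟨p.1.2.1, p.1.2.2, p.2.2⟩
    simp only [Function.comp_apply, i, if_pos h0]
    exact (fourier_term_eq k S q lam m σ hσ hs hm (i p) _).symm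

end

/-! ### Lattices in matrices over the finite adeles -/

section
variable {F : Type*} [Field F] [NumberField F] {m p : Type*}

theorem mem_locIdeal_of_valued_le (v : HeightOneSpectrum (𝓞 F)) {I : FractionalIdeal (𝓞 F)⁰ F}
    {a : F} (ha : a ∈ I) {x : v.adicCompletion F}
    (hx : Valued.v x ≤ Valued.v (algebraMap F (v.adicCompletion F) a)) : x ∈ locIdeal v I := by
  have h0 : algebraMap F (v.adicCompletion F) a ∈ locIdeal v I := Submodule.subset_span ⟨a, ha, rfl⟩
  by_cases h : a = 0
  · rw [h, map_zero, map_zero, le_zero_iff, map_eq_zero] at hx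
    rw [hx]; exact zero_mem _
  have ha' : algebraMap F (v.adicCompletion F) a ≠ 0 := (map_ne_zero _).2 h
  have h1 : x / algebraMap F (v.adicCompletion F) a ∈ v.adicCompletionIntegers F := by
    rw [HeightOneSpectrum.mem_adicCompletionIntegers, map_div₀]
    exact div_le_one_of_le₀ hx zero_le
  have h2 := (locIdeal v I).smul_mem ⟨_, h1⟩ h0
  rwa [show (⟨_, h1⟩ : v.adicCompletionIntegers F) • algebraMap F (v.adicCompletion F) a = x from
    div_mul_cancel₀ x ha'] at h2

theorem exists_fractionalIdeal_forall_mem_locIdeal (x : FiniteAdeleRing (𝓞 F) F) :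
    ∃ J : FractionalIdeal (𝓞 F)⁰ F, ∀ v, x v ∈ locIdeal v J := by
  obtain ⟨d, hd, hdx⟩ := exists_int_mul_integral x
  have hd' : (d : F) ≠ 0 := by exact_mod_cast hd
  refine ⟨FractionalIdeal.spanSingleton _ (d : F)⁻¹, fun v => ?_⟩
  refine mem_locIdeal_of_valued_le v (FractionalIdeal.mem_spanSingleton_self _ _) ?_
  have h := hdx v
  have h0 : Valued.v (algebraMap F (v.adicCompletion F) (d : F)) ≠ 0 := by
    rw [ne_eq, map_eq_zero, map_eq_zero]; exact hd'
  rw [map_mul] at h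
  rw [map_inv₀, map_inv₀]
  exact (le_inv_mul_iff₀ (zero_lt_iff.2 h0)).2 h |>.trans_eq (mul_one _)

/-- The entries of an adelic matrix have a common denominator. -/
theorem exists_matHat [Finite m] [Finite p] (A : Matrix m p (FiniteAdeleRing (𝓞 F) F)) :
    ∃ J : FractionalIdeal (𝓞 F)⁰ F, MatHat J A := by
  choose J hJ using fun ij : m × p => exists_fractionalIdeal_forall_mem_locIdeal (A ij.1 ij.2)
  obtain ⟨J₀, h⟩ := Finite.exists_le J
  exact ⟨J₀, fun v i j => locIdeal_mono v (h (i, j)) (hJ (i, j) v)⟩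

theorem exists_rational_matHat (A : Matrix m p (FiniteAdeleRing (𝓞 F) F))
    {I : FractionalIdeal (𝓞 F)⁰ F} (hI : I ≠ 0) :
    ∃ B : Matrix m p F, MatHat I (A - (toAdele B).map (toFin F)) := by
  obtain ⟨M, hM, hMI⟩ := FractionalIdeal.exists_ne_zero_mem_isInteger hI
  choose B hB using fun i j => exists_algebraMap_sub_small (A i j) hM
  refine ⟨Matrix.of B, fun v i j => ?_⟩
  refine mem_locIdeal_of_valued_le v hMI ?_
  exact (Valuation.map_sub_swap _ _ _).trans_le (hB i j v)

theorem exists_rational_symm_matHat {n : ℕ} {A : Matrix (Fin n) (Fin n) (FiniteAdeleRing (𝓞 F) F)}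
    (hA : A.IsSymm) {I : FractionalIdeal (𝓞 F)⁰ F} (hI : I ≠ 0) :
    ∃ B : Matrix (Fin n) (Fin n) F, B.IsSymm ∧ MatHat I (A - (toAdele B).map (toFin F)) := by
  obtain ⟨B, hB⟩ := exists_rational_matHat A hI
  refine ⟨Matrix.of fun i j => if i ≤ j then B i j else B j i, ?_, fun v i j => ?_⟩
  · ext i j
    rcases lt_trichotomy i j with h | h | h
    · simp [h.le, h.not_ge]
    · simp [h]
    · simp [h.le, h.not_ge]
  · by_cases h : i ≤ j
    · have := hB v i j
      simpa [h] using this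
    · have := hB v j i
      rw [Matrix.sub_apply, hA.apply] at this
      simpa [h] using this

end

section
variable {F : Type*} [Field F] [NumberField F] {m p : Type*}

/-- An adelic matrix supported at the finite places. -/
def finMat (B : Matrix m p (FiniteAdeleRing (𝓞 F) F)) : Matrix m p (AdeleRing (𝓞 F) F) :=
  archFin 0 B

/-- The archimedean part of an adelic matrix, extended by zero. -/
def archPart (A : Matrix m p (AdeleRing (𝓞 F) F)) : Matrix m p (AdeleRing (𝓞 F) F) :=
  archFin (A.map (toArch F)) 0

theorem finMat_toArch (B : Matrix m p (FiniteAdeleRing (𝓞 F) F)) :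
    (finMat B).map (toArch F) = 0 := rfl

theorem finMat_toFin (B : Matrix m p (FiniteAdeleRing (𝓞 F) F)) : (finMat B).map (toFin F) = B :=
  rfl

theorem archPart_toFin (A : Matrix m p (AdeleRing (𝓞 F) F)) : (archPart A).map (toFin F) = 0 := rfl

theorem archPart_add_finMat (A : Matrix m p (AdeleRing (𝓞 F) F)) :
    archPart A + finMat (A.map (toFin F)) = A := by
  ext i j
  exact Prod.ext (add_zero _) (zero_add _)

theorem finMat_add {m p : Type*} (A B : Matrix m p (FiniteAdeleRing (𝓞 F) F)) :
    finMat (A + B) = finMat A + finMat B := by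
  ext i j
  exact Prod.ext (add_zero _).symm rfl

theorem finMat_isSymm {B : Matrix m m (FiniteAdeleRing (𝓞 F) F)} (hB : B.IsSymm) :
    (finMat B).IsSymm := archFin_ext rfl hB

theorem archPart_isSymm {A : Matrix m m (AdeleRing (𝓞 F) F)} (hA : A.IsSymm) :
    (archPart A).IsSymm := archFin_ext (hA.map (toArch F)) rfl

theorem trace_map_toArch {s : ℕ} (A : Matrix (Fin s) (Fin s) (AdeleRing (𝓞 F) F)) :
    toArch F A.trace = (A.map (toArch F)).trace :=
  AddMonoidHom.map_trace (toArch F) A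

variable [IsTotallyReal F]

theorem psi_trace_of_toArch_eq_zero {s : ℕ} {A : Matrix (Fin s) (Fin s) (AdeleRing (𝓞 F) F)}
    (ha : A.map (toArch F) = 0) : psi A.trace = psiFin (A.map (toFin F)).trace := by
  rw [psi, trace_map_toArch, ha, Matrix.trace_zero, trace_map_toFin]
  have : (expArch fun v : InfinitePlace F => ((realAt v 0 : ℝ) : ℂ)) = 1 := by
    refine Eq.trans (congrArg expArch (funext fun v => ?_)) expArch_zero
    rw [map_zero, Complex.ofReal_zero, Pi.zero_apply]
  rw [this, one_mul]

theorem psi_trace_eq_one {s : ℕ} {A : Matrix (Fin s) (Fin s) (AdeleRing (𝓞 F) F)}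
    (ha : A.map (toArch F) = 0) (hA : MatHat (invDifferent F) (A.map (toFin F))) :
    psi A.trace = 1 := by
  rw [psi_trace_of_toArch_eq_zero ha]
  refine psiFin_eq_one fun v => psiLocal_eq_one_of_mem v ?_
  have h : (A.map (toFin F)).trace v = ∑ i, (A.map (toFin F)) i i v := map_sum (finEval v) _ _
  rw [h]
  exact sum_mem fun i _ => hA v i i

end

/-! ### The expansion at all places -/

section
variable {F : Type*} [Field F] [NumberField F] {n l : ℕ}

theorem archPart_mem (σ : Matrix (Fin n) (Fin n) (AdeleRing (𝓞 F) F)) (hσ : σ.IsSymm)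
    (m : Matrix (Fin l) (Fin n) (AdeleRing (𝓞 F) F)) :
    (archPart σ, archPart m) ∈ archTranslations F n l :=
  ⟨archPart_isSymm hσ, archPart_toFin _, archPart_toFin _⟩

variable [IsTotallyReal F]

theorem fourierChar_rational (p : Matrix (Fin n) (Fin n) F × Matrix (Fin l) (Fin n) F)
    (s : Matrix (Fin n) (Fin n) F) (m : Matrix (Fin l) (Fin n) F) :
    fourierChar p (toAdele s, toAdele m) = 1 := by
  have h : ∀ A : Matrix (Fin n) (Fin n) F, psi (toAdele A).trace = 1 := by
    intro A
    have : (toAdele A).trace = algebraMap F (AdeleRing (𝓞 F) F) A.trace :=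
      (AddMonoidHom.map_trace (algebraMap F (AdeleRing (𝓞 F) F)) A).symm
    rw [this, psi_algebraMap]
  rw [fourierChar, ← Matrix.map_mul, ← Matrix.transpose_map, ← Matrix.map_mul, h, h, mul_one]

/-- If the series is invariant under translation by `u`, only characters trivial at `u` occur. -/
theorem fourierChar_eq_one_of_invariant
    {C : Matrix (Fin n) (Fin n) F × Matrix (Fin l) (Fin n) F → ℂ}
    (hC : ∀ p, C p ≠ 0 → p.1.IsSymm)
    {u : Matrix (Fin n) (Fin n) (AdeleRing (𝓞 F) F) × Matrix (Fin l) (Fin n) (AdeleRing (𝓞 F) F)}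
    (h : ∀ x ∈ archTranslations F n l, ∃ y, HasSum (fun p => C p * fourierChar p x) y ∧
      HasSum (fun p => C p * fourierChar p (x + u)) y)
    {p : Matrix (Fin n) (Fin n) F × Matrix (Fin l) (Fin n) F} (hp : C p ≠ 0) :
    fourierChar p u = 1 := by
  have h1 := fourier_coeff_eq (C := C) (D := fun p => C p * fourierChar p u) hC
    (fun p hp => hC p (left_ne_zero_of_mul hp)) (g := fun x => ∑' p, C p * fourierChar p x)
    (fun x hx => by
      obtain ⟨y, hy, -⟩ := h x hx
      exact hy.summable.hasSum)
    (fun x hx => by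
      obtain ⟨y, hy, hy'⟩ := h x hx
      rw [hy.tsum_eq]
      exact hy'.congr_fun fun p => by rw [fourierChar_add]; ring)
  have h2 : C p * 1 = C p * fourierChar p u := by
    rw [mul_one]; exact congrFun h1 p
  exact (mul_left_cancel₀ hp h2).symm

variable {b : FractionalIdeal (𝓞 F)⁰ F} {c : Ideal (𝓞 F)}
  {k : InfinitePlace F → ℤ} {S : Matrix (Fin l) (Fin l) F}
  {χ : (AdeleRing (𝓞 F) F)ˣ →* ℂˣ} {f : JacobiGroup n l (AdeleRing (𝓞 F) F) → ℂ}

/-- Invariance under finite adelic translations by a sufficiently small lattice. -/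
theorem IsAdelicSiegelJacobiForm.exists_invariant_lattice
    (hf : IsAdelicSiegelJacobiForm b c (level n l b c) k S χ f) (hb : b ≠ 0)
    (q : GL (Fin n) (AdeleRing (𝓞 F) F)) (lam : Matrix (Fin l) (Fin n) (AdeleRing (𝓞 F) F)) :
    ∃ I : FractionalIdeal (𝓞 F)⁰ F, I ≠ 0 ∧ I ≤ 1 ∧
      ∀ (σ : Matrix (Fin n) (Fin n) (AdeleRing (𝓞 F) F)) (hσ : σ.IsSymm)
        (m : Matrix (Fin l) (Fin n) (AdeleRing (𝓞 F) F))
        (σ₁ : Matrix (Fin n) (Fin n) (FiniteAdeleRing (𝓞 F) F)) (hσ₁ : σ₁.IsSymm)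
        (m₁ : Matrix (Fin l) (Fin n) (FiniteAdeleRing (𝓞 F) F)),
        MatHat I σ₁ → MatHat I m₁ →
        normalizedForm S f q lam (σ + finMat σ₁) (hσ.add (finMat_isSymm hσ₁)) (m + finMat m₁) =
          normalizedForm S f q lam σ hσ m := by
  obtain ⟨J₁, hJ₁⟩ := exists_matHat ((q⁻¹).1.map (toFin F))
  obtain ⟨J₂, hJ₂⟩ := exists_matHat (lam.map (toFin F))
  obtain ⟨J₃, hJ₃⟩ := exists_matHat ((toAdele S).map (toFin F))
  -- `J` is a common denominator of everything in sight, and `J⁻⁴` is small enough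
  set J := 1 ⊔ b ⊔ J₁ ⊔ J₂ ⊔ J₃ with hJ
  have h1J : 1 ≤ J := le_sup_left.trans (le_sup_left.trans (le_sup_left.trans le_sup_left))
  have hbJ : b ≤ J := le_sup_right.trans (le_sup_left.trans (le_sup_left.trans le_sup_left))
  replace hJ₁ := hJ₁.mono (le_sup_right.trans (le_sup_left.trans le_sup_left) : J₁ ≤ J)
  replace hJ₂ := hJ₂.mono (le_sup_right.trans le_sup_left : J₂ ≤ J)
  replace hJ₃ : MatHat J _ := hJ₃.mono (le_sup_right : J₃ ≤ J)
  have hJ0 : J ≠ 0 := fun h => one_ne_zero (le_zero_iff.1 (h1J.trans_eq h))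
  have hJJ : J * J⁻¹ = 1 := mul_inv_cancel₀ hJ0
  have hi1 : J⁻¹ ≤ 1 := by
    calc J⁻¹ = 1 * J⁻¹ := (one_mul _).symm
      _ ≤ J * J⁻¹ := by gcongr
      _ = 1 := hJJ
  have hib : J⁻¹ ≤ b⁻¹ := FractionalIdeal.inv_anti_mono hb hJ0 hbJ
  clear_value J
  have e1 : J * (J⁻¹ * J⁻¹ * J⁻¹ * J⁻¹) = J⁻¹ * J⁻¹ * J⁻¹ := by
    rw [← mul_assoc, ← mul_assoc, ← mul_assoc, hJJ, one_mul]
  have e2 : J * (J⁻¹ * J⁻¹ * J⁻¹) = J⁻¹ * J⁻¹ := by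
    rw [← mul_assoc, ← mul_assoc, hJJ, one_mul]
  have e3 : J * (J⁻¹ * J⁻¹) = J⁻¹ := by rw [← mul_assoc, hJJ, one_mul]
  have l2 : J⁻¹ * J⁻¹ ≤ J⁻¹ := by
    calc J⁻¹ * J⁻¹ ≤ J⁻¹ * 1 := by gcongr
      _ = J⁻¹ := mul_one _
  have l3 : J⁻¹ * J⁻¹ * J⁻¹ ≤ J⁻¹ * J⁻¹ := by
    calc J⁻¹ * J⁻¹ * J⁻¹ ≤ J⁻¹ * J⁻¹ * 1 := by gcongr
      _ = J⁻¹ * J⁻¹ := mul_one _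
  have l4 : J⁻¹ * J⁻¹ * J⁻¹ * J⁻¹ ≤ J⁻¹ * J⁻¹ * J⁻¹ := by
    calc J⁻¹ * J⁻¹ * J⁻¹ * J⁻¹ ≤ J⁻¹ * J⁻¹ * J⁻¹ * 1 := by gcongr
      _ = J⁻¹ * J⁻¹ * J⁻¹ := mul_one _
  refine ⟨J⁻¹ * J⁻¹ * J⁻¹ * J⁻¹, by simp [hJ0], ((l4.trans l3).trans l2).trans hi1, ?_⟩
  intro σ hσ m σ₁ hσ₁ m₁ hs hm
  set I := J⁻¹ * J⁻¹ * J⁻¹ * J⁻¹ with hI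
  -- `σ'` and `m'` solve `q σ' ᵗq = σ₁` and `m' ᵗq + λ σ₁ = m₁`
  let σ' := (q⁻¹).1 * finMat σ₁ * (q⁻¹).1ᵀ
  let m' := (finMat m₁ - lam * finMat σ₁) * (q⁻¹).1ᵀ
  have hσ' : σ'.IsSymm := isSymm_mul_mul_transpose (finMat_isSymm hσ₁) _
  have hq1 : q.1 * σ' * q.1ᵀ = finMat σ₁ := by
    simp only [σ', Matrix.mul_assoc, GL_inv_transpose_mul, Matrix.mul_one]
    rw [← Matrix.mul_assoc, GL_mul_inv, Matrix.one_mul]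
  have hq2 : m' * q.1ᵀ = finMat m₁ - lam * finMat σ₁ := by
    simp only [m', Matrix.mul_assoc, GL_inv_transpose_mul, Matrix.mul_one]
  have hX : lam * q.1 * m'ᵀ = lam * (finMat m₁ - lam * finMat σ₁)ᵀ := by
    rw [← hq2, Matrix.transpose_mul m' _, Matrix.transpose_transpose, Matrix.mul_assoc]
  have hd : MatHat (J⁻¹ * J⁻¹ * J⁻¹) (m₁ - lam.map (toFin F) * σ₁) :=
    (hm.mono l4).sub ((hJ₂.mul hs).mono e1.le)
  have hdm : (finMat m₁ - lam * finMat σ₁).map (toFin F) = m₁ - lam.map (toFin F) * σ₁ := by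
    rw [Matrix.map_sub _ (map_sub _), Matrix.map_mul, finMat_toFin, finMat_toFin]
  have hda : (finMat m₁ - lam * finMat σ₁).map (toArch F) = 0 := by
    rw [Matrix.map_sub _ (map_sub _), Matrix.map_mul, finMat_toArch, finMat_toArch, Matrix.mul_zero,
      sub_zero]
  have h := hf.normalizedForm_add_fin q lam σ hσ m hσ' (m' := m') ?_ ?_ ?_ ?_ ?_ ?_
  · refine (normalizedForm_congr rfl rfl ?_ ?_).trans h
    · rw [hq1]
    · rw [hq1, hq2]; abel
  · rw [Matrix.map_mul, Matrix.map_mul, finMat_toArch, Matrix.mul_zero, Matrix.zero_mul]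
  · rw [Matrix.map_mul, hda, Matrix.zero_mul]
  · rw [Matrix.map_mul, Matrix.map_mul, finMat_toFin]
    refine ((hJ₁.mul hs).mul hJ₁.transpose).mono ?_
    rw [e1, mul_comm, e2]
    exact l2.trans hib
  · rw [Matrix.map_mul, hdm]
    refine (hd.mul hJ₁.transpose).mono ?_
    rw [mul_comm, e2]
    exact l2.trans hib
  · rw [hq1]
    refine psi_trace_eq_one ?_ ?_
    · rw [Matrix.map_mul, finMat_toArch, Matrix.mul_zero]
    · rw [Matrix.map_mul, Matrix.map_mul, Matrix.map_mul, finMat_toFin]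
      refine MatHat.mono ?_ (((hJ₂.transpose.mul hJ₃).mul hJ₂).mul hs)
      rw [mul_assoc, mul_assoc, e1, e2, e3]
      exact hi1.trans one_le_invDifferent
  · rw [hX]
    have h0 : MatHat (J⁻¹ * J⁻¹)
        ((lam * (finMat m₁ - lam * finMat σ₁)ᵀ).map (toFin F)) := by
      rw [Matrix.map_mul, Matrix.transpose_map, hdm]
      exact (hJ₂.mul hd.transpose).mono e2.le
    refine psi_trace_eq_one ?_ ?_
    · rw [Matrix.map_mul, Matrix.map_add _ (map_add _), Matrix.transpose_map, Matrix.map_mul,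
        Matrix.transpose_map, hda]
      simp
    · rw [Matrix.map_mul, Matrix.map_add _ (map_add _), Matrix.transpose_map]
      refine (hJ₃.mul (h0.add h0.transpose)).mono ?_
      rw [e3]
      exact hi1.trans one_le_invDifferent

/-- A character with index in `J` is trivial on the finite translations by `I ⊆ J⁻¹`. -/
theorem matHat_trace_char {I : FractionalIdeal (𝓞 F)⁰ F} {J : FractionalIdeal (𝓞 F)⁰ F}
    (hIJ : J * I ≤ 1)
    (p : Matrix (Fin n) (Fin n) F × Matrix (Fin l) (Fin n) F)
    (hp1 : MatHat J ((toAdele p.1).map (toFin F))) (hp2 : MatHat J ((toAdele p.2).map (toFin F)))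
    {s : Matrix (Fin n) (Fin n) (FiniteAdeleRing (𝓞 F) F)}
    {m : Matrix (Fin l) (Fin n) (FiniteAdeleRing (𝓞 F) F)} (hs : MatHat I s) (hm : MatHat I m) :
    fourierChar p (finMat s, finMat m) = 1 := by
  rw [fourierChar, psi_trace_eq_one, psi_trace_eq_one, mul_one]
  · rw [Matrix.map_mul, finMat_toArch, Matrix.mul_zero]
  · rw [Matrix.map_mul, finMat_toFin, Matrix.transpose_map]
    exact (hp2.transpose.mul hm).mono (hIJ.trans one_le_invDifferent)
  · rw [Matrix.map_mul, finMat_toArch, Matrix.mul_zero]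
  · rw [Matrix.map_mul, finMat_toFin]
    exact (hp1.mul hs).mono (hIJ.trans one_le_invDifferent)

/-- The density of `F` in the finite adeles extends the expansion from archimedean translations to
all adelic translations. -/
theorem IsAdelicSiegelJacobiForm.hasSum_normalizedForm
    (hf : IsAdelicSiegelJacobiForm b c (level n l b c) k S χ f) (hb : b ≠ 0)
    (q : GL (Fin n) (AdeleRing (𝓞 F) F)) (lam : Matrix (Fin l) (Fin n) (AdeleRing (𝓞 F) F))
    {C : Matrix (Fin n) (Fin n) F × Matrix (Fin l) (Fin n) F → ℂ}
    (hC : ∀ p, C p ≠ 0 → p.1.IsSymm)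
    (h : ∀ (σ : Matrix (Fin n) (Fin n) (AdeleRing (𝓞 F) F)) (hσ : σ.IsSymm)
      (m : Matrix (Fin l) (Fin n) (AdeleRing (𝓞 F) F)),
      σ.map (toFin F) = 0 → m.map (toFin F) = 0 →
      HasSum (fun p => C p * fourierChar p (σ, m)) (normalizedForm S f q lam σ hσ m))
    (σ : Matrix (Fin n) (Fin n) (AdeleRing (𝓞 F) F)) (hσ : σ.IsSymm)
    (m : Matrix (Fin l) (Fin n) (AdeleRing (𝓞 F) F)) :
    HasSum (fun p => C p * fourierChar p (σ, m)) (normalizedForm S f q lam σ hσ m) := by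
  obtain ⟨I, hI0, hI1, hI⟩ := hf.exists_invariant_lattice hb q lam
  -- the characters which occur are trivial on the finite parts of rational translations in the lattice
  have hrat : ∀ p, C p ≠ 0 → ∀ (s : Matrix (Fin n) (Fin n) F) (r : Matrix (Fin l) (Fin n) F),
      s.IsSymm → MatHat I ((toAdele s).map (toFin F)) → MatHat I ((toAdele r).map (toFin F)) →
      fourierChar p (finMat ((toAdele s).map (toFin F)), finMat ((toAdele r).map (toFin F))) = 1 := by
    intro p hp s r hs hsI hrI
    have hsA : (toAdele s).IsSymm := hs.map _
    have h1 : fourierChar p (archPart (toAdele s), archPart (toAdele r)) = 1 := by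
      refine fourierChar_eq_one_of_invariant hC (fun x hx => ?_) hp
      have hu := archPart_mem (toAdele s) hsA (toAdele r)
      have hxu := add_mem hx hu
      refine ⟨normalizedForm S f q lam x.1 hx.1 x.2, h x.1 hx.1 x.2 hx.2.1 hx.2.2, ?_⟩
      have h2 := h _ hxu.1 _ hxu.2.1 hxu.2.2
      have h3 : normalizedForm S f q lam (x + (archPart (toAdele s), archPart (toAdele r))).1 hxu.1
          (x + (archPart (toAdele s), archPart (toAdele r))).2 =
          normalizedForm S f q lam x.1 hx.1 x.2 := by
        rw [← hI _ hxu.1 _ _ (hsA.map (toFin F)) _ hsI hrI,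
          ← hf.normalizedForm_add_rational q lam x.1 hx.1 x.2 hs r]
        refine normalizedForm_congr rfl rfl ?_ ?_
        · rw [Prod.fst_add, add_assoc, archPart_add_finMat]
        · rw [Prod.snd_add, add_assoc, archPart_add_finMat]
      rwa [h3] at h2
    have h2 := fourierChar_rational p s r
    have h3 : (toAdele s, toAdele r) = (archPart (toAdele s), archPart (toAdele r)) +
        (finMat ((toAdele s).map (toFin F)), finMat ((toAdele r).map (toFin F))) :=
      Prod.ext (archPart_add_finMat _).symm (archPart_add_finMat _).symm
    rwa [h3, fourierChar_add, h1, one_mul] at h2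
  -- they are trivial on the whole lattice: `p` has a denominator `J`, and any translation in the
  -- lattice is congruent to a rational one modulo `J⁻¹ I`
  have hfin : ∀ p, C p ≠ 0 → ∀ (s : Matrix (Fin n) (Fin n) (FiniteAdeleRing (𝓞 F) F))
      (r : Matrix (Fin l) (Fin n) (FiniteAdeleRing (𝓞 F) F)),
      s.IsSymm → MatHat I s → MatHat I r → fourierChar p (finMat s, finMat r) = 1 := by
    intro p hp s r hs hsI hrI
    obtain ⟨J₁, hJ₁⟩ := exists_matHat ((toAdele p.1).map (toFin F))
    obtain ⟨J₂, hJ₂⟩ := exists_matHat ((toAdele p.2).map (toFin F))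
    set J := 1 ⊔ J₁ ⊔ J₂ with hJ
    have h1J : 1 ≤ J := le_sup_left.trans le_sup_left
    replace hJ₁ := hJ₁.mono (le_sup_right.trans le_sup_left : J₁ ≤ J)
    replace hJ₂ : MatHat J _ := hJ₂.mono (le_sup_right : J₂ ≤ J)
    have hJ0 : J ≠ 0 := fun h => one_ne_zero (le_zero_iff.1 (h1J.trans_eq h))
    have hJJ : J * J⁻¹ = 1 := mul_inv_cancel₀ hJ0
    have hi1 : J⁻¹ ≤ 1 := by
      calc J⁻¹ = 1 * J⁻¹ := (one_mul _).symm
        _ ≤ J * J⁻¹ := by gcongr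
        _ = 1 := hJJ
    have hle : J⁻¹ * I ≤ I := by
      calc J⁻¹ * I ≤ 1 * I := by gcongr
        _ = I := one_mul _
    have hne : J⁻¹ * I ≠ 0 := mul_ne_zero (by simp [hJ0]) hI0
    obtain ⟨s', hs', hss⟩ := exists_rational_symm_matHat hs hne
    obtain ⟨r', hrr⟩ := exists_rational_matHat r hne
    have h1 := hrat p hp s' r' hs'
      (by have := hsI.sub (hss.mono hle); rwa [sub_sub_cancel] at this)
      (by have := hrI.sub (hrr.mono hle); rwa [sub_sub_cancel] at this)
    have h2 := matHat_trace_char (by rw [← mul_assoc, hJJ, one_mul]; exact hI1) p hJ₁ hJ₂ hss hrr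
    have h3 : (finMat s, finMat r) =
        (finMat ((toAdele s').map (toFin F)), finMat ((toAdele r').map (toFin F))) +
        (finMat (s - (toAdele s').map (toFin F)), finMat (r - (toAdele r').map (toFin F))) := by
      rw [Prod.mk_add_mk, ← finMat_add, ← finMat_add, add_sub_cancel, add_sub_cancel]
    rw [h3, fourierChar_add, h1, h2, one_mul]
  -- split `(σ, m)` into an archimedean, a lattice and a rational translation
  obtain ⟨s, hs, hsI⟩ := exists_rational_symm_matHat (hσ.map (toFin F)) hI0
  obtain ⟨r, hrI⟩ := exists_rational_matHat (m.map (toFin F)) hI0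
  have hsA : (toAdele s).IsSymm := hs.map _
  have hσ0 := hσ.sub hsA
  have hmem := archPart_mem (σ - toAdele s) hσ0 (m - toAdele r)
  rw [← Matrix.map_sub _ (map_sub _)] at hsI hrI
  have hsplit : (σ, m) = (archPart (σ - toAdele s), archPart (m - toAdele r)) +
      (finMat ((σ - toAdele s).map (toFin F)), finMat ((m - toAdele r).map (toFin F))) +
      (toAdele s, toAdele r) := by
    refine Prod.ext ?_ ?_
    · rw [Prod.fst_add, Prod.fst_add, archPart_add_finMat, sub_add_cancel]
    · rw [Prod.snd_add, Prod.snd_add, archPart_add_finMat, sub_add_cancel]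
  have hval : normalizedForm S f q lam σ hσ m =
      normalizedForm S f q lam (archPart (σ - toAdele s)) hmem.1 (archPart (m - toAdele r)) := by
    refine Eq.trans ?_ ((hf.normalizedForm_add_rational q lam _ _ _ hs r).trans
      (hI _ hmem.1 _ _ (hσ0.map (toFin F)) _ hsI hrI))
    exact normalizedForm_congr rfl rfl (congrArg Prod.fst hsplit) (congrArg Prod.snd hsplit)
  rw [hval]
  refine (h _ hmem.1 _ hmem.2.1 hmem.2.2).congr_fun fun p => ?_
  by_cases hp : C p = 0
  · rw [hp, zero_mul, zero_mul]
  · rw [hsplit, fourierChar_add, fourierChar_add, fourierChar_rational,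
      hfin p hp _ _ (hσ0.map (toFin F)) hsI hrI, mul_one, mul_one]

end

/-! ### Duality for lattices of symmetric matrices -/

/-- A sum over a square lies in `A` if the diagonal terms and the sums of the pairs of opposite terms
do. -/
theorem sum_sum_mem_of_add_swap {G ι : Type*} [AddCommMonoid G] [Fintype ι] [LinearOrder ι]
    (A : AddSubmonoid G) (g : ι → ι → G) (hd : ∀ i, g i i ∈ A)
    (ho : ∀ i j, i < j → g i j + g j i ∈ A) : ∑ i, ∑ j, g i j ∈ A := by
  have h : ∑ i, ∑ j, g i j =
      (∑ i, ∑ j, if i = j then g i j else 0) + ∑ i, ∑ j, if i < j then g i j + g j i else 0 := by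
    have h1 : ∀ i j, g i j = (if i = j then g i j else 0) +
        ((if i < j then g i j else 0) + (if j < i then g i j else 0)) := by
      intro i j
      rcases lt_trichotomy i j with h | h | h
      · simp [h, h.ne, h.asymm]
      · simp [h]
      · simp [h, h.ne', h.asymm]
    have h2 : (∑ i, ∑ j, if j < i then g i j else 0) = ∑ i, ∑ j, if i < j then g j i else 0 :=
      Finset.sum_comm
    rw [Finset.sum_congr rfl fun i _ => Finset.sum_congr rfl fun j _ => h1 i j]
    simp only [Finset.sum_add_distrib]
    rw [h2, ← Finset.sum_add_distrib]
    congr 1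
    refine Finset.sum_congr rfl fun i _ => ?_
    rw [← Finset.sum_add_distrib]
    refine Finset.sum_congr rfl fun j _ => ?_
    split_ifs <;> simp
  rw [h]
  refine add_mem (sum_mem fun i _ => ?_) (sum_mem fun i _ => sum_mem fun j _ => ?_)
  · rw [Finset.sum_ite_eq Finset.univ i, if_pos (Finset.mem_univ _)]
    exact hd i
  · split_ifs with h'
    · exact ho i j h'
    · exact zero_mem _

section
variable {F : Type*} [Field F] [NumberField F] {n : ℕ}

theorem dualSym_diag {T : Matrix (Fin n) (Fin n) F} (hT : T ∈ dualSym F n) (i : Fin n) :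
    T i i ∈ (algebraMap (𝓞 F) F).range := by
  have h := hT.2 (Matrix.single i i 1) (by rw [Matrix.IsSymm, Matrix.transpose_single])
  have e : (Matrix.single i i (1 : 𝓞 F)).map (algebraMap (𝓞 F) F) = Matrix.single i i 1 := by
    rw [Matrix.map_single, map_one]
  rw [e, Matrix.trace_mul_single] at h
  simpa using h

theorem dualSym_add_swap {T : Matrix (Fin n) (Fin n) F} (hT : T ∈ dualSym F n) (i j : Fin n) :
    T i j + T j i ∈ (algebraMap (𝓞 F) F).range := by
  have h := hT.2 (Matrix.single i j 1 + Matrix.single j i 1) (by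
    rw [Matrix.IsSymm, Matrix.transpose_add, Matrix.transpose_single, Matrix.transpose_single,
      add_comm])
  have e : (Matrix.single i j (1 : 𝓞 F) + Matrix.single j i 1).map (algebraMap (𝓞 F) F) =
      Matrix.single i j 1 + Matrix.single j i 1 := by
    rw [Matrix.map_add _ (map_add _), Matrix.map_single, Matrix.map_single, map_one]
  rw [e, Matrix.mul_add, Matrix.trace_add, Matrix.trace_mul_single, Matrix.trace_mul_single] at h
  simpa [add_comm] using h

theorem range_mem_integers (v : HeightOneSpectrum (𝓞 F)) {x : F}
    (hx : x ∈ (algebraMap (𝓞 F) F).range) :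
    algebraMap F (v.adicCompletion F) x ∈ v.adicCompletionIntegers F := by
  obtain ⟨a, rfl⟩ := hx
  exact v.coe_mem_adicCompletionIntegers a

/-- Elements of `𝔟𝔡⁻¹𝒯_n` pair symmetric matrices over `𝔟_v⁻¹` into `𝔡_v⁻¹`. -/
theorem trace_mul_mem_of_mem_indexLattice (v : HeightOneSpectrum (𝓞 F))
    {b : FractionalIdeal (𝓞 F)⁰ F} {S : Matrix (Fin n) (Fin n) F} (hS : S ∈ indexLattice n b)
    {Z : Matrix (Fin n) (Fin n) (v.adicCompletion F)} (hZ : Z.IsSymm)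
    (hZb : ∀ i j, Z i j ∈ locIdeal v b⁻¹) :
    (S.map (algebraMap F (v.adicCompletion F)) * Z).trace ∈ locIdeal v (invDifferent F) := by
  have key : ∀ u ∈ b * invDifferent F, ∀ y ∈ locIdeal v b⁻¹,
      algebraMap F (v.adicCompletion F) u * y ∈ locIdeal v (invDifferent F) := by
    intro u hu y hy
    have h := locIdeal_mul v (Submodule.subset_span ⟨u, hu, rfl⟩ :
      algebraMap F (v.adicCompletion F) u ∈ locIdeal v (b * invDifferent F)) hy
    refine locIdeal_mono v ?_ h
    by_cases hb : b = 0
    · simp [hb]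
    · rw [mul_comm b, mul_assoc, mul_inv_cancel₀ hb, mul_one]
  refine Submodule.smul_induction_on hS (fun u hu T hT => ?_) (fun A B hA hB => ?_)
  · have e : ((u • T).map (algebraMap F (v.adicCompletion F)) * Z).trace =
        algebraMap F (v.adicCompletion F) u *
          (T.map (algebraMap F (v.adicCompletion F)) * Z).trace := by
      have : (u • T).map (algebraMap F (v.adicCompletion F)) =
          algebraMap F (v.adicCompletion F) u • T.map (algebraMap F (v.adicCompletion F)) := by
        ext i j
        simp
      rw [this, Matrix.smul_mul, Matrix.trace_smul, smul_eq_mul]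
    rw [e]
    refine key u hu _ ?_
    have e2 : (T.map (algebraMap F (v.adicCompletion F)) * Z).trace =
        ∑ i, ∑ j, algebraMap F (v.adicCompletion F) (T i j) * Z j i := rfl
    rw [e2]
    refine sum_sum_mem_of_add_swap (locIdeal v b⁻¹).toAddSubmonoid _ (fun i => ?_)
      (fun i j _ => ?_)
    · exact (locIdeal v b⁻¹).smul_mem ⟨_, range_mem_integers v (dualSym_diag hT i)⟩ (hZb i i)
    · have e3 : algebraMap F (v.adicCompletion F) (T i j) * Z j i +
          algebraMap F (v.adicCompletion F) (T j i) * Z i j =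
          algebraMap F (v.adicCompletion F) (T i j + T j i) * Z i j := by
        rw [hZ.apply i j, map_add, add_mul]
      rw [e3]
      exact (locIdeal v b⁻¹).smul_mem ⟨_, range_mem_integers v (dualSym_add_swap hT i j)⟩ (hZb i j)
  · rw [Matrix.map_add _ (map_add _), Matrix.add_mul, Matrix.trace_add]
    exact add_mem hA hB

/-- The matrix `(E_ij + E_ji) / 2`. -/
def symmUnit (F : Type*) [Field F] (i j : Fin n) : Matrix (Fin n) (Fin n) F :=
  (2 : F)⁻¹ • (Matrix.single i j 1 + Matrix.single j i 1)

theorem symmUnit_mem_dualSym (i j : Fin n) : symmUnit F i j ∈ dualSym F n := by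
  refine ⟨?_, fun y hy => ⟨y i j, ?_⟩⟩
  · rw [Matrix.IsSymm, symmUnit, Matrix.transpose_smul, Matrix.transpose_add,
      Matrix.transpose_single, Matrix.transpose_single, add_comm]
  · rw [symmUnit, Matrix.smul_mul, Matrix.trace_smul, Matrix.add_mul, Matrix.trace_add,
      Matrix.trace_single_mul, Matrix.trace_single_mul]
    simp only [Matrix.map_apply, smul_eq_mul, one_mul]
    rw [hy.apply i j, ← two_mul, inv_mul_cancel_left₀ two_ne_zero]

theorem smul_symmUnit_mem (v : HeightOneSpectrum (𝓞 F)) {b : FractionalIdeal (𝓞 F)⁰ F}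
    {u : v.adicCompletion F} (hu : u ∈ locIdeal v (b * invDifferent F)) (i j : Fin n) :
    u • (symmUnit F i j).map (algebraMap F (v.adicCompletion F)) ∈
      locLattice v (indexLattice n b) := by
  refine Submodule.span_induction ?_ ?_ ?_ ?_ hu
  · rintro _ ⟨a, ha, rfl⟩
    refine Submodule.subset_span ⟨a • symmUnit F i j,
      Submodule.smul_mem_smul ha (symmUnit_mem_dualSym i j), ?_⟩
    ext s t
    simp
  · rw [zero_smul]; exact zero_mem _
  · intro x y _ _ hx hy
    rw [add_smul]; exact add_mem hx hy
  · intro a x _ hx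
    have : (a • x) • (symmUnit F i j).map (algebraMap F (v.adicCompletion F)) =
        a • (x • (symmUnit F i j).map (algebraMap F (v.adicCompletion F))) := smul_assoc _ _ _
    rw [this]
    exact Submodule.smul_mem _ _ hx

/-- `(𝔟𝔡⁻¹𝒯_n)_v` contains the dual of the symmetric matrices over `𝔟_v⁻¹` under `Ψ_v`. -/
theorem mem_locLattice_of_psiLocal (v : HeightOneSpectrum (𝓞 F))
    {b : FractionalIdeal (𝓞 F)⁰ F} (hb : b ≠ 0)
    {y : Matrix (Fin n) (Fin n) (v.adicCompletion F)} (hy : y.IsSymm)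
    (h : ∀ s : Matrix (Fin n) (Fin n) (v.adicCompletion F), s.IsSymm →
      (∀ i j, s i j ∈ locIdeal v b⁻¹) → psiLocal v (y * s).trace = 1) :
    y ∈ locLattice v (indexLattice n b) := by
  have hsingle : ∀ (i j : Fin n) {z : v.adicCompletion F}, z ∈ locIdeal v b⁻¹ → ∀ s t,
      Matrix.single i j z s t ∈ locIdeal v b⁻¹ := by
    intro i j z hz s t
    rw [Matrix.single_apply]
    split_ifs
    · exact hz
    · exact zero_mem _
  have hd : ∀ i, y i i ∈ locIdeal v (b * invDifferent F) := by
    intro i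
    refine mem_locIdeal_of_psiLocal hb v fun z hz => ?_
    have := h (Matrix.single i i z) (by rw [Matrix.IsSymm, Matrix.transpose_single])
      (hsingle i i hz)
    rw [Matrix.trace_mul_single] at this
    simpa [mul_comm] using this
  have ho : ∀ i j, y i j + y j i ∈ locIdeal v (b * invDifferent F) := by
    intro i j
    refine mem_locIdeal_of_psiLocal hb v fun z hz => ?_
    have := h (Matrix.single i j z + Matrix.single j i z)
      (by rw [Matrix.IsSymm, Matrix.transpose_add, Matrix.transpose_single,
        Matrix.transpose_single, add_comm])
      (fun s t => add_mem (hsingle i j hz s t) (hsingle j i hz s t))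
    rw [Matrix.mul_add, Matrix.trace_add, Matrix.trace_mul_single, Matrix.trace_mul_single] at this
    rw [add_mul, add_comm]
    simpa [mul_comm] using this
  have h2 : (2 : v.adicCompletion F) ≠ 0 := by
    have : algebraMap F (v.adicCompletion F) 2 ≠ 0 := (map_ne_zero _).2 two_ne_zero
    rwa [map_ofNat] at this
  have hmap : ∀ i j : Fin n, (symmUnit F i j).map (algebraMap F (v.adicCompletion F)) =
      (2 : v.adicCompletion F)⁻¹ • (Matrix.single i j 1 + Matrix.single j i 1) := by
    intro i j
    have e : ∀ i j : Fin n, (Matrix.single i j (1 : F)).map (algebraMap F (v.adicCompletion F)) =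
        Matrix.single i j 1 := fun i j => by rw [Matrix.map_single, map_one]
    rw [← e, ← e, symmUnit]
    ext s t : 2
    simp only [Matrix.map_apply, Matrix.smul_apply, Matrix.add_apply, smul_eq_mul, map_mul, map_add,
      map_inv₀, map_ofNat]
  rw [Matrix.matrix_eq_sum_single y]
  refine sum_sum_mem_of_add_swap (locLattice v (indexLattice n b)).toAddSubmonoid _ (fun i => ?_)
    (fun i j _ => ?_)
  · have := smul_symmUnit_mem v (hd i) i i
    rwa [hmap, ← two_smul (v.adicCompletion F), inv_smul_smul₀ h2, Matrix.smul_single, smul_eq_mul,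
      mul_one] at this
  · have := smul_symmUnit_mem v (ho i j) i j
    rw [hmap, hy.apply i j, ← two_mul, smul_smul, mul_comm (2 : v.adicCompletion F), mul_assoc,
      mul_inv_cancel₀ h2, mul_one, smul_add, Matrix.smul_single, Matrix.smul_single, smul_eq_mul,
      mul_one] at this
    rwa [hy.apply i j]

end

/-! ### Support and equivariance of the coefficients -/

section
variable {F : Type*} [Field F] [NumberField F] {n l : ℕ}

open scoped Classical in
/-- A matrix over `F_v` as a matrix over the finite adeles, zero at the other places. -/
def localMat {m p : Type*} (v : HeightOneSpectrum (𝓞 F)) (X : Matrix m p (v.adicCompletion F)) :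
    Matrix m p (FiniteAdeleRing (𝓞 F) F) :=
  X.map (RestrictedProduct.single (fun w : HeightOneSpectrum (𝓞 F) => w.adicCompletionIntegers F) v)

theorem localMat_same {m p : Type*} (v : HeightOneSpectrum (𝓞 F))
    (X : Matrix m p (v.adicCompletion F)) : (localMat v X).map (finEval v) = X := by
  classical
  refine Matrix.ext fun i j => ?_
  exact Pi.single_eq_same (M := fun w : HeightOneSpectrum (𝓞 F) => w.adicCompletion F) v (X i j)

theorem localMat_of_ne {m p : Type*} {v w : HeightOneSpectrum (𝓞 F)} (h : w ≠ v)
    (X : Matrix m p (v.adicCompletion F)) : (localMat v X).map (finEval w) = 0 := by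
  classical
  refine Matrix.ext fun i j => ?_
  exact Pi.single_eq_of_ne (M := fun w : HeightOneSpectrum (𝓞 F) => w.adicCompletion F) h (X i j)

theorem localMat_isSymm {m : Type*} {v : HeightOneSpectrum (𝓞 F)}
    {X : Matrix m m (v.adicCompletion F)} (hX : X.IsSymm) : (localMat v X).IsSymm :=
  hX.map _

theorem localMat_matHat {m p : Type*} {v : HeightOneSpectrum (𝓞 F)}
    {X : Matrix m p (v.adicCompletion F)} {I : FractionalIdeal (𝓞 F)⁰ F}
    (hX : ∀ i j, X i j ∈ locIdeal v I) : MatHat I (localMat v X) := by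
  intro w i j
  by_cases h : w = v
  · subst h
    have := congrFun (congrFun (localMat_same w X) i) j
    rw [Matrix.map_apply] at this
    exact (this.symm ▸ hX i j : finEval w (localMat w X i j) ∈ locIdeal w I)
  · have := congrFun (congrFun (localMat_of_ne h X) i) j
    rw [Matrix.map_apply, Matrix.zero_apply] at this
    exact (this.symm ▸ zero_mem _ : finEval w (localMat v X i j) ∈ locIdeal w I)

theorem toAdele_map_finEval {m p : Type*} (A : Matrix m p F) (v : HeightOneSpectrum (𝓞 F)) :
    ((toAdele A).map (toFin F)).map (finEval v) = A.map (algebraMap F (v.adicCompletion F)) := rfl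

theorem trace_map_finEval {s : ℕ} (v : HeightOneSpectrum (𝓞 F))
    (A : Matrix (Fin s) (Fin s) (FiniteAdeleRing (𝓞 F) F)) :
    A.trace v = (A.map (finEval v)).trace :=
  AddMonoidHom.map_trace (finEval v) A

/-- The action `(t, r) ↦ (ᵗa t a, r a)` of `GL_n(F)` on the indices. -/
def indexEquiv (l : ℕ) (a : GL (Fin n) F) :
    Matrix (Fin n) (Fin n) F × Matrix (Fin l) (Fin n) F ≃
      Matrix (Fin n) (Fin n) F × Matrix (Fin l) (Fin n) F where
  toFun p := (a.1ᵀ * p.1 * a.1, p.2 * a.1)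
  invFun p := ((a⁻¹).1ᵀ * p.1 * (a⁻¹).1, p.2 * (a⁻¹).1)
  left_inv p := by
    refine Prod.ext ?_ ?_
    · calc (a⁻¹).1ᵀ * (a.1ᵀ * p.1 * a.1) * (a⁻¹).1 =
          ((a⁻¹).1ᵀ * a.1ᵀ) * p.1 * (a.1 * (a⁻¹).1) := by simp only [Matrix.mul_assoc]
        _ = p.1 := by rw [GL_inv_transpose_mul, GL_mul_inv, Matrix.one_mul, Matrix.mul_one]
    · change p.2 * a.1 * (a⁻¹).1 = p.2
      rw [Matrix.mul_assoc, GL_mul_inv, Matrix.mul_one]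
  right_inv p := by
    refine Prod.ext ?_ ?_
    · calc a.1ᵀ * ((a⁻¹).1ᵀ * p.1 * (a⁻¹).1) * a.1 =
          (a.1ᵀ * (a⁻¹).1ᵀ) * p.1 * ((a⁻¹).1 * a.1) := by simp only [Matrix.mul_assoc]
        _ = p.1 := by rw [GL_transpose_mul_inv, GL_inv_mul, Matrix.one_mul, Matrix.mul_one]
    · change p.2 * (a⁻¹).1 * a.1 = p.2
      rw [Matrix.mul_assoc, GL_inv_mul, Matrix.mul_one]

theorem trace_conj_eq (S : Matrix (Fin l) (Fin l) F) (a : GL (Fin n) (AdeleRing (𝓞 F) F))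
    (lam : Matrix (Fin l) (Fin n) (AdeleRing (𝓞 F) F))
    (σ : Matrix (Fin n) (Fin n) (AdeleRing (𝓞 F) F)) :
    ((lam * (a⁻¹).1)ᵀ * toAdele S * (lam * (a⁻¹).1) * (a.1 * σ * a.1ᵀ)).trace =
      (lamᵀ * toAdele S * lam * σ).trace := by
  calc _ = ((a⁻¹).1ᵀ * (lamᵀ * toAdele S * lam * ((a⁻¹).1 * a.1) * σ * a.1ᵀ)).trace := by
        rw [Matrix.transpose_mul]; simp only [Matrix.mul_assoc]
    _ = (lamᵀ * toAdele S * lam * σ * (a.1ᵀ * (a⁻¹).1ᵀ)).trace := by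
        rw [GL_inv_mul, Matrix.mul_one, Matrix.trace_mul_comm]; simp only [Matrix.mul_assoc]
    _ = _ := by rw [GL_transpose_mul_inv, Matrix.mul_one]

variable [IsTotallyReal F]

theorem psi_trace_eq_psiLocal (v : HeightOneSpectrum (𝓞 F)) {s : ℕ}
    {A : Matrix (Fin s) (Fin s) (AdeleRing (𝓞 F) F)}
    (ha : A.map (toArch F) = 0)
    (hw : ∀ w, w ≠ v → (A.map (toFin F)).map (finEval w) = 0) :
    psi A.trace = psiLocal v ((A.map (toFin F)).map (finEval v)).trace := by
  rw [psi_trace_of_toArch_eq_zero ha, psiFin, finprod_eq_single _ v fun w h => ?_,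
    trace_map_finEval]
  rw [trace_map_finEval, hw w h, Matrix.trace_zero, psiLocal_zero]

theorem psi_trace_mul_eq_one {b : FractionalIdeal (𝓞 F)⁰ F} {S : Matrix (Fin l) (Fin l) F}
    (hS : S ∈ indexLattice l b) {Z : Matrix (Fin l) (Fin l) (AdeleRing (𝓞 F) F)} (hZ : Z.IsSymm)
    (ha : Z.map (toArch F) = 0) (hb : MatHat b⁻¹ (Z.map (toFin F))) :
    psi (toAdele S * Z).trace = 1 := by
  rw [psi_trace_of_toArch_eq_zero (by rw [Matrix.map_mul, ha, Matrix.mul_zero])]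
  refine psiFin_eq_one fun v => psiLocal_eq_one_of_mem v ?_
  rw [trace_map_finEval, Matrix.map_mul, Matrix.map_mul, toAdele_map_finEval]
  exact trace_mul_mem_of_mem_indexLattice v hS ((hZ.map _).map _) fun i j => hb v i j

variable {b : FractionalIdeal (𝓞 F)⁰ F} {c : Ideal (𝓞 F)}
  {k : InfinitePlace F → ℤ} {S : Matrix (Fin l) (Fin l) F}
  {χ : (AdeleRing (𝓞 F) F)ˣ →* ℂˣ} {f : JacobiGroup n l (AdeleRing (𝓞 F) F) → ℂ}

/-- If `λq` is integral, the phases under translations from the level are trivial, because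
`S ∈ 𝔟𝔡⁻¹𝒯_l`. -/
theorem IsAdelicSiegelJacobiForm.normalizedForm_add_of_integral
    (hf : IsAdelicSiegelJacobiForm b c (level n l b c) k S χ f) (hS : S ∈ indexLattice l b)
    (q : GL (Fin n) (AdeleRing (𝓞 F) F)) (lam : Matrix (Fin l) (Fin n) (AdeleRing (𝓞 F) F))
    (hint : MatHat 1 ((lam * q.1).map (toFin F)))
    (σ : Matrix (Fin n) (Fin n) (AdeleRing (𝓞 F) F)) (hσ : σ.IsSymm)
    (m : Matrix (Fin l) (Fin n) (AdeleRing (𝓞 F) F))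
    {s : Matrix (Fin n) (Fin n) (FiniteAdeleRing (𝓞 F) F)} (hs : s.IsSymm) (hsb : MatHat b⁻¹ s)
    {x : Matrix (Fin l) (Fin n) (FiniteAdeleRing (𝓞 F) F)} (hxb : MatHat b⁻¹ x) :
    normalizedForm S f q lam (σ + q.1 * finMat s * q.1ᵀ)
        (hσ.add (isSymm_mul_mul_transpose (finMat_isSymm hs) _))
        (m + finMat x * q.1ᵀ + lam * (q.1 * finMat s * q.1ᵀ)) =
      normalizedForm S f q lam σ hσ m := by
  refine hf.normalizedForm_add_fin q lam σ hσ m (finMat_isSymm hs) rfl rfl hsb hxb ?_ ?_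
  · have e : (lamᵀ * toAdele S * lam * (q.1 * finMat s * q.1ᵀ)).trace =
        (toAdele S * (lam * q.1 * finMat s * (lam * q.1)ᵀ)).trace := by
      rw [Matrix.mul_assoc, Matrix.mul_assoc, Matrix.trace_mul_comm, Matrix.transpose_mul]
      simp only [Matrix.mul_assoc]
    rw [e]
    refine psi_trace_mul_eq_one hS (isSymm_mul_mul_transpose (finMat_isSymm hs) _) ?_ ?_
    · rw [Matrix.map_mul, Matrix.map_mul (L := lam * q.1), finMat_toArch, Matrix.mul_zero,
        Matrix.zero_mul]
    · rw [Matrix.map_mul, Matrix.map_mul (L := lam * q.1), finMat_toFin, Matrix.transpose_map]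
      exact ((hint.mul hsb).mul hint.transpose).mono (by rw [one_mul, mul_one])
  · have hX : MatHat b⁻¹ ((lam * q.1 * (finMat x)ᵀ).map (toFin F)) := by
      rw [Matrix.map_mul, Matrix.transpose_map, finMat_toFin]
      exact (hint.mul hxb.transpose).mono (one_mul _).le
    have hXa : (lam * q.1 * (finMat x)ᵀ).map (toArch F) = 0 := by
      rw [Matrix.map_mul, Matrix.transpose_map, finMat_toArch, Matrix.transpose_zero,
        Matrix.mul_zero]
    refine psi_trace_mul_eq_one hS (Matrix.isSymm_add_transpose_self _) ?_ ?_
    · rw [Matrix.map_add _ (map_add _), Matrix.transpose_map, hXa, Matrix.transpose_zero, add_zero]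
    · rw [Matrix.map_add _ (map_add _), Matrix.transpose_map]
      exact hX.add hX.transpose

/-- The local conditions on the indices of the non-zero coefficients. -/
theorem IsAdelicSiegelJacobiForm.local_conditions
    (hf : IsAdelicSiegelJacobiForm b c (level n l b c) k S χ f) (hb : b ≠ 0)
    (hS : S ∈ indexLattice l b)
    (q : GL (Fin n) (AdeleRing (𝓞 F) F)) (lam : Matrix (Fin l) (Fin n) (AdeleRing (𝓞 F) F))
    (hint : MatHat 1 ((lam * q.1).map (toFin F)))
    {C : Matrix (Fin n) (Fin n) F × Matrix (Fin l) (Fin n) F → ℂ}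
    (hC : ∀ p, C p ≠ 0 → p.1.IsSymm)
    (h : ∀ (σ : Matrix (Fin n) (Fin n) (AdeleRing (𝓞 F) F)) (hσ : σ.IsSymm)
      (m : Matrix (Fin l) (Fin n) (AdeleRing (𝓞 F) F)),
      HasSum (fun p => C p * fourierChar p (σ, m)) (normalizedForm S f q lam σ hσ m))
    {t : Matrix (Fin n) (Fin n) F} {r : Matrix (Fin l) (Fin n) F} (hp : C (t, r) ≠ 0)
    (v : HeightOneSpectrum (𝓞 F)) :
    let qv := (q.1.map (toFin F)).map (finEval v)
    qvᵀ * t.map (algebraMap F (v.adicCompletion F)) * qv ∈ locLattice v (indexLattice n b) ∧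
      ∀ x : Matrix (Fin l) (Fin n) (v.adicCompletion F), (∀ i j, x i j ∈ locIdeal v b⁻¹) →
        psiLocal v (qvᵀ * (r.map (algebraMap F (v.adicCompletion F)))ᵀ * x).trace = 1 := by
  intro qv
  have hinv : ∀ {s : Matrix (Fin n) (Fin n) (FiniteAdeleRing (𝓞 F) F)}, s.IsSymm → MatHat b⁻¹ s →
      ∀ {x : Matrix (Fin l) (Fin n) (FiniteAdeleRing (𝓞 F) F)}, MatHat b⁻¹ x →
      fourierChar (t, r) (q.1 * finMat s * q.1ᵀ,
        finMat x * q.1ᵀ + lam * (q.1 * finMat s * q.1ᵀ)) = 1 := by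
    intro s hs hsb x hxb
    refine fourierChar_eq_one_of_invariant hC (fun y hy => ?_) hp
    refine ⟨_, h y.1 hy.1 y.2, ?_⟩
    rw [← hf.normalizedForm_add_of_integral hS q lam hint y.1 hy.1 y.2 hs hsb hxb, add_assoc]
    exact h _ _ _
  -- the conditions on `r` (taking `s = 0`) and on `t` (the term `λ q s` being integral over `𝔟⁻¹`)
  have hr : ∀ {x : Matrix (Fin l) (Fin n) (FiniteAdeleRing (𝓞 F) F)}, MatHat b⁻¹ x →
      psi ((toAdele r)ᵀ * (finMat x * q.1ᵀ)).trace = 1 := by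
    intro x hxb
    have := hinv Matrix.isSymm_zero MatHat.zero hxb
    have h0 : finMat (0 : Matrix (Fin n) (Fin n) (FiniteAdeleRing (𝓞 F) F)) = 0 := rfl
    simpa [fourierChar, h0, psi_zero] using this
  have ht : ∀ {s : Matrix (Fin n) (Fin n) (FiniteAdeleRing (𝓞 F) F)}, s.IsSymm → MatHat b⁻¹ s →
      psi (toAdele t * (q.1 * finMat s * q.1ᵀ)).trace = 1 := by
    intro s hs hsb
    have h1 := hinv hs hsb MatHat.zero
    have h0 : finMat (0 : Matrix (Fin l) (Fin n) (FiniteAdeleRing (𝓞 F) F)) = 0 := rfl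
    have h2 := hr ((hint.mul hsb).mono (one_mul _).le)
    have h3 : lam * (q.1 * finMat s * q.1ᵀ) = finMat ((lam * q.1).map (toFin F) * s) * q.1ᵀ := by
      rw [← Matrix.mul_assoc, ← Matrix.mul_assoc]
      congr 1
      refine archFin_ext ?_ ?_
      · rw [Matrix.map_mul, finMat_toArch, finMat_toArch, Matrix.mul_zero]
      · rw [Matrix.map_mul, finMat_toFin, finMat_toFin]
    rw [fourierChar, h0, Matrix.zero_mul, zero_add, h3, h2, mul_one] at h1
    exact h1
  constructor
  · have hts := hC _ hp
    refine mem_locLattice_of_psiLocal v hb ?_ fun s hs hsb => ?_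
    · have := isSymm_mul_mul_transpose (hts.map (algebraMap F (v.adicCompletion F))) qvᵀ
      rwa [Matrix.transpose_transpose] at this
    · have h1 := ht (localMat_isSymm hs) (localMat_matHat hsb)
      rw [psi_trace_eq_psiLocal v] at h1
      · simp only [Matrix.map_mul, toAdele_map_finEval, finMat_toFin, localMat_same,
          Matrix.transpose_map] at h1
        rw [← h1]
        congr 1
        rw [Matrix.mul_assoc, Matrix.mul_assoc, Matrix.trace_mul_comm]
        simp only [Matrix.mul_assoc]
        rfl
      · simp only [Matrix.map_mul, finMat_toArch, Matrix.mul_zero, Matrix.zero_mul]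
      · intro w hw
        simp only [Matrix.map_mul, finMat_toFin, localMat_of_ne hw, Matrix.mul_zero,
          Matrix.zero_mul]
  · intro x hx
    have h1 := hr (localMat_matHat hx)
    rw [psi_trace_eq_psiLocal v] at h1
    · simp only [Matrix.map_mul, toAdele_map_finEval, finMat_toFin, localMat_same,
        Matrix.transpose_map] at h1
      rw [← h1]
      congr 1
      rw [Matrix.mul_assoc, Matrix.trace_mul_comm]
      simp only [Matrix.mul_assoc]
      rfl
    · simp only [Matrix.map_mul, finMat_toArch, Matrix.mul_zero, Matrix.zero_mul]
    · intro w hw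
      simp only [Matrix.map_mul, finMat_toFin, localMat_of_ne hw, Matrix.mul_zero,
        Matrix.zero_mul]

/-- Invariance under `diag(a, ᵗa⁻¹)` for `a ∈ GL_n(F)`. -/
theorem IsAdelicSiegelJacobiForm.normalizedForm_diag
    (hf : IsAdelicSiegelJacobiForm b c (level n l b c) k S χ f) (a : GL (Fin n) F)
    (q : GL (Fin n) (AdeleRing (𝓞 F) F)) (lam : Matrix (Fin l) (Fin n) (AdeleRing (𝓞 F) F))
    (σ : Matrix (Fin n) (Fin n) (AdeleRing (𝓞 F) F)) (hσ : σ.IsSymm)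
    (m : Matrix (Fin l) (Fin n) (AdeleRing (𝓞 F) F)) :
    let aA := Matrix.GeneralLinearGroup.map (algebraMap F (AdeleRing (𝓞 F) F)) a
    normalizedForm S f (aA * q) (lam * (aA⁻¹).1) (aA.1 * σ * aA.1ᵀ)
        (isSymm_mul_mul_transpose hσ _) (m * aA.1ᵀ) = normalizedForm S f q lam σ hσ m := by
  intro aA
  have h1 := hf.map_mul (siegelElt 0 0 a 0 Matrix.isSymm_zero)
    (siegelElt lam (m - lam * σ) q σ hσ)
  have h2 : (siegelElt (l := l) 0 0 a 0 Matrix.isSymm_zero).map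
      (algebraMap F (AdeleRing (𝓞 F) F)) = siegelElt 0 0 aA 0 Matrix.isSymm_zero := by
    rw [map_siegelElt]
    exact siegelElt_congr (Matrix.map_zero _ (_root_.map_zero _))
      (Matrix.map_zero _ (_root_.map_zero _)) rfl (Matrix.map_zero _ (_root_.map_zero _))
  rw [h2, diag_mul_siegelElt _ _ _ _ _ hσ (isSymm_mul_mul_transpose hσ _)] at h1
  rw [normalizedForm, normalizedForm, trace_conj_eq, ← h1]
  congr 2
  refine siegelElt_congr rfl ?_ rfl rfl
  rw [Matrix.sub_mul]
  congr 1
  calc lam * (aA⁻¹).1 * (aA.1 * σ * aA.1ᵀ) = lam * ((aA⁻¹).1 * aA.1) * σ * aA.1ᵀ := by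
        simp only [Matrix.mul_assoc]
    _ = lam * σ * aA.1ᵀ := by rw [GL_inv_mul, Matrix.mul_one]

theorem fourierChar_indexEquiv (a : GL (Fin n) F)
    (p : Matrix (Fin n) (Fin n) F × Matrix (Fin l) (Fin n) F)
    (σ : Matrix (Fin n) (Fin n) (AdeleRing (𝓞 F) F))
    (m : Matrix (Fin l) (Fin n) (AdeleRing (𝓞 F) F)) :
    fourierChar (indexEquiv l a p) (σ, m) =
      fourierChar p (toAdele a.1 * σ * (toAdele a.1)ᵀ, m * (toAdele a.1)ᵀ) := by
  simp only [fourierChar, indexEquiv, Equiv.coe_fn_mk, Matrix.map_mul, Matrix.transpose_map,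
    Matrix.transpose_mul]
  congr 2
  · rw [Matrix.mul_assoc, Matrix.mul_assoc, Matrix.trace_mul_comm]
    simp only [Matrix.mul_assoc]
  · rw [Matrix.mul_assoc, Matrix.trace_mul_comm, Matrix.mul_assoc]

/-- Equivariance of the coefficients under `GL_n(F)`. -/
theorem IsAdelicSiegelJacobiForm.coeff_indexEquiv
    (hf : IsAdelicSiegelJacobiForm b c (level n l b c) k S χ f) (a : GL (Fin n) F)
    (q : GL (Fin n) (AdeleRing (𝓞 F) F)) (lam : Matrix (Fin l) (Fin n) (AdeleRing (𝓞 F) F))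
    {C D : Matrix (Fin n) (Fin n) F × Matrix (Fin l) (Fin n) F → ℂ}
    (hC : ∀ p, C p ≠ 0 → p.1.IsSymm) (hD : ∀ p, D p ≠ 0 → p.1.IsSymm)
    (h : ∀ (σ : Matrix (Fin n) (Fin n) (AdeleRing (𝓞 F) F)) (hσ : σ.IsSymm)
      (m : Matrix (Fin l) (Fin n) (AdeleRing (𝓞 F) F)),
      HasSum (fun p => C p * fourierChar p (σ, m)) (normalizedForm S f q lam σ hσ m))
    (h' : ∀ (σ : Matrix (Fin n) (Fin n) (AdeleRing (𝓞 F) F)) (hσ : σ.IsSymm)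
      (m : Matrix (Fin l) (Fin n) (AdeleRing (𝓞 F) F)),
      HasSum (fun p => D p * fourierChar p (σ, m)) (normalizedForm S f
        (Matrix.GeneralLinearGroup.map (algebraMap F (AdeleRing (𝓞 F) F)) a * q)
        (lam * ((Matrix.GeneralLinearGroup.map (algebraMap F (AdeleRing (𝓞 F) F)) a)⁻¹).1) σ hσ m))
    (p : Matrix (Fin n) (Fin n) F × Matrix (Fin l) (Fin n) F) : D p = C (indexEquiv l a p) := by
  have h1 := fourier_coeff_eq (C := fun p => D ((indexEquiv l a).symm p)) (D := C)
    (g := fun x => ∑' p, C p * fourierChar p x) (fun p hp => ?_) hC (fun x hx => ?_)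
    (fun x hx => (h x.1 hx.1 x.2).summable.hasSum)
  · rw [← congrFun h1, Equiv.symm_apply_apply]
  · have h2 := isSymm_mul_mul_transpose (hD _ hp) a.1ᵀ
    have h3 := congrArg Prod.fst ((indexEquiv l a).apply_symm_apply p)
    rw [Matrix.transpose_transpose] at h2
    rwa [← h3]
  · rw [(h x.1 hx.1 x.2).tsum_eq, ← hf.normalizedForm_diag a q lam x.1 hx.1 x.2,
      ← (indexEquiv l a).hasSum_iff]
    refine (h' _ _ _).congr_fun fun p => ?_
    rw [Function.comp_apply, Equiv.symm_apply_apply]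
    congr 1
    exact fourierChar_indexEquiv a p x.1 x.2

end

end
end SiegelJacobi

theorem mainTheorem10 {F : Type*} [Field F] [NumberField F] [IsTotallyReal F] (n l : ℕ)
    (b : FractionalIdeal (𝓞 F)⁰ F) (hb : b ≠ 0) (c : Ideal (𝓞 F)) (hc : c ≠ ⊥)
    (k : InfinitePlace F → ℤ) (S : Matrix (Fin l) (Fin l) F) (hS : S ∈ indexLattice l b)
    (χ : (AdeleRing (𝓞 F) F)ˣ →* ℂˣ) (hχ : IsHeckeChar c χ)
    (f : JacobiGroup n l (AdeleRing (𝓞 F) F) → ℂ)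
    (hf : IsAdelicSiegelJacobiForm b c (level n l b c) k S χ f) :
    ∃ (c₀ : Matrix (Fin n) (Fin n) F → Matrix (Fin l) (Fin n) F →
        GL (Fin n) (FiniteAdeleRing (𝓞 F) F) →
        Matrix (Fin l) (Fin n) (FiniteAdeleRing (𝓞 F) F) → ℂ)
      (L : GL (Fin n) (FiniteAdeleRing (𝓞 F) F) →
        Matrix (Fin l) (Fin n) (FiniteAdeleRing (𝓞 F) F) → Submodule ℤ (Matrix (Fin n) (Fin n) F))
      (M : GL (Fin n) (FiniteAdeleRing (𝓞 F) F) →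
        Matrix (Fin l) (Fin n) (FiniteAdeleRing (𝓞 F) F) → Submodule ℤ (Matrix (Fin l) (Fin n) F)),
      (∀ qh lamh, IsLatticeIn {t : Matrix (Fin n) (Fin n) F | t.IsSymm} (L qh lamh) ∧
        IsLatticeIn (Set.univ : Set (Matrix (Fin l) (Fin n) F)) (M qh lamh) ∧
        ∀ t r, c₀ t r qh lamh ≠ 0 → t ∈ L qh lamh ∧ TotNonneg t ∧ r ∈ M qh lamh) ∧
      (∀ (q : GL (Fin n) (AdeleRing (𝓞 F) F)) (lam mu : Matrix (Fin l) (Fin n) (AdeleRing (𝓞 F) F))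
        (σ : Matrix (Fin n) (Fin n) (AdeleRing (𝓞 F) F)) (hσ : σ.IsSymm),
        HasSum
          (fun p : {t : Matrix (Fin n) (Fin n) F //
              t ∈ L (Matrix.GeneralLinearGroup.map (toFin F) q) (lam.map (toFin F)) ∧ TotNonneg t} ×
              M (Matrix.GeneralLinearGroup.map (toFin F) q) (lam.map (toFin F)) =>
            jacobiCoeff k S c₀ p.1 p.2 q lam σ *
              psi (p.1.1.map (algebraMap F (AdeleRing (𝓞 F) F)) * σ).trace *
              psi ((p.2.1.map (algebraMap F (AdeleRing (𝓞 F) F)))ᵀ * lam * σ +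
                (p.2.1.map (algebraMap F (AdeleRing (𝓞 F) F)))ᵀ * mu).trace)
          (f (siegelElt lam mu q σ hσ))) ∧
      (∀ (a : GL (Fin n) F) (t : Matrix (Fin n) (Fin n) F) (r : Matrix (Fin l) (Fin n) F)
        (q : GL (Fin n) (AdeleRing (𝓞 F) F)) (lam : Matrix (Fin l) (Fin n) (AdeleRing (𝓞 F) F))
        (σ : Matrix (Fin n) (Fin n) (AdeleRing (𝓞 F) F)), σ.IsSymm →
        let aA := Matrix.GeneralLinearGroup.map (algebraMap F (AdeleRing (𝓞 F) F)) a
        jacobiCoeff k S c₀ t r (aA * q) (lam * (aA⁻¹).1) (aA.1 * σ * aA.1ᵀ) =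
          (χ (Matrix.GeneralLinearGroup.det aA) : ℂ) *
            jacobiCoeff k S c₀ (a.1ᵀ * t * a.1) (r * a.1) q lam σ) ∧
      (∀ (t : Matrix (Fin n) (Fin n) F) (r : Matrix (Fin l) (Fin n) F)
        (q : GL (Fin n) (AdeleRing (𝓞 F) F)) (lam : Matrix (Fin l) (Fin n) (AdeleRing (𝓞 F) F))
        (σ : Matrix (Fin n) (Fin n) (AdeleRing (𝓞 F) F)), σ.IsSymm →
        (∀ v : HeightOneSpectrum (𝓞 F), ∀ i j,
          finEval v (toFin F ((lam * q.1) i j)) ∈ v.adicCompletionIntegers F) →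
        jacobiCoeff k S c₀ t r q lam σ ≠ 0 →
        ∀ v : HeightOneSpectrum (𝓞 F),
          let qv := q.1.map fun x => finEval v (toFin F x)
          qvᵀ * t.map (algebraMap F (v.adicCompletion F)) * qv ∈ locLattice v (indexLattice n b) ∧
          ∀ x : Matrix (Fin l) (Fin n) (v.adicCompletion F),
            (∀ i j, x i j ∈ locIdeal v b⁻¹) →
            psiLocal v (qvᵀ * (r.map (algebraMap F (v.adicCompletion F)))ᵀ * x).trace = 1) := by
  choose L M a hL hM ha h using hf.exists_arch_expansion
  let c₀ : Matrix (Fin n) (Fin n) F → Matrix (Fin l) (Fin n) F →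
      GL (Fin n) (FiniteAdeleRing (𝓞 F) F) →
      Matrix (Fin l) (Fin n) (FiniteAdeleRing (𝓞 F) F) → ℂ := fun t r qh lamh => a qh lamh t r
  let C := fun (q : GL (Fin n) (AdeleRing (𝓞 F) F))
    (lam : Matrix (Fin l) (Fin n) (AdeleRing (𝓞 F) F))
    (p : Matrix (Fin n) (Fin n) F × Matrix (Fin l) (Fin n) F) =>
      c₀ p.1 p.2 (Matrix.GeneralLinearGroup.map (toFin F) q) (lam.map (toFin F)) *
        archFactor k S q lam p
  -- `C q λ` is the family of coefficients of `normalizedForm`; its support consists of symmetric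
  -- matrices because `L` spans the symmetric matrices
  have hsymm : ∀ q lam p, C q lam p ≠ 0 → p.1.IsSymm := by
    intro q lam p hp
    have h1 := (ha _ _ _ _ (left_ne_zero_of_mul hp)).1
    have h2 : p.1 ∈ (Submodule.span ℚ (L (Matrix.GeneralLinearGroup.map (toFin F) q)
      (lam.map (toFin F)) : Set (Matrix (Fin n) (Fin n) F)) : Set (Matrix (Fin n) (Fin n) F)) :=
      Submodule.subset_span h1
    rw [(hL _ _).2] at h2
    exact h2
  have hsum : ∀ q lam (σ : Matrix (Fin n) (Fin n) (AdeleRing (𝓞 F) F)) (hσ : σ.IsSymm)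
      (m : Matrix (Fin l) (Fin n) (AdeleRing (𝓞 F) F)),
      HasSum (fun p => C q lam p * fourierChar p (σ, m)) (normalizedForm S f q lam σ hσ m) :=
    fun q lam => hf.hasSum_normalizedForm hb q lam (hsymm q lam)
      (h _ _ q lam rfl rfl)
  have hcoeff : ∀ t r q lam σ, jacobiCoeff k S c₀ t r q lam σ =
      psi (lamᵀ * toAdele S * lam * σ).trace * C q lam (t, r) :=
    fun t r q lam σ => jacobiCoeff_eq k S c₀ t r q lam σ
  refine ⟨c₀, L, M, fun qh lamh => ⟨hL qh lamh, hM qh lamh, ha qh lamh⟩, ?_, ?_, ?_⟩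
  · intro q lam mu σ hσ
    let i : {t : Matrix (Fin n) (Fin n) F //
        t ∈ L (Matrix.GeneralLinearGroup.map (toFin F) q) (lam.map (toFin F)) ∧ TotNonneg t} ×
        M (Matrix.GeneralLinearGroup.map (toFin F) q) (lam.map (toFin F)) →
      Matrix (Fin n) (Fin n) F × Matrix (Fin l) (Fin n) F := fun p => (p.1.1, p.2.1)
    have hi : Function.Injective i := by
      rintro ⟨⟨t, ht⟩, ⟨r, hr⟩⟩ ⟨⟨t', ht'⟩, ⟨r', hr'⟩⟩ h
      obtain ⟨h1, h2⟩ := Prod.mk.inj h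
      subst h1 h2
      rfl
    -- the series over all pairs `(t, r)` is supported on the lattices
    have h1 := (hsum q lam σ hσ (mu + lam * σ)).mul_left (psi (lamᵀ * toAdele S * lam * σ).trace)
    rw [← apply_siegelElt, ← hi.hasSum_iff] at h1
    · refine h1.congr_fun fun p => ?_
      have e : (toAdele p.2.1)ᵀ * (mu + lam * σ) =
          (toAdele p.2.1)ᵀ * lam * σ + (toAdele p.2.1)ᵀ * mu := by
        rw [Matrix.mul_add, add_comm, Matrix.mul_assoc]
      rw [hcoeff, Function.comp_apply, fourierChar, e]
      simp only [i, mul_assoc]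
    · intro p hp
      have h0 : C q lam p = 0 := by
        by_contra h0
        obtain ⟨h2, h3, h4⟩ := ha _ _ _ _ (left_ne_zero_of_mul h0)
        exact hp ⟨(⟨p.1, h2, h3⟩, ⟨p.2, h4⟩), rfl⟩
      rw [h0, zero_mul, mul_zero]
  · intro A t r q lam σ hσ aA
    have hdet : Matrix.GeneralLinearGroup.det aA =
        Units.map (algebraMap F (AdeleRing (𝓞 F) F)).toMonoidHom
          (Matrix.GeneralLinearGroup.det A) :=
      Units.ext (RingHom.map_det _ _).symm
    have h1 : C (aA * q) (lam * (aA⁻¹).1) (t, r) = C q lam (A.1ᵀ * t * A.1, r * A.1) :=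
      hf.coeff_indexEquiv A q lam (hsymm _ _) (hsymm _ _) (hsum _ _) (hsum _ _) (t, r)
    rw [hcoeff, hcoeff, hdet, hχ.trivial_on_global, trace_conj_eq, h1, Units.val_one, one_mul]
  · intro t r q lam σ hσ hint hne v
    rw [hcoeff] at hne
    have hq : MatHat 1 ((lam * q.1).map (toFin F)) := fun v i j =>
      (mem_locIdeal_one v _).2 (hint v i j)
    exact hf.local_conditions hb hS q lam hq (hsymm q lam) (hsum q lam)
      (right_ne_zero_of_mul hne) v
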